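/- Let $M\subset\mathbb C^2$ be a real-analytic real hypersurface and $p\in M$. Suppose that $M$ is Levi-nonflat at $p$ (every neighbourhood of $p$ contains Levi-nondegenerate points of $M$) and nonminimal at $p$ (there is a germ at $p$ of a nontrivial complex curve $X\subset M$; it is then unique and smooth). Suppose that $p$ is a point of Fuchsian type for $M$. Then every formal infinitesimal automorphism $L\in\mathfrak{hol}^f(M,p)$ is convergent, i.e. both of its coefficients are power series that converge in a neighbourhood of $p$. Here the following terminology is used. (1) A formal infinitesimal automorphism of $M$ at $p$ is a formal holomorphic vector field $L=P\,\partial/\partial z+Q\,\partial/\partial w$, with $P,Q$ formal power series centred at $p$, such that $L+\overline L$ is formally tangent to $M$: for a real-analytic local defining function $\rho$ of $M$ at $p$ (with $\rho(p)=0$, $d\rho(p)\neq0$), with Taylor series $r$ at $p$ in $(z,w,\bar z,\bar w)$, the series $(L+\overline L)r$ is a multiple of $r$ in the ring of formal power series in $(z,w,\bar z,\bar w)$. (2) Suppose first that $M\setminus X$ is Levi-nondegenerate near $p$. Then $M$ is of Fuchsian type at $p$ if, in some local holomorphic coordinates $(z,w)$ with $w=u+iv$ in which $p$ is the origin, $M$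 is given near the origin by a real-analytic equation $$v=u^m\Bigl(\pm|z|^2+\sum_{k,l\ge2}h_{kl}(u)z^k\bar z^l\Bigr),\qquad m\ge1,$$ with $$\operatorname{ord}_0h_{22}\ge m-1,\quad \operatorname{ord}_0h_{23}\ge 2m-2,\quad \operatorname{ord}_0h_{33}\ge 2m-2,\quad \operatorname{ord}_0h_{24}\ge 3m-3,\quad \operatorname{ord}_0h_{34}\ge 3m-3.$$ (3) If $M\setminus X$ is not Levi-nondegenerate near $p$, then $M$ is of Fuchsian type at $p$ if it has a monomial blow-up $M'$ at $p$ such that $M'\setminus\{\eta=0\}$ is Levi-nondegenerate near the origin and $M'$ is of Fuchsian type at the origin in the sense of (2). A monomial blow-up of $M$ at $p$ is a germ at the origin of a real-analytic hypersurface $M'\subset\mathbb C^2_{(\xi,\eta)}$ containing the germ of the complex line $\{\eta=0\}$ such that, in some local holomorphic coordinates near $p$ in which $p$ is the origin, the map $F(\xi,\eta)=(\xi\eta^s,\eta^l)$ with some integers $s,l\ge1$ satisfies $F(M')\subset M$. -/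

import Mathlib

open Filter Topology

noncomputable section

namespace FuchsianCR

/-- The space `ℂ²`, with coordinates `x 0` and `x 1` (usually called `z` and `w`). All notions below
are local, so the choice of the norm does not matter. -/
abbrev C2 : Type := Fin 2 → ℂ

/-! ### Real-analytic hypersurfaces and the Levi form -/

/-- `ρ` is a real-analytic local defining function of `M` near the point `q` of `M`. -/
structure IsDefiningFunctionAt (ρ : C2 → ℝ) (M : Set C2) (q : C2) : Prop where
  analyticAt : AnalyticAt ℝ ρ q
  map_eq_zero : ρ q = 0
  fderiv_ne_zero : fderiv ℝ ρ q ≠ 0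
  eventually_mem_iff : ∀ᶠ x in 𝓝 q, x ∈ M ↔ ρ x = 0

/-- Near its point `p`, the set `M` is a real-analytic (real) hypersurface in `ℂ²`. -/
def IsRealAnalyticHypersurfaceAt (M : Set C2) (p : C2) : Prop :=
  ∃ ρ : C2 → ℝ, IsDefiningFunctionAt ρ M p

/-- The Levi form `∑ ρ_{x_i x̄_j}(q) t_i t̄_j` of `ρ` at `q`, in terms of the real second derivative
of `ρ`. -/
def leviForm (ρ : C2 → ℝ) (q t : C2) : ℝ :=
  (fderiv ℝ (fderiv ℝ ρ) q t t +
    fderiv ℝ (fderiv ℝ ρ) q (Complex.I • t) (Complex.I • t)) / 4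

/-- `t` is tangent, together with `i t`, to the level set of `ρ` through `q`. -/
def IsComplexTangent (ρ : C2 → ℝ) (q t : C2) : Prop :=
  fderiv ℝ ρ q t = 0 ∧ fderiv ℝ ρ q (Complex.I • t) = 0

/-- The hypersurface `M` is Levi-nondegenerate at its point `q`. (The complex tangent space is
one-dimensional, so the Levi form is nondegenerate iff it does not vanish on nonzero vectors.
This does not depend on the choice of the defining function.) -/
def IsLeviNondegenerateAt (M : Set C2) (q : C2) : Prop :=
  ∃ ρ : C2 → ℝ, IsDefiningFunctionAt ρ M q ∧
    ∀ t : C2, t ≠ 0 → IsComplexTangent ρ q t → leviForm ρ q t ≠ 0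

/-- The germ of `M` at `p` is Levi-flat: the Levi form vanishes at all points of `M` near `p`. -/
def IsLeviFlatAt (M : Set C2) (p : C2) : Prop :=
  ∀ᶠ q in 𝓝[M] p, ¬ IsLeviNondegenerateAt M q

/-! ### Complex curves in `M`, nonminimality -/

/-- Near `p`, the set `X` is a complex curve through `p`: the zero set of a holomorphic function
which vanishes at `p` but does not vanish identically near `p`. -/
def IsComplexCurveAt (X : Set C2) (p : C2) : Prop :=
  ∃ f : C2 → ℂ, AnalyticAt ℂ f p ∧ f p = 0 ∧ (¬ ∀ᶠ x in 𝓝 p, f x = 0) ∧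
    ∀ᶠ x in 𝓝 p, x ∈ X ↔ f x = 0

/-- `X` is (near `p`) a complex curve through `p` contained in `M`. When `M` is a real hypersurface,
there is at most one such germ, the complex locus of `M` at `p`. -/
def IsComplexLocusAt (X M : Set C2) (p : C2) : Prop :=
  IsComplexCurveAt X p ∧ ∀ᶠ x in 𝓝 p, x ∈ X → x ∈ M

/-- `M` is nonminimal at `p`: it contains the germ of a nontrivial complex curve through `p`. -/
def IsNonminimalAt (M : Set C2) (p : C2) : Prop :=
  ∃ X : Set C2, IsComplexLocusAt X M p

/-- `M` has a complex locus `X` at `p` and `M \ X` is Levi-nondegenerate near `p`, that is, the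
additional component of the Levi degeneracy set of `M` (besides `X`) is empty near `p`. -/
def IsLeviNondegenerateOffLocusAt (M : Set C2) (p : C2) : Prop :=
  ∃ X : Set C2, IsComplexLocusAt X M p ∧ ∀ᶠ q in 𝓝[M] p, q ∉ X → IsLeviNondegenerateAt M q

/-! ### Fuchsian type -/

/-- `ψ` is (the inverse of) a local holomorphic coordinate system near `p` in which `p` is the
origin: a germ of a biholomorphism `(ℂ², 0) → (ℂ², p)`. -/
structure IsLocalCoordinatesAt (ψ : C2 → C2) (p : C2) : Prop where
  analyticAt : AnalyticAt ℂ ψ 0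
  map_zero : ψ 0 = p
  isInvertible : (fderiv ℂ ψ 0).IsInvertible

/-- In the coordinates `(z, w)` given by `ψ`, with `w = u + i v`, the set `M` is given near the
origin by the real-analytic equation
`v = u ^ m * (ε * |z|² + ∑_{k, l ≥ 2} h_{k l}(u) z ^ k * z̄ ^ l)`. -/
def IsAdmissibleEquation (M : Set C2) (ψ : C2 → C2) (m : ℕ) (ε : ℝ)
    (h : ℕ → ℕ → PowerSeries ℂ) : Prop :=
  (∀ k l, k < 2 ∨ l < 2 → h k l = 0) ∧
  ∃ H : ℂ → ℝ → ℝ,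
    (∀ᶠ x in 𝓝 (0 : C2),
      HasSum (fun n : ℕ × ℕ × ℕ =>
          PowerSeries.coeff n.2.2 (h n.1 n.2.1) * ((x 1).re : ℂ) ^ n.2.2 *
            x 0 ^ n.1 * (starRingEnd ℂ (x 0)) ^ n.2.1)
        ((H (x 0) (x 1).re : ℝ) : ℂ)) ∧
    ∀ᶠ x in 𝓝 (0 : C2),
      ψ x ∈ M ↔ (x 1).im = (x 1).re ^ m * (ε * ‖x 0‖ ^ 2 + H (x 0) (x 1).re)

/-- The Fuchsian condition in admissible coordinates: in some local holomorphic coordinates centred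
at `p`, `M` is given by an admissible equation whose coefficients `h_{k l}` vanish at `0` to the
prescribed orders. -/
def IsFuchsianInAdmissibleCoordinatesAt (M : Set C2) (p : C2) : Prop :=
  ∃ (ψ : C2 → C2) (m : ℕ) (ε : ℝ) (h : ℕ → ℕ → PowerSeries ℂ),
    IsLocalCoordinatesAt ψ p ∧ 1 ≤ m ∧ (ε = 1 ∨ ε = -1) ∧ IsAdmissibleEquation M ψ m ε h ∧
    ((m - 1 : ℕ) : ℕ∞) ≤ (h 2 2).order ∧
    ((2 * (m - 1) : ℕ) : ℕ∞) ≤ (h 2 3).order ∧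
    ((2 * (m - 1) : ℕ) : ℕ∞) ≤ (h 3 3).order ∧
    ((3 * (m - 1) : ℕ) : ℕ∞) ≤ (h 2 4).order ∧
    ((3 * (m - 1) : ℕ) : ℕ∞) ≤ (h 3 4).order

/-- The germ at the origin of `M'` is a monomial blow-up of `M` at `p`: `M'` is a real-analytic
hypersurface containing the germ of the complex line `{η = 0}`, and in some local holomorphic
coordinates centred at `p` the map `(ξ, η) ↦ (ξ * η ^ s, η ^ l)`, `s, l ≥ 1`, sends `M'` into `M`. -/
def IsMonomialBlowUpAt (M' M : Set C2) (p : C2) : Prop :=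
  IsRealAnalyticHypersurfaceAt M' 0 ∧
  (∀ᶠ x in 𝓝 (0 : C2), x 1 = 0 → x ∈ M') ∧
  ∃ (ψ : C2 → C2) (s l : ℕ), IsLocalCoordinatesAt ψ p ∧ 1 ≤ s ∧ 1 ≤ l ∧
    ∀ᶠ x in 𝓝 (0 : C2), x ∈ M' → ψ ![x 0 * x 1 ^ s, x 1 ^ l] ∈ M

/-- `M` is of Fuchsian type at `p`. -/
def IsFuchsianTypeAt (M : Set C2) (p : C2) : Prop :=
  (IsLeviNondegenerateOffLocusAt M p ∧ IsFuchsianInAdmissibleCoordinatesAt M p) ∨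
  (¬ IsLeviNondegenerateOffLocusAt M p ∧
    ∃ M' : Set C2, IsMonomialBlowUpAt M' M p ∧ IsLeviNondegenerateOffLocusAt M' 0 ∧
      IsFuchsianInAdmissibleCoordinatesAt M' 0)

/-! ### Formal infinitesimal automorphisms -/

/-- Formal power series in the variables `x_i` (index `Sum.inl i`) and `x̄_i` (index `Sum.inr i`). -/
abbrev FormalRing : Type := MvPowerSeries (Fin 2 ⊕ Fin 2) ℂ

/-- `r` is the Taylor series of `ρ` at `p` in the variables `x - p` and their conjugates. -/
def IsTaylorSeriesAt (r : FormalRing) (ρ : C2 → ℝ) (p : C2) : Prop :=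
  ∀ᶠ x in 𝓝 (0 : C2),
    HasSum (fun n : Fin 2 ⊕ Fin 2 →₀ ℕ =>
        MvPowerSeries.coeff n r * ((∏ i, x i ^ n (Sum.inl i)) *
          ∏ i, (starRingEnd ℂ (x i)) ^ n (Sum.inr i)))
      ((ρ (p + x) : ℝ) : ℂ)

/-- A formal power series in `x_0, x_1`, as a series in `x, x̄`. -/
def holo (P : MvPowerSeries (Fin 2) ℂ) : FormalRing :=
  MvPowerSeries.rename Sum.inl P

/-- The complex conjugate of a formal power series in `x_0, x_1`, as a series in `x, x̄`. -/
def antiholo (P : MvPowerSeries (Fin 2) ℂ) : FormalRing :=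
  MvPowerSeries.rename Sum.inr (MvPowerSeries.map (starRingEnd ℂ) P)

/-- A formal holomorphic vector field `L = L_0 ∂/∂x_0 + L_1 ∂/∂x_1` at a point `p` of `ℂ²`, given by
its coefficients, formal power series in `x - p`. -/
abbrev FormalVectorField : Type := Fin 2 → MvPowerSeries (Fin 2) ℂ

/-- The series `(L + L̄) r`. -/
def FormalVectorField.applyReal (L : FormalVectorField) (r : FormalRing) : FormalRing :=
  ∑ i, (holo (L i) * MvPowerSeries.pderiv ℂ (Sum.inl i) r +
    antiholo (L i) * MvPowerSeries.pderiv ℂ (Sum.inr i) r)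

/-- `L` is a formal infinitesimal automorphism of `M` at `p`: the field `L + L̄` is formally tangent
to `M`, i.e. for a defining function of `M` with Taylor series `r` at `p`, the series `(L + L̄) r` is
a formal multiple of `r`. -/
def IsFormalInfinitesimalAutomorphismAt (M : Set C2) (p : C2) (L : FormalVectorField) : Prop :=
  ∃ (ρ : C2 → ℝ) (r : FormalRing), IsDefiningFunctionAt ρ M p ∧ IsTaylorSeriesAt r ρ p ∧
    r ∣ L.applyReal r

/-- A formal power series in two variables is convergent (in some neighbourhood of the origin). -/
def IsConvergent (P : MvPowerSeries (Fin 2) ℂ) : Prop :=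
  ∀ᶠ x in 𝓝 (0 : C2),
    Summable (fun n : Fin 2 →₀ ℕ => MvPowerSeries.coeff n P * ∏ i, x i ^ n i)

/-- A formal holomorphic vector field is convergent if its coefficients are. -/
def FormalVectorField.IsConvergent (L : FormalVectorField) : Prop :=
  ∀ i, FuchsianCR.IsConvergent (L i)

end FuchsianCR

end

/-!
The proof pulls the vector field `L` back by a holomorphic map `Ψ` from the hypersurface `v = u ^ m
(± |z|² + ∑ h_{k l}(u) z ^ k z̄ ^ l)` into `M`, shows that the pulled back field satisfies a linear
ordinary differential equation in `u` with a Fuchsian singularity, and descends convergence back to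
`L`.

*Pullback.* `Ψ` is either a coordinate map or, for a blow-up, the composition of a coordinate map of
`M`, of the monomial map `(ξ, η) ↦ (ξ η ^ s, η ^ l)`, and of admissible coordinates of the blow-up.
In the second case `η` is a unit multiple of `w`, because a complex curve through the origin in the
blow-up must be `{w = 0}` (`exists_snd_eq_X_one_mul`). In both cases the Jacobian determinant of `Ψ`
is a power of `w` up to a unit, so that `L` pulls back to a formal field `w⁻ᵏ (p ∂_z + q ∂_w)` with
a pole along `w = 0`. Formal tangency of `L` to `M` becomes tangency of this field to the graph
(`tangency`).

*Components.* With the hypersurface written as `v = u S(z, z̄, u)`, put `γ = q = ∑ γ_k z ^ k` and `π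
= w p = ∑ π_k z ^ k`. The tangency equation is compared at the monomials `z ^ k z̄ ^ l` with `k < 4`
or `l < 4`; modulo the other monomials a third order Taylor expansion of `γ` and `π` in `w` at `w =
u` is exact (`cf_tangency`). The bidegrees `(k, 0)`, `(2, 1)` and `(k, 1)`, `k ≥ 3`, express all
coefficients of `γ` and `π` as series in `z` through `γ_0`, `π_0` and `π_1`. The bidegrees `(1, 1)`,
`(2, 2)`, `(3, 2)` and `(3, 3)` are differential equations for these three.

*The Fuchsian condition.* The lower bounds for the orders of `h_{22}`, `h_{23}`, `h_{33}`, `h_{24}`,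
`h_{34}` are exactly what is needed to divide these four equations by the power of `u` in their
leading terms. Then `π_0`, `π_1`, `γ_0`, their conjugates and some of their derivatives under `u
d/du` span a module over the convergent power series in `u` which is stable under `u d/du`
(`IsTangent.conv_rows`), and formal solutions of such a system `u Y' = A(u) Y` converge
(`conv_of_fuchs_system`).

*Descent.* Hence the pulled back coefficients `L_i ∘ Ψ` converge (`conv_subst_of_dvd`). Composition
with a biholomorphism reflects convergence, and so does composition with the monomial map, which
only moves the coefficients of a power series to other exponents (`conv_of_conv_subst_blowUp`).
-/

open Filter Topology
open MvPowerSeries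
open scoped ENNReal NNReal

noncomputable section

namespace FuchsianCR

/-! ### Convergent power series: weighted norms -/

section Convergence

variable {σ τ : Type*}

/-- The weighted `ℓ¹`-norm `∑ ‖f_n‖ t ^ |n|` of a formal power series. -/
def wnorm (t : ℝ≥0∞) (f : MvPowerSeries σ ℂ) : ℝ≥0∞ :=
  ∑' n : σ →₀ ℕ, ‖coeff n f‖ₑ * t ^ n.degree

/-- A formal power series is convergent if one of its weighted `ℓ¹`-norms is finite. -/
def Conv (f : MvPowerSeries σ ℂ) : Prop :=
  ∃ t : ℝ≥0, 0 < t ∧ wnorm t f ≠ ⊤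

theorem wnorm_mono {s t : ℝ≥0∞} (h : s ≤ t) (f : MvPowerSeries σ ℂ) : wnorm s f ≤ wnorm t f :=
  ENNReal.tsum_le_tsum fun n => by gcongr

theorem wnorm_add_le (t : ℝ≥0∞) (f g : MvPowerSeries σ ℂ) :
    wnorm t (f + g) ≤ wnorm t f + wnorm t g := by
  rw [wnorm, wnorm, wnorm, ← ENNReal.tsum_add]
  refine ENNReal.tsum_le_tsum fun n => ?_
  rw [← add_mul, map_add]
  gcongr
  exact enorm_add_le _ _

theorem wnorm_neg (t : ℝ≥0∞) (f : MvPowerSeries σ ℂ) : wnorm t (-f) = wnorm t f := by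
  simp [wnorm]

theorem wnorm_mul_le (t : ℝ≥0∞) (f g : MvPowerSeries σ ℂ) :
    wnorm t (f * g) ≤ wnorm t f * wnorm t g := by
  classical
  have key : wnorm t f * wnorm t g = ∑' n : σ →₀ ℕ, ∑ q ∈ Finset.HasAntidiagonal.antidiagonal n,
      (‖coeff q.1 f‖ₑ * t ^ q.1.degree) * (‖coeff q.2 g‖ₑ * t ^ q.2.degree) := by
    rw [wnorm, wnorm, ← ENNReal.tsum_mul_right]
    simp_rw [← ENNReal.tsum_mul_left]
    rw [← ENNReal.tsum_prod (f := fun p q : σ →₀ ℕ =>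
      (‖coeff p f‖ₑ * t ^ p.degree) * (‖coeff q g‖ₑ * t ^ q.degree)),
      ← Finset.HasAntidiagonal.sigmaAntidiagonalEquivProd.tsum_eq, ENNReal.tsum_sigma']
    refine tsum_congr fun n => ?_
    rw [tsum_fintype, Finset.sum_coe_sort_eq_attach]
    exact Finset.sum_attach (Finset.HasAntidiagonal.antidiagonal n)
      (fun q : (σ →₀ ℕ) × (σ →₀ ℕ) =>
        (‖coeff q.1 f‖ₑ * t ^ q.1.degree) * (‖coeff q.2 g‖ₑ * t ^ q.2.degree))
  rw [key]
  refine ENNReal.tsum_le_tsum fun n => ?_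
  rw [coeff_mul]
  refine (mul_le_mul_left (enorm_sum_le _ _) _).trans ?_
  rw [Finset.sum_mul]
  refine Finset.sum_le_sum fun q hq => ?_
  rw [Finset.HasAntidiagonal.mem_antidiagonal] at hq
  rw [← hq, map_add, pow_add, enorm_mul]
  exact le_of_eq (by ring)

theorem wnorm_C (t : ℝ≥0∞) (c : ℂ) : wnorm t (C c : MvPowerSeries σ ℂ) = ‖c‖ₑ := by
  classical
  rw [wnorm, tsum_eq_single 0]
  · simp
  · intro n hn
    simp [coeff_C, hn]

theorem wnorm_one (t : ℝ≥0∞) : wnorm t (1 : MvPowerSeries σ ℂ) = 1 := by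
  have := wnorm_C (σ := σ) t 1
  simpa using this

theorem wnorm_X (t : ℝ≥0∞) (i : σ) : wnorm t (X i : MvPowerSeries σ ℂ) = t := by
  classical
  rw [wnorm, tsum_eq_single (Finsupp.single i 1)]
  · simp
  · intro n hn
    simp [coeff_X, hn]

theorem wnorm_pow_le (t : ℝ≥0∞) (f : MvPowerSeries σ ℂ) (n : ℕ) :
    wnorm t (f ^ n) ≤ wnorm t f ^ n := by
  induction n with
  | zero => simp [wnorm_one]
  | succ n ih =>
    rw [pow_succ, pow_succ]
    exact (wnorm_mul_le _ _ _).trans (by gcongr)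

theorem wnorm_prod_le {ι : Type*} (t : ℝ≥0∞) (s : Finset ι) (f : ι → MvPowerSeries σ ℂ) :
    wnorm t (∏ i ∈ s, f i) ≤ ∏ i ∈ s, wnorm t (f i) := by
  classical
  induction s using Finset.induction_on with
  | empty => simp [wnorm_one]
  | insert i s hi ih =>
    rw [Finset.prod_insert hi, Finset.prod_insert hi]
    exact (wnorm_mul_le _ _ _).trans (by gcongr)

theorem mul_wnorm_le {s t : ℝ≥0∞} (h : s ≤ t) {f : MvPowerSeries σ ℂ}
    (hf : constantCoeff f = 0) : t * wnorm s f ≤ s * wnorm t f := by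
  rw [wnorm, wnorm, ← ENNReal.tsum_mul_left, ← ENNReal.tsum_mul_left]
  refine ENNReal.tsum_le_tsum fun n => ?_
  rcases Nat.eq_zero_or_pos n.degree with h0 | h0
  · rw [Finsupp.degree_eq_zero_iff] at h0
    subst h0
    simp [hf]
  · obtain ⟨k, hk⟩ := Nat.exists_eq_succ_of_ne_zero h0.ne'
    rw [hk, pow_succ, pow_succ]
    calc t * (‖coeff n f‖ₑ * (s ^ k * s)) = s * t * (‖coeff n f‖ₑ * s ^ k) := by ring
      _ ≤ s * t * (‖coeff n f‖ₑ * t ^ k) := by gcongr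
      _ = _ := by ring

theorem Conv.exists_wnorm_le {f : MvPowerSeries σ ℂ} (hf : Conv f) (h0 : constantCoeff f = 0)
    {ε : ℝ≥0} (hε : 0 < ε) : ∃ s : ℝ≥0, 0 < s ∧ wnorm s f ≤ ε := by
  obtain ⟨t, ht, hft⟩ := hf
  set B : ℝ≥0 := (wnorm t f).toNNReal with hB
  have hB' : wnorm t f = B := (ENNReal.coe_toNNReal hft).symm
  refine ⟨min t (ε * t / (B + 1)), by positivity, ?_⟩
  have h1 := mul_wnorm_le (σ := σ) (s := ((min t (ε * t / (B + 1)) : ℝ≥0) : ℝ≥0∞)) (t := t)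
    (by exact_mod_cast min_le_left _ _) h0
  rw [hB'] at h1
  have h2 : (t : ℝ≥0∞) * wnorm ((min t (ε * t / (B + 1)) : ℝ≥0) : ℝ≥0∞) f ≤ t * ε := by
    refine h1.trans ?_
    have : min t (ε * t / (B + 1)) * B ≤ t * ε := by
      calc min t (ε * t / (B + 1)) * B ≤ (ε * t / (B + 1)) * (B + 1) := by
            gcongr
            · exact min_le_right _ _
            · simp
        _ = t * ε := by field_simp
    exact_mod_cast this
  exact (ENNReal.mul_le_mul_iff_right (by exact_mod_cast ht.ne') ENNReal.coe_ne_top).1 h2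

/-- Substitution does not increase the weighted norm if the weight of each variable bounds the norm
of the series substituted for it. -/
theorem wnorm_subst_le {a : σ → MvPowerSeries τ ℂ} (ha : HasSubst a) {s t : ℝ≥0∞}
    (has : ∀ i, wnorm t (a i) ≤ s) (f : MvPowerSeries σ ℂ) :
    wnorm t (subst a f) ≤ wnorm s f := by
  have h1 : ∀ e : τ →₀ ℕ, ‖coeff e (subst a f)‖ₑ * t ^ e.degree ≤
      ∑' d : σ →₀ ℕ, ‖coeff d f‖ₑ * (‖coeff e (d.prod fun i k => a i ^ k)‖ₑ * t ^ e.degree) := by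
    intro e
    rw [coeff_subst ha, ← tsum_eq_finsum (L := .unconditional _) (coeff_subst_finite ha f e)]
    simp_rw [← mul_assoc]
    rw [ENNReal.tsum_mul_right]
    gcongr
    refine enorm_tsum_le_tsum_enorm.trans (ENNReal.tsum_le_tsum fun d => ?_)
    rw [smul_eq_mul, enorm_mul]
  refine (ENNReal.tsum_le_tsum h1).trans ?_
  rw [ENNReal.tsum_comm]
  refine ENNReal.tsum_le_tsum fun d => ?_
  rw [ENNReal.tsum_mul_left]
  gcongr
  change wnorm t _ ≤ _
  rw [Finsupp.prod]
  refine (wnorm_prod_le _ _ _).trans ?_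
  rw [Finsupp.degree_apply, ← Finset.prod_pow_eq_pow_sum]
  refine Finset.prod_le_prod' fun i _ => (wnorm_pow_le _ _ _).trans ?_
  gcongr
  exact has i

theorem Conv.add {f g : MvPowerSeries σ ℂ} (hf : Conv f) (hg : Conv g) : Conv (f + g) := by
  obtain ⟨s, hs, hf⟩ := hf
  obtain ⟨t, ht, hg⟩ := hg
  refine ⟨min s t, by positivity, ne_top_of_le_ne_top (ENNReal.add_ne_top.2 ⟨hf, hg⟩)
    ((wnorm_add_le _ _ _).trans ?_)⟩
  gcongr <;> exact wnorm_mono (by simp) _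

theorem Conv.mul {f g : MvPowerSeries σ ℂ} (hf : Conv f) (hg : Conv g) : Conv (f * g) := by
  obtain ⟨s, hs, hf⟩ := hf
  obtain ⟨t, ht, hg⟩ := hg
  refine ⟨min s t, by positivity, ne_top_of_le_ne_top (ENNReal.mul_ne_top hf hg)
    ((wnorm_mul_le _ _ _).trans ?_)⟩
  gcongr <;> exact wnorm_mono (by simp) _

theorem Conv.neg {f : MvPowerSeries σ ℂ} (hf : Conv f) : Conv (-f) := by
  obtain ⟨s, hs, hf⟩ := hf
  exact ⟨s, hs, by rwa [wnorm_neg]⟩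

theorem Conv.sub {f g : MvPowerSeries σ ℂ} (hf : Conv f) (hg : Conv g) : Conv (f - g) :=
  sub_eq_add_neg f g ▸ hf.add hg.neg

theorem conv_C (c : ℂ) : Conv (C c : MvPowerSeries σ ℂ) := ⟨1, one_pos, by simp [wnorm_C]⟩

theorem conv_X (i : σ) : Conv (X i : MvPowerSeries σ ℂ) := ⟨1, one_pos, by simp [wnorm_X]⟩

variable (σ) in
/-- The ring of convergent power series. -/
def convSubring : Subalgebra ℂ (MvPowerSeries σ ℂ) where
  carrier := {f | Conv f}
  mul_mem' := Conv.mul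
  add_mem' := Conv.add
  algebraMap_mem' c := by
    rw [← c_eq_algebraMap]
    exact conv_C c

theorem Conv.pow {f : MvPowerSeries σ ℂ} (hf : Conv f) (n : ℕ) : Conv (f ^ n) :=
  (convSubring σ).pow_mem hf n

theorem Conv.exists_forall_wnorm_le [Fintype σ] {a : σ → MvPowerSeries τ ℂ} (ha : ∀ i, Conv (a i))
    (h0 : ∀ i, constantCoeff (a i) = 0) {ε : ℝ≥0} (hε : 0 < ε) :
    ∃ s : ℝ≥0, 0 < s ∧ ∀ i, wnorm s (a i) ≤ ε := by
  choose s hs hsa using fun i => (ha i).exists_wnorm_le (h0 i) hε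
  rcases isEmpty_or_nonempty σ with h | h
  · exact ⟨1, one_pos, fun i => h.elim i⟩
  · refine ⟨Finset.univ.inf' Finset.univ_nonempty s, by simpa using hs, fun i => ?_⟩
    refine (wnorm_mono ?_ _).trans (hsa i)
    exact_mod_cast Finset.inf'_le _ (Finset.mem_univ i)

theorem Conv.comp [Fintype σ] {f : MvPowerSeries σ ℂ} (hf : Conv f) {a : σ → MvPowerSeries τ ℂ}
    (ha : ∀ i, Conv (a i)) (h0 : ∀ i, constantCoeff (a i) = 0) : Conv (subst a f) := by
  obtain ⟨t, ht, hf⟩ := hf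
  obtain ⟨s, hs, hsa⟩ := Conv.exists_forall_wnorm_le ha h0 ht
  exact ⟨s, hs, ne_top_of_le_ne_top hf (wnorm_subst_le (hasSubst_of_constantCoeff_zero h0) hsa f)⟩

theorem Conv.map_conj {f : MvPowerSeries σ ℂ} (hf : Conv f) :
    Conv (map (starRingEnd ℂ) f) := by
  obtain ⟨t, ht, hf⟩ := hf
  refine ⟨t, ht, ?_⟩
  have : wnorm t (map (starRingEnd ℂ) f) = wnorm t f := by
    simp only [wnorm, coeff_map]
    refine tsum_congr fun n => ?_
    congr 1
    rw [← ofReal_norm, ← ofReal_norm, RCLike.norm_conj]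
  rwa [this]

/-- Partial derivatives of convergent series converge: `|n| ≤ 2 ^ |n|`, so halving the radius
is enough. -/
theorem Conv.pderiv {f : MvPowerSeries σ ℂ} (hf : Conv f) (i : σ) :
    Conv (MvPowerSeries.pderiv ℂ i f) := by
  obtain ⟨t, ht, hf⟩ := hf
  refine ⟨t / 2, by positivity, ?_⟩
  have hle : (t : ℝ≥0∞) * wnorm ((t / 2 : ℝ≥0) : ℝ≥0∞) (MvPowerSeries.pderiv ℂ i f) ≤
      2 * wnorm t f := by
    rw [wnorm, wnorm, ← ENNReal.tsum_mul_left, ← ENNReal.tsum_mul_left]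
    have hinj : Function.Injective fun n : σ →₀ ℕ => n + Finsupp.single i 1 :=
      add_left_injective _
    refine le_trans (ENNReal.tsum_le_tsum fun n => ?_)
      (ENNReal.tsum_comp_le_tsum_of_injective hinj
        fun n => 2 * (‖coeff n f‖ₑ * (t : ℝ≥0∞) ^ n.degree))
    rw [coeff_pderiv, enorm_mul, map_add, Finsupp.degree_single, pow_succ]
    have h1 : ‖((n i : ℂ) + 1)‖ₑ ≤ 2 * 2 ^ n.degree := by
      have : n i + 1 ≤ 2 * 2 ^ n.degree := by
        have h2 : n i ≤ n.degree := Finsupp.le_degree i n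
        have h3 : n.degree < 2 ^ n.degree := Nat.lt_two_pow_self
        omega
      have h4 : ‖((n i : ℂ) + 1)‖ₑ = ((n i + 1 : ℕ) : ℝ≥0∞) := by
        rw [← ofReal_norm, show ((n i : ℂ) + 1) = ((n i + 1 : ℕ) : ℂ) by push_cast; rfl,
          Complex.norm_natCast, ENNReal.ofReal_natCast]
      rw [h4]
      exact_mod_cast this
    have h5 : (2 : ℝ≥0∞) ^ n.degree * ((t / 2 : ℝ≥0) : ℝ≥0∞) ^ n.degree = (t : ℝ≥0∞) ^ n.degree := by
      rw [← mul_pow]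
      congr 1
      have : 2 * (t / 2) = t := by field_simp
      exact_mod_cast this
    calc (t : ℝ≥0∞) * (‖coeff (n + Finsupp.single i 1) f‖ₑ * ‖((n i : ℂ) + 1)‖ₑ *
          ((t / 2 : ℝ≥0) : ℝ≥0∞) ^ n.degree)
        ≤ t * (‖coeff (n + Finsupp.single i 1) f‖ₑ * (2 * 2 ^ n.degree) *
          ((t / 2 : ℝ≥0) : ℝ≥0∞) ^ n.degree) := by gcongr
      _ = 2 * (‖coeff (n + Finsupp.single i 1) f‖ₑ * (((2 : ℝ≥0∞) ^ n.degree *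
          ((t / 2 : ℝ≥0) : ℝ≥0∞) ^ n.degree) * t)) := by ring
      _ = _ := by rw [h5]
  intro htop
  rw [htop, ENNReal.mul_top (by exact_mod_cast ht.ne')] at hle
  exact (ENNReal.mul_ne_top (by simp) hf) (top_le_iff.1 hle)

end Convergence

/-! ### Evaluation of convergent power series -/

section Evaluation

variable {σ τ : Type*}

theorem wnorm_pow_ne_top {t : ℝ≥0∞} {f : MvPowerSeries σ ℂ} (hf : wnorm t f ≠ ⊤) (k : ℕ) :
    wnorm t (f ^ k) ≠ ⊤ :=
  ne_top_of_le_ne_top (ENNReal.pow_ne_top hf) (wnorm_pow_le t f k)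

theorem wnorm_prod_ne_top {ι : Type*} {t : ℝ≥0∞} {s : Finset ι} {f : ι → MvPowerSeries σ ℂ}
    (hf : ∀ i, wnorm t (f i) ≠ ⊤) : wnorm t (∏ i ∈ s, f i) ≠ ⊤ :=
  ne_top_of_le_ne_top (ENNReal.prod_ne_top fun i _ => hf i) (wnorm_prod_le t s f)

variable [Fintype σ] [Fintype τ]

/-- The value of a power series at a point; meaningful only where the series converges. -/
def ev (x : σ → ℂ) (f : MvPowerSeries σ ℂ) : ℂ :=
  ∑' n : σ →₀ ℕ, coeff n f * ∏ i, x i ^ n i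

theorem enorm_term_le {t : ℝ≥0∞} {x : σ → ℂ} (hx : ∀ i, ‖x i‖ₑ ≤ t) (f : MvPowerSeries σ ℂ)
    (n : σ →₀ ℕ) : ‖coeff n f * ∏ i, x i ^ n i‖ₑ ≤ ‖coeff n f‖ₑ * t ^ n.degree := by
  rw [enorm_mul]
  gcongr
  rw [Finsupp.degree_eq_sum, ← Finset.prod_pow_eq_pow_sum]
  rw [← ofReal_norm, norm_prod, ENNReal.ofReal_prod_of_nonneg (fun _ _ => norm_nonneg _)]
  refine Finset.prod_le_prod' fun i _ => ?_
  rw [ofReal_norm, enorm_pow]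
  gcongr
  exact hx i

theorem summable_norm_of_wnorm {t : ℝ≥0∞} {f : MvPowerSeries σ ℂ} (hf : wnorm t f ≠ ⊤)
    {x : σ → ℂ} (hx : ∀ i, ‖x i‖ₑ ≤ t) :
    Summable fun n : σ →₀ ℕ => ‖coeff n f * ∏ i, x i ^ n i‖ := by
  have h : ∑' n : σ →₀ ℕ, ‖coeff n f * ∏ i, x i ^ n i‖ₑ ≠ ⊤ :=
    ne_top_of_le_ne_top hf (ENNReal.tsum_le_tsum (enorm_term_le hx f))
  simp only [enorm_eq_nnnorm] at h
  rw [ENNReal.tsum_coe_ne_top_iff_summable] at h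
  exact NNReal.summable_coe.2 h

theorem hasSum_ev {t : ℝ≥0∞} {f : MvPowerSeries σ ℂ} (hf : wnorm t f ≠ ⊤)
    {x : σ → ℂ} (hx : ∀ i, ‖x i‖ₑ ≤ t) :
    HasSum (fun n : σ →₀ ℕ => coeff n f * ∏ i, x i ^ n i) (ev x f) :=
  (summable_norm_of_wnorm hf hx).of_norm.hasSum

theorem enorm_ev_le {t : ℝ≥0∞} {f : MvPowerSeries σ ℂ} {x : σ → ℂ} (hx : ∀ i, ‖x i‖ₑ ≤ t) :
    ‖ev x f‖ₑ ≤ wnorm t f :=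
  enorm_tsum_le_tsum_enorm.trans (ENNReal.tsum_le_tsum (enorm_term_le hx f))

theorem ev_C_mul (c : ℂ) (f : MvPowerSeries σ ℂ) (x : σ → ℂ) : ev x (C c * f) = c * ev x f := by
  rw [ev, ev, ← tsum_mul_left]
  exact tsum_congr fun n => by rw [coeff_C_mul, mul_assoc]

theorem ev_mul {t : ℝ≥0∞} {f g : MvPowerSeries σ ℂ} (hf : wnorm t f ≠ ⊤) (hg : wnorm t g ≠ ⊤)
    {x : σ → ℂ} (hx : ∀ i, ‖x i‖ₑ ≤ t) : ev x (f * g) = ev x f * ev x g := by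
  classical
  have hsf := summable_norm_of_wnorm hf hx
  have hsg := summable_norm_of_wnorm hg hx
  have hterm : ∀ n : σ →₀ ℕ, coeff n (f * g) * ∏ i, x i ^ n i =
      ∑ q ∈ Finset.HasAntidiagonal.antidiagonal n,
        (coeff q.1 f * ∏ i, x i ^ q.1 i) * (coeff q.2 g * ∏ i, x i ^ q.2 i) := by
    intro n
    rw [coeff_mul, Finset.sum_mul]
    refine Finset.sum_congr rfl fun q hq => ?_
    obtain rfl := Finset.HasAntidiagonal.mem_antidiagonal.1 hq
    have : ∏ i, x i ^ (q.1 + q.2) i = (∏ i, x i ^ q.1 i) * ∏ i, x i ^ q.2 i := by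
      rw [← Finset.prod_mul_distrib]
      exact Finset.prod_congr rfl fun i _ => by rw [Finsupp.add_apply, pow_add]
    rw [this]
    exact mul_mul_mul_comm _ _ _ _
  calc ev x (f * g) = ∑' n : σ →₀ ℕ, ∑ q ∈ Finset.HasAntidiagonal.antidiagonal n,
        (coeff q.1 f * ∏ i, x i ^ q.1 i) * (coeff q.2 g * ∏ i, x i ^ q.2 i) := tsum_congr hterm
    _ = _ := (hsf.of_norm.tsum_mul_tsum_eq_tsum_sum_antidiagonal hsg.of_norm
      (summable_mul_of_summable_norm (f := fun n : σ →₀ ℕ => coeff n f * ∏ i, x i ^ n i)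
        (g := fun n : σ →₀ ℕ => coeff n g * ∏ i, x i ^ n i) hsf hsg)).symm

theorem ev_C (c : ℂ) (x : σ → ℂ) : ev x (C c : MvPowerSeries σ ℂ) = c := by
  classical
  rw [ev, tsum_eq_single 0]
  · simp
  · intro n hn
    simp [coeff_C, hn]

theorem ev_one (x : σ → ℂ) : ev x (1 : MvPowerSeries σ ℂ) = 1 := by
  simpa using ev_C (σ := σ) 1 x

theorem ev_zero (x : σ → ℂ) : ev x (0 : MvPowerSeries σ ℂ) = 0 := by
  simpa using ev_C (σ := σ) 0 x

theorem ev_X (i : σ) (x : σ → ℂ) : ev x (X i : MvPowerSeries σ ℂ) = x i := by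
  classical
  rw [ev, tsum_eq_single (Finsupp.single i 1)]
  · rw [coeff_index_single_self_X, one_mul, Finset.prod_eq_single i]
    · simp
    · intro j _ hj
      simp [hj.symm]
    · simp
  · intro n hn
    simp [coeff_X, hn]

theorem ev_pow {t : ℝ≥0∞} {f : MvPowerSeries σ ℂ} (hf : wnorm t f ≠ ⊤)
    {x : σ → ℂ} (hx : ∀ i, ‖x i‖ₑ ≤ t) (k : ℕ) : ev x (f ^ k) = ev x f ^ k := by
  induction k with
  | zero => simp [ev_one]
  | succ k ih => rw [pow_succ, pow_succ, ev_mul (wnorm_pow_ne_top hf k) hf hx, ih]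

theorem ev_prod {ι : Type*} {t : ℝ≥0∞} {s : Finset ι} {f : ι → MvPowerSeries σ ℂ}
    (hf : ∀ i, wnorm t (f i) ≠ ⊤) {x : σ → ℂ} (hx : ∀ i, ‖x i‖ₑ ≤ t) :
    ev x (∏ i ∈ s, f i) = ∏ i ∈ s, ev x (f i) := by
  classical
  induction s using Finset.induction_on with
  | empty => simp [ev_one]
  | insert i s hi ih =>
    rw [Finset.prod_insert hi, Finset.prod_insert hi, ev_mul (hf i) (wnorm_prod_ne_top hf) hx, ih]

theorem ev_subst {a : σ → MvPowerSeries τ ℂ} (ha : HasSubst a) {s t : ℝ≥0∞} (hs : s ≠ ⊤)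
    (has : ∀ i, wnorm t (a i) ≤ s) {f : MvPowerSeries σ ℂ} (hf : wnorm s f ≠ ⊤)
    {x : τ → ℂ} (hx : ∀ i, ‖x i‖ₑ ≤ t) :
    ev x (subst a f) = ev (fun i => ev x (a i)) f := by
  have hat : ∀ i, wnorm t (a i) ≠ ⊤ := fun i => ne_top_of_le_ne_top hs (has i)
  have hprod : ∀ d : σ →₀ ℕ, (d.prod fun i k => a i ^ k) = ∏ i, a i ^ d i := fun d =>
    Finsupp.prod_fintype _ _ (fun i => pow_zero _)
  have hevd : ∀ d : σ →₀ ℕ, ∑' e : τ →₀ ℕ, coeff d f * coeff e (∏ i, a i ^ d i) *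
      ∏ j, x j ^ e j = coeff d f * ∏ i, ev x (a i) ^ d i := by
    intro d
    simp_rw [mul_assoc]
    rw [tsum_mul_left]
    congr 1
    change ev x _ = _
    rw [ev_prod (fun i => wnorm_pow_ne_top (hat i) _) hx]
    exact Finset.prod_congr rfl fun i _ => ev_pow (hat i) hx _
  have hsum : Summable (Function.uncurry fun (e : τ →₀ ℕ) (d : σ →₀ ℕ) =>
      coeff d f * coeff e (∏ i, a i ^ d i) * ∏ j, x j ^ e j) := by
    refine Summable.of_norm ?_
    have h : ∑' q : (τ →₀ ℕ) × (σ →₀ ℕ), ‖coeff q.2 f * coeff q.1 (∏ i, a i ^ q.2 i) *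
        ∏ j, x j ^ q.1 j‖ₑ ≠ ⊤ := by
      refine ne_top_of_le_ne_top hf ?_
      rw [ENNReal.tsum_prod (f := fun (e : τ →₀ ℕ) (d : σ →₀ ℕ) =>
        ‖coeff d f * coeff e (∏ i, a i ^ d i) * ∏ j, x j ^ e j‖ₑ), ENNReal.tsum_comm]
      refine ENNReal.tsum_le_tsum fun d => ?_
      simp_rw [mul_assoc, enorm_mul (coeff d f)]
      rw [ENNReal.tsum_mul_left]
      gcongr
      refine (ENNReal.tsum_le_tsum (enorm_term_le hx _)).trans ?_
      refine (wnorm_prod_le _ _ _).trans ?_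
      rw [Finsupp.degree_eq_sum, ← Finset.prod_pow_eq_pow_sum]
      refine Finset.prod_le_prod' fun i _ => (wnorm_pow_le _ _ _).trans ?_
      gcongr
      exact has i
    simp only [enorm_eq_nnnorm] at h
    rw [ENNReal.tsum_coe_ne_top_iff_summable] at h
    exact NNReal.summable_coe.2 h
  calc ev x (subst a f) = ∑' e : τ →₀ ℕ, ∑' d : σ →₀ ℕ,
        coeff d f * coeff e (∏ i, a i ^ d i) * ∏ j, x j ^ e j := by
        refine tsum_congr fun e => ?_
        rw [tsum_mul_right, coeff_subst ha,
          ← tsum_eq_finsum (L := .unconditional _) (coeff_subst_finite ha f e)]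
        simp only [hprod, smul_eq_mul]
    _ = ∑' d : σ →₀ ℕ, ∑' e : τ →₀ ℕ,
        coeff d f * coeff e (∏ i, a i ^ d i) * ∏ j, x j ^ e j := hsum.tsum_comm.symm
    _ = _ := tsum_congr hevd

theorem eventually_enorm_le {t : ℝ≥0} (ht : 0 < t) :
    ∀ᶠ x in 𝓝 (0 : σ → ℂ), ∀ i, ‖x i‖ₑ ≤ t := by
  filter_upwards [Metric.ball_mem_nhds (0 : σ → ℂ) (show (0 : ℝ) < t by exact_mod_cast ht)]
    with x hx i
  rw [mem_ball_zero_iff] at hx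
  have := (norm_le_pi_norm x i).trans hx.le
  rw [enorm_eq_nnnorm]
  exact_mod_cast this

theorem Conv.eventually_hasSum {f : MvPowerSeries σ ℂ} (hf : Conv f) :
    ∀ᶠ x in 𝓝 (0 : σ → ℂ), HasSum (fun n : σ →₀ ℕ => coeff n f * ∏ i, x i ^ n i) (ev x f) := by
  obtain ⟨t, ht, hf⟩ := hf
  filter_upwards [eventually_enorm_le ht] with x hx using hasSum_ev hf hx

theorem Conv.eventually_ev_add {f g : MvPowerSeries σ ℂ} (hf : Conv f) (hg : Conv g) :
    ∀ᶠ x in 𝓝 (0 : σ → ℂ), ev x (f + g) = ev x f + ev x g := by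
  filter_upwards [hf.eventually_hasSum, hg.eventually_hasSum] with x h1 h2
  rw [ev, ← (h1.add h2).tsum_eq]
  exact tsum_congr fun n => by rw [map_add, add_mul]

theorem Conv.eventually_ev_mul {f g : MvPowerSeries σ ℂ} (hf : Conv f) (hg : Conv g) :
    ∀ᶠ x in 𝓝 (0 : σ → ℂ), ev x (f * g) = ev x f * ev x g := by
  obtain ⟨s, hs, hf⟩ := hf
  obtain ⟨t, ht, hg⟩ := hg
  filter_upwards [eventually_enorm_le (lt_min hs ht)] with x hx
  exact ev_mul (t := (min s t : ℝ≥0)) (ne_top_of_le_ne_top hf (wnorm_mono (by simp) _))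
    (ne_top_of_le_ne_top hg (wnorm_mono (by simp) _)) hx

theorem Conv.tendsto_ev {f : MvPowerSeries σ ℂ} (hf : Conv f) (h0 : constantCoeff f = 0) :
    Tendsto (fun x => ev x f) (𝓝 0) (𝓝 0) := by
  rw [Metric.tendsto_nhds]
  intro ε hε
  obtain ⟨s, hs, hsf⟩ := hf.exists_wnorm_le h0 (ε := (ε / 2).toNNReal) (by simpa using hε)
  filter_upwards [eventually_enorm_le hs] with x hx
  have h := (enorm_ev_le hx).trans hsf
  rw [dist_zero_right]
  rw [enorm_eq_nnnorm, ENNReal.coe_le_coe, ← NNReal.coe_le_coe, coe_nnnorm,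
    Real.coe_toNNReal _ (by positivity)] at h
  linarith

theorem Conv.eventually_ev_subst {f : MvPowerSeries σ ℂ} (hf : Conv f) {a : σ → MvPowerSeries τ ℂ}
    (ha : ∀ i, Conv (a i)) (h0 : ∀ i, constantCoeff (a i) = 0) :
    ∀ᶠ x in 𝓝 (0 : τ → ℂ), ev x (subst a f) = ev (fun i => ev x (a i)) f := by
  obtain ⟨t, ht, hf⟩ := hf
  obtain ⟨s, hs, hsa⟩ := Conv.exists_forall_wnorm_le ha h0 ht
  filter_upwards [eventually_enorm_le hs] with x hx
  exact ev_subst (hasSubst_of_constantCoeff_zero h0) ENNReal.coe_ne_top hsa hf hx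

/-- Absolute convergence at one point of the open positive diagonal is convergence. -/
theorem conv_of_summable {f : MvPowerSeries σ ℂ} {t : ℝ≥0} (ht : 0 < t)
    (h : Summable fun n : σ →₀ ℕ => coeff n f * ∏ i : σ, ((t : ℝ) : ℂ) ^ n i) : Conv f := by
  refine ⟨t, ht, ?_⟩
  have h2 : wnorm t f = ∑' n : σ →₀ ℕ, ‖coeff n f * ∏ i : σ, ((t : ℝ) : ℂ) ^ n i‖ₑ := by
    refine tsum_congr fun n => ?_
    rw [enorm_mul, Finset.prod_pow_eq_pow_sum, ← Finsupp.degree_eq_sum, enorm_pow]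
    congr 2
    rw [enorm_eq_nnnorm, Complex.nnnorm_real]
    simp
  rw [h2]
  simp only [enorm_eq_nnnorm]
  rw [ENNReal.tsum_coe_ne_top_iff_summable]
  exact NNReal.summable_coe.1 h.norm

theorem conv_of_eventually_summable {f : MvPowerSeries σ ℂ}
    (h : ∀ᶠ x in 𝓝 (0 : σ → ℂ), Summable fun n : σ →₀ ℕ => coeff n f * ∏ i, x i ^ n i) :
    Conv f := by
  obtain ⟨ε, hε, hb⟩ := Metric.eventually_nhds_iff.1 h
  have hε2 : 0 < ε / 2 := by positivity
  refine conv_of_summable (t := (ε / 2).toNNReal) (by simpa using hε2)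
    (hb (y := fun _ => (((ε / 2).toNNReal : ℝ) : ℂ)) ?_)
  rw [dist_zero_right, Real.coe_toNNReal _ hε2.le]
  refine lt_of_le_of_lt ((pi_norm_le_iff_of_nonneg hε2.le).2 fun i => ?_) (half_lt_self hε)
  rw [Complex.norm_real, Real.norm_of_nonneg hε2.le]

theorem conv_iff_isConvergent (f : MvPowerSeries (Fin 2) ℂ) : Conv f ↔ IsConvergent f :=
  ⟨fun h => h.eventually_hasSum.mono fun _ hx => hx.summable, conv_of_eventually_summable⟩

/-- A sequence is zero if its power series vanishes for all small positive real arguments. -/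
theorem eq_zero_of_hasSum_zero {p : ℕ → ℂ}
    (h : ∀ s : ℝ, 0 < s → s ≤ 1 → HasSum (fun d => p d * (s : ℂ) ^ d) 0) : p = 0 := by
  set q := FormalMultilinearSeries.ofScalars ℂ p with hq
  have hsum1 : Summable p := by simpa using (h 1 one_pos le_rfl).summable
  have hrad : 0 < q.radius := by
    refine lt_of_lt_of_le one_pos (q.le_radius_of_summable_norm (r := 1) ?_)
    simp only [NNReal.coe_one, one_pow, mul_one]
    exact Summable.of_nonneg_of_le (fun _ => norm_nonneg _)
      (fun n => (FormalMultilinearSeries.ofScalars_norm (E := ℂ) p n).le) hsum1.norm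
  have hball := q.hasFPowerSeriesOnBall hrad
  have hz : ∀ s : ℝ, 0 < s → s ≤ 1 → q.sum (s : ℂ) = 0 := by
    intro s h1 h2
    rw [← (h s h1 h2).tsum_eq]
    refine tsum_congr fun n => ?_
    simp [hq, FormalMultilinearSeries.ofScalars]
  have hfreq : ∃ᶠ z in 𝓝[≠] (0 : ℂ), q.sum z = 0 := by
    have ht : Tendsto (fun n : ℕ => (((1 / ((n : ℝ) + 1) : ℝ)) : ℂ)) atTop (𝓝[≠] 0) := by
      refine tendsto_nhdsWithin_iff.2 ⟨?_, Eventually.of_forall fun n => ?_⟩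
      · have h := (Complex.continuous_ofReal.tendsto 0).comp
          (tendsto_one_div_add_atTop_nhds_zero_nat (𝕜 := ℝ))
        rwa [Complex.ofReal_zero] at h
      · simp only [Set.mem_compl_iff, Set.mem_singleton_iff, Complex.ofReal_eq_zero]
        positivity
    refine ht.frequently (Frequently.of_forall fun n => hz _ (by positivity) ?_)
    rw [div_le_one (by positivity)]
    simp
  have hev := hball.analyticAt.frequently_zero_iff_eventually_zero.1 hfreq
  have h0 : q = 0 := (hball.hasFPowerSeriesAt.congr hev).eq_zero
  ext n
  have := congrArg (fun r => FormalMultilinearSeries.coeff r n) h0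
  rw [hq, FormalMultilinearSeries.coeff_ofScalars] at this
  rw [this]
  rfl

/-- A convergent power series which vanishes at all small real points is zero. -/
theorem Conv.eq_zero_of_real {f : MvPowerSeries σ ℂ} (hf : Conv f) {δ : ℝ} (hδ : 0 < δ)
    (h : ∀ y : σ → ℝ, (∀ i, 0 < y i ∧ y i < δ) → ev (fun i => (y i : ℂ)) f = 0) : f = 0 := by
  classical
  obtain ⟨t, ht, hf⟩ := hf
  have ht' : (0 : ℝ) < t := by exact_mod_cast ht
  set ε := min δ t with hε
  have hε0 : 0 < ε := lt_min hδ ht'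
  ext n
  set d := n.degree with hd
  set q : MvPolynomial σ ℂ :=
    ∑ m ∈ Finset.finsuppAntidiag Finset.univ d, MvPolynomial.monomial m (coeff m f) with hq
  have hfin : (Finsupp.degree ⁻¹' {d} : Set (σ →₀ ℕ)) =
      ↑(Finset.finsuppAntidiag (Finset.univ : Finset σ) d) := by
    ext m
    simp [Finset.mem_finsuppAntidiag, Finsupp.degree_eq_sum]
  have hq0 : q = 0 := by
    refine MvPolynomial.funext_set (fun _ => (fun r : ℝ => (r : ℂ)) '' Set.Ioo 0 ε)
      (fun _ => (Set.Ioo_infinite hε0).image Complex.ofReal_injective.injOn) fun x hx => ?_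
    choose y hy hyx using fun i => hx i (Set.mem_univ i)
    obtain rfl : (fun i => (y i : ℂ)) = x := funext hyx
    have hp := congrFun (eq_zero_of_hasSum_zero
      (p := fun d => ∑' b : (Finsupp.degree ⁻¹' {d} : Set (σ →₀ ℕ)),
        coeff b.1 f * ∏ i, (y i : ℂ) ^ b.1 i) fun s hs0 hs1 => ?_) d
    · rw [hq, map_sum, map_zero]
      simp only [MvPolynomial.eval_monomial]
      refine Eq.trans ?_ hp
      rw [hfin]
      rw [Finset.tsum_subtype' (Finset.finsuppAntidiag (Finset.univ : Finset σ) d)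
        (fun b => coeff b f * ∏ i, (y i : ℂ) ^ b i)]
      exact Finset.sum_congr rfl fun m _ => by
        rw [Finsupp.prod_fintype _ _ (fun i => pow_zero _)]
    · have hsy : ∀ i, 0 < s * y i ∧ s * y i < ε := fun i =>
        ⟨mul_pos hs0 (hy i).1, by nlinarith [(hy i).1, (hy i).2]⟩
      have h1 := hasSum_ev (t := t) hf (x := fun i => ((s * y i : ℝ) : ℂ)) fun i => by
        rw [enorm_eq_nnnorm]
        have : ‖((s * y i : ℝ) : ℂ)‖ ≤ t := by
          rw [Complex.norm_real, Real.norm_of_nonneg (hsy i).1.le]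
          exact ((hsy i).2.trans_le (min_le_right _ _)).le
        exact_mod_cast this
      rw [h (fun i => s * y i) fun i => ⟨(hsy i).1, (hsy i).2.trans_le (min_le_left _ _)⟩] at h1
      refine (congrArg (HasSum · (0 : ℂ)) (funext fun d => ?_)).mp (h1.tsum_fiberwise Finsupp.degree)
      rw [← tsum_mul_right]
      refine tsum_congr fun b => ?_
      have hb : (s : ℂ) ^ d = (s : ℂ) ^ b.1.degree := congrArg _ (b.2 : b.1.degree = d).symm
      rw [hb, Finsupp.degree_eq_sum, mul_assoc, ← Finset.prod_pow_eq_pow_sum,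
        ← Finset.prod_mul_distrib]
      congr 1
      exact Finset.prod_congr rfl fun i _ => by
        rw [← mul_pow, Complex.ofReal_mul, mul_comm]
  have := congrArg (MvPolynomial.coeff n) hq0
  rw [hq, MvPolynomial.coeff_sum] at this
  simp only [MvPolynomial.coeff_monomial, MvPolynomial.coeff_zero] at this
  rw [Finset.sum_ite_eq' , if_pos] at this
  · simpa using this
  · rw [← Finset.mem_coe, ← hfin]
    rfl

end Evaluation

/-! ### Identity theorems, Taylor series and Fuchsian systems -/

section AnalyticSeries

variable {σ : Type*}

/-- The exponent of the monomial `x_{s 1} ⋯ x_{s k}`. -/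
def wordDegree (q : Σ k : ℕ, Fin k → σ) : σ →₀ ℕ :=
  ∑ j, Finsupp.single (q.2 j) 1

theorem degree_wordDegree (q : Σ k : ℕ, Fin k → σ) : (wordDegree q).degree = q.1 := by
  simp [wordDegree, map_sum]

variable [Fintype σ]

theorem Conv.eq_zero_of_eventually_real {f : MvPowerSeries σ ℂ} (hf : Conv f)
    (h : ∀ᶠ y in 𝓝 (0 : σ → ℝ), ev (fun i => (y i : ℂ)) f = 0) : f = 0 := by
  obtain ⟨δ, hδ, hb⟩ := Metric.eventually_nhds_iff.1 h
  refine hf.eq_zero_of_real (half_pos hδ) fun y hy => hb ?_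
  rw [dist_zero_right]
  refine lt_of_le_of_lt ((pi_norm_le_iff_of_nonneg (half_pos hδ).le).2 fun i => ?_)
    (half_lt_self hδ)
  rw [Real.norm_of_nonneg (hy i).1.le]
  exact (hy i).2.le

theorem Conv.eq_zero_of_eventually {f : MvPowerSeries σ ℂ} (hf : Conv f)
    (h : ∀ᶠ x in 𝓝 (0 : σ → ℂ), ev x f = 0) : f = 0 := by
  refine hf.eq_zero_of_eventually_real ?_
  have hc : Continuous fun y : σ → ℝ => fun i => (y i : ℂ) := by fun_prop
  have := hc.tendsto 0
  simp only [Pi.zero_apply, Complex.ofReal_zero] at this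
  exact this.eventually h

/-- The points `(t, z, z̄, u)` with `t`, `u` real form a maximally totally real subspace of `ℂ⁴`:
a convergent power series vanishing on it vanishes. -/
theorem Conv.eq_zero_of_conj {f : MvPowerSeries (Fin 4) ℂ} (hf : Conv f)
    (h : ∀ᶠ q in 𝓝 (0 : ℂ × ℝ × ℝ),
      ev ![(q.2.1 : ℂ), q.1, starRingEnd ℂ q.1, (q.2.2 : ℂ)] f = 0) : f = 0 := by
  set a : Fin 4 → MvPowerSeries (Fin 4) ℂ :=
    ![X 0, X 1 + C Complex.I * X 2, X 1 - C Complex.I * X 2, X 3] with ha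
  set b : Fin 4 → MvPowerSeries (Fin 4) ℂ :=
    ![X 0, C (1 / 2) * (X 1 + X 2), C (1 / (2 * Complex.I)) * (X 1 - X 2), X 3] with hb
  have ha0 : ∀ i, constantCoeff (a i) = 0 := by
    intro i; fin_cases i <;> simp [ha]
  have hb0 : ∀ i, constantCoeff (b i) = 0 := by
    intro i; fin_cases i <;> simp [hb]
  have hac : ∀ i, Conv (a i) := by
    intro i
    fin_cases i
    exacts [conv_X _, (conv_X _).add ((conv_C _).mul (conv_X _)),
      (conv_X _).sub ((conv_C _).mul (conv_X _)), conv_X _]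
  have hF : Conv (subst a f) := hf.comp hac ha0
  have hF0 : subst a f = 0 := by
    refine hF.eq_zero_of_eventually_real ?_
    have hcont : Tendsto (fun y : Fin 4 → ℝ => ((y 1 + Complex.I * y 2, y 0, y 3) : ℂ × ℝ × ℝ))
        (𝓝 0) (𝓝 0) := by
      have : Continuous fun y : Fin 4 → ℝ => ((y 1 + Complex.I * y 2, y 0, y 3) : ℂ × ℝ × ℝ) := by
        fun_prop
      simpa [Prod.zero_eq_mk] using this.tendsto 0
    have hcr : Tendsto (fun y : Fin 4 → ℝ => fun i => (y i : ℂ)) (𝓝 0) (𝓝 0) := by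
      have : Continuous fun y : Fin 4 → ℝ => fun i => (y i : ℂ) := by fun_prop
      have h2 := this.tendsto 0
      simp only [Pi.zero_apply, Complex.ofReal_zero] at h2
      exact h2
    have hadd := hcr.eventually
      ((conv_X (1 : Fin 4)).eventually_ev_add ((conv_C Complex.I).mul (conv_X 2)))
    have hsub := hcr.eventually
      ((conv_X (1 : Fin 4)).eventually_ev_add ((conv_C (-Complex.I)).mul (conv_X 2)))
    filter_upwards [hcont.eventually h, hcr.eventually (hf.eventually_ev_subst hac ha0), hadd, hsub]
      with y h1 h2 h3 h4
    rw [h2, ← h1]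
    congr 1
    funext i
    fin_cases i
    · exact ev_X _ _
    · have : a 1 = X 1 + C Complex.I * X 2 := rfl
      simp only [Fin.mk_one, this]
      rw [h3, ev_C_mul, ev_X, ev_X]
      rfl
    · have : a 2 = X 1 + C (-Complex.I) * X 2 := by
        simp [ha, sub_eq_add_neg]
      simp only [Fin.reduceFinMk, this]
      rw [h4, ev_C_mul, ev_X, ev_X]
      simp [Complex.conj_ofReal]
    · exact ev_X _ _
  have hsubst := hasSubst_of_constantCoeff_zero ha0
  have hsubstb := hasSubst_of_constantCoeff_zero hb0
  have hX : (fun s => subst b (a s)) = (X : Fin 4 → MvPowerSeries (Fin 4) ℂ) := by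
    have hC : ∀ c : ℂ, subst b (C c : MvPowerSeries (Fin 4) ℂ) = C c := fun c => subst_C c
    funext s
    have h1 : b 1 = C (1 / 2) * (X 1 + X 2) := rfl
    have h2 : b 2 = C (1 / (2 * Complex.I)) * (X 1 - X 2) := rfl
    have hI : (C Complex.I : MvPowerSeries (Fin 4) ℂ) * C (1 / (2 * Complex.I)) = C (1 / 2) := by
      rw [← map_mul]
      congr 1
      field_simp
    have hhalf : (C (1 / 2) : MvPowerSeries (Fin 4) ℂ) * 2 = 1 := by
      rw [← map_ofNat C 2, ← map_mul]
      norm_num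
    fin_cases s
    · exact subst_X hsubstb _
    · change subst b (X 1 + C Complex.I * X 2) = X 1
      rw [subst_add hsubstb, subst_mul hsubstb, hC, subst_X hsubstb, subst_X hsubstb, h1, h2]
      linear_combination (X 1 - X 2) * hI + X 1 * hhalf
    · change subst b (X 1 - C Complex.I * X 2) = X 2
      rw [subst_sub hsubstb, subst_mul hsubstb, hC, subst_X hsubstb, subst_X hsubstb, h1, h2]
      linear_combination -(X 1 - X 2) * hI + X 2 * hhalf
    · exact subst_X hsubstb _
  have := subst_comp_subst_apply hsubst hsubstb f
  rw [hF0, hX, subst_self] at this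
  rw [← coe_substAlgHom hsubstb, map_zero] at this
  exact this.symm

theorem prod_pow_wordDegree (x : σ → ℂ) (q : Σ k : ℕ, Fin k → σ) :
    ∏ i, x i ^ wordDegree q i = ∏ j, x (q.2 j) := by
  classical
  have h : ∀ i, x i ^ wordDegree q i = ∏ j, x i ^ (Finsupp.single (q.2 j) 1 : σ →₀ ℕ) i := by
    intro i
    rw [Finset.prod_pow_eq_pow_sum, wordDegree, Finsupp.finsetSum_apply]
  simp_rw [h]
  rw [Finset.prod_comm]
  refine Finset.prod_congr rfl fun j _ => ?_
  rw [Finset.prod_eq_single (q.2 j)]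
  · simp
  · intro i _ hi
    simp [hi.symm]
  · simp

/-- A holomorphic function has a convergent Taylor series: expand the multilinear terms of its
Fréchet power series in coordinates and collect equal monomials. -/
theorem exists_conv_of_analyticAt {f : (σ → ℂ) → ℂ} (hf : AnalyticAt ℂ f 0) :
    ∃ g : MvPowerSeries σ ℂ, Conv g ∧ ∀ᶠ x in 𝓝 (0 : σ → ℂ), ev x g = f x := by
  classical
  obtain ⟨p, hp⟩ := hf
  obtain ⟨ρ, hρ⟩ := hp
  set N : ℝ≥0 := Fintype.card σ + 1 with hN
  have hN0 : 0 < N := by positivity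
  obtain ⟨r', hr'0, hr'⟩ : ∃ r : ℝ≥0, 0 < r ∧ (r : ℝ≥0∞) < p.radius := by
    obtain ⟨r, h1, h2⟩ := ENNReal.lt_iff_exists_nnreal_btwn.1 (hρ.r_pos.trans_le hρ.r_le)
    exact ⟨r, by exact_mod_cast h1, h2⟩
  set r : ℝ≥0 := r' / N with hr
  have hr0 : 0 < r := by positivity
  set A : (Σ k : ℕ, Fin k → σ) → ℂ := fun q => p q.1 fun j => Pi.single (q.2 j) 1 with hA
  set g : MvPowerSeries σ ℂ := fun n => ∑' q : (wordDegree ⁻¹' {n} : Set (Σ k : ℕ, Fin k → σ)), A q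
    with hg
  have hgc : ∀ n, coeff n g =
      ∑' q : (wordDegree ⁻¹' {n} : Set (Σ k : ℕ, Fin k → σ)), A q := fun n => rfl
  have hAle : ∀ q, ‖A q‖ₑ ≤ ‖p q.1‖ₑ := by
    intro q
    have h1 := (p q.1).le_opNorm fun j => Pi.single (q.2 j) 1
    have h2 : ∏ j, ‖(Pi.single (q.2 j) 1 : σ → ℂ)‖ ≤ 1 := by
      refine Finset.prod_le_one (fun _ _ => norm_nonneg _) fun j _ => ?_
      refine (pi_norm_le_iff_of_nonneg zero_le_one).2 fun i => ?_
      rcases eq_or_ne i (q.2 j) with rfl | h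
      · simp
      · simp [h]
    rw [enorm_eq_nnnorm, enorm_eq_nnnorm]
    have h3 : ‖A q‖ ≤ ‖p q.1‖ := h1.trans (mul_le_of_le_one_right (norm_nonneg _) h2)
    exact_mod_cast h3
  have hsumA : ∑' q : (Σ k : ℕ, Fin k → σ), ‖A q‖ₑ * (r : ℝ≥0∞) ^ q.1 ≠ ⊤ := by
    have h1 : ∑' k : ℕ, ‖p k‖ₑ * (r' : ℝ≥0∞) ^ k ≠ ⊤ := by
      have := p.summable_norm_mul_pow hr'
      have h2 : Summable fun k => ‖p k‖₊ * r' ^ k := by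
        rw [← NNReal.summable_coe]
        simpa using this
      have h3 := ENNReal.tsum_coe_ne_top_iff_summable.2 h2
      simpa [enorm_eq_nnnorm] using h3
    refine ne_top_of_le_ne_top h1 ?_
    rw [ENNReal.tsum_sigma']
    refine ENNReal.tsum_le_tsum fun k => ?_
    calc ∑' s : Fin k → σ, ‖A ⟨k, s⟩‖ₑ * (r : ℝ≥0∞) ^ k
        ≤ ∑' s : Fin k → σ, ‖p k‖ₑ * (r : ℝ≥0∞) ^ k :=
          ENNReal.tsum_le_tsum fun s => by gcongr; exact hAle ⟨k, s⟩
      _ = (Fintype.card σ : ℝ≥0∞) ^ k * (‖p k‖ₑ * (r : ℝ≥0∞) ^ k) := by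
          rw [tsum_fintype, Finset.sum_const, Finset.card_univ, Fintype.card_fun, Fintype.card_fin,
            nsmul_eq_mul]
          push_cast
          rfl
      _ = ‖p k‖ₑ * ((Fintype.card σ : ℝ≥0∞) * r) ^ k := by ring
      _ ≤ ‖p k‖ₑ * (r' : ℝ≥0∞) ^ k := by
          gcongr
          have : (Fintype.card σ : ℝ≥0) * r ≤ r' := by
            calc (Fintype.card σ : ℝ≥0) * r ≤ N * r := by
                  gcongr
                  simp [hN]
              _ = r' := by rw [hr]; field_simp
          exact_mod_cast this
  have hw : wnorm r g ≠ ⊤ := by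
    refine ne_top_of_le_ne_top hsumA ?_
    rw [← (Equiv.sigmaFiberEquiv (wordDegree (σ := σ))).tsum_eq, ENNReal.tsum_sigma']
    refine ENNReal.tsum_le_tsum fun n => ?_
    rw [hgc]
    refine (mul_le_mul_left enorm_tsum_le_tsum_enorm _).trans ?_
    rw [← ENNReal.tsum_mul_right]
    refine ENNReal.tsum_le_tsum fun q => ?_
    have hq : wordDegree q.1 = n := q.2
    have : (Equiv.sigmaFiberEquiv (wordDegree (σ := σ))) ⟨n, q⟩ = q.1 := rfl
    rw [this, ← degree_wordDegree q.1, hq]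
  refine ⟨g, ⟨r, hr0, hw⟩, ?_⟩
  have hb := Metric.eball_mem_nhds (0 : σ → ℂ) hρ.r_pos
  filter_upwards [eventually_enorm_le hr0, hb] with x hx hxb
  have hsumm : Summable fun q : (Σ k : ℕ, Fin k → σ) => A q * ∏ j, x (q.2 j) := by
    refine Summable.of_norm ?_
    have h : ∑' q : (Σ k : ℕ, Fin k → σ), ‖A q * ∏ j, x (q.2 j)‖ₑ ≠ ⊤ := by
      refine ne_top_of_le_ne_top hsumA (ENNReal.tsum_le_tsum fun q => ?_)
      rw [enorm_mul]
      gcongr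
      rw [← ofReal_norm, norm_prod, ENNReal.ofReal_prod_of_nonneg (fun _ _ => norm_nonneg _)]
      refine (Finset.prod_le_prod' (g := fun _ => (r : ℝ≥0∞)) fun i _ => ?_).trans (by simp)
      rw [ofReal_norm]
      exact hx _
    simp only [enorm_eq_nnnorm] at h
    rw [ENNReal.tsum_coe_ne_top_iff_summable] at h
    exact NNReal.summable_coe.2 h
  have h1 : ev x g = ∑' q : (Σ k : ℕ, Fin k → σ), A q * ∏ j, x (q.2 j) := by
    rw [← (hsumm.hasSum.tsum_fiberwise wordDegree).tsum_eq, ev]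
    refine tsum_congr fun n => ?_
    rw [hgc, ← tsum_mul_right]
    refine tsum_congr fun q => ?_
    rw [← prod_pow_wordDegree]
    have hq : wordDegree q.1 = n := q.2
    rw [hq]
  have h2 : HasSum (fun k => p k fun _ => x) (f x) := by
    have := hρ.hasSum hxb
    rwa [zero_add] at this
  rw [h1, hsumm.tsum_sigma, ← h2.tsum_eq]
  refine tsum_congr fun k => ?_
  rw [tsum_fintype]
  have hx' : x = ∑ i, x i • (Pi.single i 1 : σ → ℂ) := pi_eq_sum_univ' x
  conv_rhs => rw [hx']
  rw [ContinuousMultilinearMap.map_sum]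
  refine Finset.sum_congr rfl fun s _ => ?_
  rw [(p k).map_smul_univ (fun j => x (s j)) (fun j => Pi.single (s j) 1), smul_eq_mul, mul_comm]

end AnalyticSeries

section Fuchs

theorem conv_powerSeries_iff (f : PowerSeries ℂ) :
    Conv f ↔ ∃ B r : ℝ, 0 < r ∧ ∀ n, ‖PowerSeries.coeff n f‖ ≤ B * r ^ n := by
  have hw : ∀ t : ℝ≥0∞, wnorm (σ := Unit) t f = ∑' n : ℕ, ‖PowerSeries.coeff n f‖ₑ * t ^ n := by
    intro t
    rw [wnorm, ← (Finsupp.uniqueEquiv () (M := ℕ)).symm.tsum_eq]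
    refine tsum_congr fun n => ?_
    have : (Finsupp.uniqueEquiv () (M := ℕ)).symm n = Finsupp.single () n := by
      ext; simp
    rw [this, Finsupp.degree_single]
    rfl
  constructor
  · rintro ⟨t, ht, hf⟩
    rw [hw] at hf
    refine ⟨(∑' n : ℕ, ‖PowerSeries.coeff n f‖ₑ * (t : ℝ≥0∞) ^ n).toReal, (t : ℝ)⁻¹,
      by positivity, fun n => ?_⟩
    have h1 := ENNReal.toReal_mono hf (ENNReal.le_tsum (f := fun n =>
      ‖PowerSeries.coeff n f‖ₑ * (t : ℝ≥0∞) ^ n) n)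
    rw [ENNReal.toReal_mul, toReal_enorm, ENNReal.toReal_pow, ENNReal.coe_toReal] at h1
    have ht' : (0 : ℝ) < t := by exact_mod_cast ht
    rw [inv_pow, ← div_eq_mul_inv, le_div_iff₀ (by positivity)]
    exact h1
  · rintro ⟨B, r, hr, h⟩
    have ht : 0 < (1 / (2 * r)).toNNReal := by simpa using by positivity
    refine ⟨(1 / (2 * r)).toNNReal, ht, ?_⟩
    rw [hw]
    simp only [enorm_eq_nnnorm]
    have hs : Summable fun n : ℕ => ‖PowerSeries.coeff n f‖₊ * (1 / (2 * r)).toNNReal ^ n := by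
      rw [← NNReal.summable_coe]
      refine Summable.of_nonneg_of_le (fun _ => NNReal.coe_nonneg _) (fun n => ?_)
        (summable_geometric_two.mul_left B)
      push_cast
      rw [Real.coe_toNNReal _ (by positivity)]
      calc ‖PowerSeries.coeff n f‖ * (1 / (2 * r)) ^ n ≤ B * r ^ n * (1 / (2 * r)) ^ n := by
            gcongr
            exact h n
        _ = B * (r * (1 / (2 * r))) ^ n := by rw [mul_pow]; ring
        _ = B * (1 / 2) ^ n := by congr 2; field_simp
    have := ENNReal.tsum_coe_ne_top_iff_summable.2 hs
    simpa using this

/-- The majorant argument behind the convergence of formal solutions at a Fuchsian singularity: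
for large `n` the factor `n` absorbs the whole right-hand side. -/
theorem bounded_of_fuchs_recursion {Z : ℕ → ℝ} {K : ℝ} (hZ : ∀ n, 0 ≤ Z n) (hK : 0 < K)
    (h : ∀ n, n * Z n ≤ K * ∑ m ∈ Finset.range (n + 1), (1 / 2) ^ m * Z (n - m)) :
    ∃ B, ∀ n, Z n ≤ B := by
  obtain ⟨n0, hn0⟩ := exists_nat_ge (2 * K)
  set B := ∑ k ∈ Finset.range (n0 + 1), Z k with hB
  have hB0 : 0 ≤ B := Finset.sum_nonneg fun k _ => hZ k
  refine ⟨B, fun n => ?_⟩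
  induction n using Nat.strong_induction_on with
  | _ n ih =>
    rcases le_or_gt n n0 with hn | hn
    · exact Finset.single_le_sum (f := Z) (fun k _ => hZ k) (Finset.mem_range.2 (by omega))
    · have h1 := h n
      rw [Finset.sum_range_succ'] at h1
      simp only [pow_zero, one_mul, Nat.sub_zero] at h1
      have h2 : ∑ m ∈ Finset.range n, (1 / 2 : ℝ) ^ (m + 1) * Z (n - (m + 1)) ≤ B := by
        calc ∑ m ∈ Finset.range n, (1 / 2 : ℝ) ^ (m + 1) * Z (n - (m + 1))
            ≤ ∑ m ∈ Finset.range n, (1 / 2 : ℝ) ^ m * (B / 2) := by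
              refine Finset.sum_le_sum fun m hm => ?_
              rw [Finset.mem_range] at hm
              have := ih (n - (m + 1)) (by omega)
              rw [pow_succ]
              nlinarith [pow_pos (show (0 : ℝ) < 1 / 2 by norm_num) m]
          _ = (∑ m ∈ Finset.range n, (1 / 2 : ℝ) ^ m) * (B / 2) := by rw [Finset.sum_mul]
          _ ≤ 2 * (B / 2) := by
              gcongr
              exact sum_geometric_two_le n
          _ = B := by ring
      have hn' : 2 * K ≤ n := hn0.trans (by exact_mod_cast hn.le)
      have h3 : (n : ℝ) * Z n ≤ K * B + K * Z n := by nlinarith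
      have h4 : K * Z n ≤ K * B := by nlinarith [hZ n]
      exact le_of_mul_le_mul_left h4 hK

/-- Formal solutions of a linear system `u Y' = A(u) Y` with convergent `A` converge. -/
theorem conv_of_fuchs_system {ι : Type*} [Fintype ι] {y : ι → PowerSeries ℂ}
    {A : ι → ι → PowerSeries ℂ} (hA : ∀ i j, Conv (A i j))
    (h : ∀ i (n : ℕ), (n : ℂ) * PowerSeries.coeff n (y i) = PowerSeries.coeff n (∑ j, A i j * y j)) :
    ∀ i, Conv (y i) := by
  obtain ⟨K, r, hK, hr, hAb⟩ : ∃ K r : ℝ, 0 < K ∧ 0 < r ∧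
      ∀ n, ∑ i, ∑ j, ‖PowerSeries.coeff n (A i j)‖ ≤ K * r ^ n := by
    choose B r hr hB using fun i j => (conv_powerSeries_iff _).1 (hA i j)
    have hB0 : ∀ i j, 0 ≤ B i j := fun i j => by
      simpa using (norm_nonneg _).trans (hB i j 0)
    set R : ℝ := 1 + ∑ i, ∑ j, r i j with hR
    have hrR : ∀ i j, r i j ≤ R := fun i j => by
      have h1 : r i j ≤ ∑ j, r i j :=
        Finset.single_le_sum (f := fun j => r i j) (fun j _ => (hr i j).le) (Finset.mem_univ j)
      have h2 : ∑ j, r i j ≤ ∑ i, ∑ j, r i j :=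
        Finset.single_le_sum (f := fun i => ∑ j, r i j)
          (fun i _ => Finset.sum_nonneg fun j _ => (hr i j).le) (Finset.mem_univ i)
      linarith
    have hR0 : 0 < R := by
      have : 0 ≤ ∑ i, ∑ j, r i j :=
        Finset.sum_nonneg fun i _ => Finset.sum_nonneg fun j _ => (hr i j).le
      linarith
    refine ⟨1 + ∑ i, ∑ j, B i j, R, ?_, hR0, fun n => ?_⟩
    · have : 0 ≤ ∑ i, ∑ j, B i j :=
        Finset.sum_nonneg fun i _ => Finset.sum_nonneg fun j _ => hB0 i j
      linarith
    · calc ∑ i, ∑ j, ‖PowerSeries.coeff n (A i j)‖ ≤ ∑ i, ∑ j, B i j * R ^ n := by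
            refine Finset.sum_le_sum fun i _ => Finset.sum_le_sum fun j _ => (hB i j n).trans ?_
            have := hB0 i j
            have := (hr i j).le
            gcongr
            exact hrR i j
        _ = (∑ i, ∑ j, B i j) * R ^ n := by simp_rw [Finset.sum_mul]
        _ ≤ _ := by
            have : 0 < R ^ n := by positivity
            nlinarith
  set Y : ℕ → ℝ := fun n => ∑ i, ‖PowerSeries.coeff n (y i)‖ with hY
  have hY0 : ∀ n, 0 ≤ Y n := fun n => Finset.sum_nonneg fun i _ => norm_nonneg _
  have hle : ∀ n i, ‖PowerSeries.coeff n (y i)‖ ≤ Y n := fun n i =>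
    Finset.single_le_sum (f := fun i => ‖PowerSeries.coeff n (y i)‖) (fun i _ => norm_nonneg _)
      (Finset.mem_univ i)
  have hrec : ∀ n, n * Y n ≤ ∑ m ∈ Finset.range (n + 1), K * r ^ m * Y (n - m) := by
    intro n
    have h1 : ∀ i, (n : ℝ) * ‖PowerSeries.coeff n (y i)‖ ≤
        ∑ m ∈ Finset.range (n + 1), (∑ j, ‖PowerSeries.coeff m (A i j)‖) * Y (n - m) := by
      intro i
      have h2 : (n : ℝ) * ‖PowerSeries.coeff n (y i)‖ =
          ‖(n : ℂ) * PowerSeries.coeff n (y i)‖ := by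
        rw [norm_mul, Complex.norm_natCast]
      rw [h2, h, map_sum]
      refine (norm_sum_le _ _).trans ?_
      simp_rw [Finset.sum_mul]
      rw [Finset.sum_comm]
      refine Finset.sum_le_sum fun j _ => ?_
      rw [PowerSeries.coeff_mul, Finset.Nat.sum_antidiagonal_eq_sum_range_succ
        (fun a b => PowerSeries.coeff a (A i j) * PowerSeries.coeff b (y j))]
      refine (norm_sum_le _ _).trans (Finset.sum_le_sum fun m _ => ?_)
      rw [norm_mul]
      gcongr
      exact hle _ _
    calc (n : ℝ) * Y n = ∑ i, (n : ℝ) * ‖PowerSeries.coeff n (y i)‖ := Finset.mul_sum _ _ _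
      _ ≤ ∑ i, ∑ m ∈ Finset.range (n + 1), (∑ j, ‖PowerSeries.coeff m (A i j)‖) * Y (n - m) :=
        Finset.sum_le_sum fun i _ => h1 i
      _ = ∑ m ∈ Finset.range (n + 1), (∑ i, ∑ j, ‖PowerSeries.coeff m (A i j)‖) * Y (n - m) := by
        rw [Finset.sum_comm]
        simp_rw [Finset.sum_mul]
      _ ≤ _ := Finset.sum_le_sum fun m _ => by
        have := hY0 (n - m)
        gcongr
        exact hAb m
  obtain ⟨B, hB⟩ := bounded_of_fuchs_recursion (Z := fun n => Y n / (2 * r) ^ n) (K := K)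
    (fun n => div_nonneg (hY0 n) (by positivity)) hK fun n => by
      rw [← mul_div_assoc, div_le_iff₀ (by positivity), Finset.mul_sum (s := Finset.range _), Finset.sum_mul]
      refine (hrec n).trans (le_of_eq (Finset.sum_congr rfl fun m hm => ?_))
      have hmn : m ≤ n := by
        rw [Finset.mem_range] at hm
        omega
      have hpow : (2 * r) ^ n = (2 * r) ^ (n - m) * (2 * r) ^ m := by
        rw [← pow_add, Nat.sub_add_cancel hmn]
      rw [hpow]
      have : (2 * r) ^ (n - m) ≠ 0 := by positivity
      field_simp
      rw [mul_assoc, ← mul_pow, mul_comm]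
      congr 2
      ring
  intro i
  refine (conv_powerSeries_iff _).2 ⟨B, 2 * r, by positivity, fun n => (hle n i).trans ?_⟩
  have := hB n
  rwa [div_le_iff₀ (by positivity)] at this

end Fuchs

/-! ### Substitution, derivatives and congruences -/

section FormalCalculus

variable {σ τ : Type*}

instance : IsDomain (MvPowerSeries σ ℂ) := NoZeroDivisors.to_isDomain _

theorem coeff_subst_eq_zero_of_degree_lt {a : σ → MvPowerSeries τ ℂ} (ha : HasSubst a)
    (h0 : ∀ i, constantCoeff (a i) = 0) {f : MvPowerSeries σ ℂ} {n : ℕ}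
    (hf : ∀ d, d.degree < n → coeff d f = 0) {e : τ →₀ ℕ} (he : e.degree < n) :
    coeff e (subst a f) = 0 := by
  apply coeff_of_lt_order
  refine lt_of_lt_of_le (b := (n : ℕ∞)) (by exact_mod_cast he) ?_
  have h1 : (1 : ℕ∞) ≤ ⨅ i, (a i).order :=
    le_iInf fun i => one_le_order_iff_constCoeff_eq_zero.2 (h0 i)
  calc (n : ℕ∞) ≤ f.order := nat_le_order hf
    _ = 1 * f.order := (one_mul _).symm
    _ ≤ (⨅ i, (a i).order) * f.order := by gcongr
    _ ≤ _ := le_order_subst ha f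

/-- The chain rule for the substitution of power series without constant term. -/
theorem pderiv_subst [Fintype σ] [Finite τ] {a : σ → MvPowerSeries τ ℂ}
    (h0 : ∀ i, constantCoeff (a i) = 0) (f : MvPowerSeries σ ℂ) (j : τ) :
    pderiv ℂ j (subst a f) = ∑ i, subst a (pderiv ℂ i f) * pderiv ℂ j (a i) := by
  classical
  have ha := hasSubst_of_constantCoeff_zero h0
  have hpoly : ∀ p : MvPolynomial σ ℂ, pderiv ℂ j (subst a (p : MvPowerSeries σ ℂ)) =
      ∑ i, subst a (pderiv ℂ i (p : MvPowerSeries σ ℂ)) * pderiv ℂ j (a i) := by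
    intro p
    induction p using MvPolynomial.induction_on with
    | C c =>
      have hC : subst a (C c : MvPowerSeries σ ℂ) = C c := subst_C c
      rw [MvPolynomial.coe_C, hC, pderiv_C]
      refine (Finset.sum_eq_zero fun i _ => ?_).symm
      rw [pderiv_C, ← coe_substAlgHom ha, map_zero, zero_mul]
    | add p q hp hq =>
      rw [MvPolynomial.coe_add, subst_add ha, map_add, hp, hq, ← Finset.sum_add_distrib]
      exact Finset.sum_congr rfl fun i _ => by rw [map_add, subst_add ha, add_mul]
    | mul_X p k hp =>
      rw [MvPolynomial.coe_mul, MvPolynomial.coe_X, subst_mul ha, Derivation.leibniz, hp,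
        subst_X ha]
      have h1 : ∀ i, subst a (pderiv ℂ i ((p : MvPowerSeries σ ℂ) * X k)) =
          subst a (p : MvPowerSeries σ ℂ) * (if k = i then 1 else 0) +
            a k * subst a (pderiv ℂ i (p : MvPowerSeries σ ℂ)) := by
        intro i
        rw [Derivation.leibniz, smul_eq_mul, smul_eq_mul, subst_add ha, subst_mul ha, subst_mul ha,
          subst_X ha]
        rcases eq_or_ne k i with rfl | h
        · rw [pderiv_X_self, if_pos rfl, ← coe_substAlgHom ha, map_one]
        · rw [pderiv_X_of_ne h, if_neg h, ← coe_substAlgHom ha, map_zero]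
      simp_rw [h1, add_mul, Finset.sum_add_distrib]
      rw [smul_eq_mul, smul_eq_mul, Finset.mul_sum]
      congr 1
      · rw [Finset.sum_eq_single k]
        · simp
        · intro i _ hi
          simp [hi.symm]
        · simp
      · exact Finset.sum_congr rfl fun i _ => by ring
  ext e
  set n := e.degree + 2 with hn
  set p := truncTotal n f with hp
  set r : MvPowerSeries σ ℂ := f - p with hr
  have hrc : ∀ d : σ →₀ ℕ, d.degree < n → coeff d r = 0 := by
    intro d hd
    rw [hr, map_sub, MvPolynomial.coeff_coe, hp, coeff_truncTotal _ hd, sub_self]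
  have hf : f = p + r := by rw [hr]; ring
  have hr1 : coeff e (pderiv ℂ j (subst a r)) = 0 := by
    rw [coeff_pderiv, coeff_subst_eq_zero_of_degree_lt ha h0 hrc, zero_mul]
    rw [map_add, Finsupp.degree_single]
    omega
  have hr2 : coeff e (∑ i, subst a (pderiv ℂ i r) * pderiv ℂ j (a i)) = 0 := by
    rw [map_sum]
    refine Finset.sum_eq_zero fun i _ => ?_
    rw [coeff_mul]
    refine Finset.sum_eq_zero fun q hq => ?_
    rw [Finset.HasAntidiagonal.mem_antidiagonal] at hq
    rw [coeff_subst_eq_zero_of_degree_lt ha h0 (n := n - 1), zero_mul]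
    · intro d hd
      rw [coeff_pderiv, hrc, zero_mul]
      rw [map_add, Finsupp.degree_single]
      omega
    · have : q.1.degree + q.2.degree = e.degree := by rw [← map_add, hq]
      omega
  have h2 : ∑ i, subst a (pderiv ℂ i f) * pderiv ℂ j (a i) =
      ∑ i, subst a (pderiv ℂ i (p : MvPowerSeries σ ℂ)) * pderiv ℂ j (a i) +
      ∑ i, subst a (pderiv ℂ i r) * pderiv ℂ j (a i) := by
    rw [← Finset.sum_add_distrib]
    refine Finset.sum_congr rfl fun i _ => ?_
    conv_lhs => rw [hf]
    rw [map_add, subst_add ha, add_mul]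
  rw [h2, map_add, hr2, ← hpoly]
  conv_lhs => rw [hf]
  rw [subst_add ha, map_add, map_add, hr1]

/-- Substitution respects congruences modulo a variable. -/
theorem X_dvd_subst_sub_subst {a b : σ → MvPowerSeries τ ℂ} (ha : HasSubst a) (hb : HasSubst b)
    {s : τ} (h : ∀ i, X s ∣ a i - b i) (f : MvPowerSeries σ ℂ) :
    X s ∣ subst a f - subst b f := by
  rw [X_dvd_iff]
  intro m hm
  rw [map_sub, coeff_subst ha, coeff_subst hb, sub_eq_zero]
  refine finsum_congr fun d => ?_
  have h1 : X s ∣ (d.prod fun i k => a i ^ k) - d.prod fun i k => b i ^ k := by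
    have h2 : ∀ i, Ideal.Quotient.mk (Ideal.span {X s}) (a i) =
        Ideal.Quotient.mk (Ideal.span {X s}) (b i) := fun i =>
      Ideal.Quotient.eq.2 (Ideal.mem_span_singleton.2 (h i))
    rw [← Ideal.mem_span_singleton, ← Ideal.Quotient.eq, Finsupp.prod, Finsupp.prod, map_prod,
      map_prod]
    exact Finset.prod_congr rfl fun i _ => by rw [map_pow, map_pow, h2]
  have h3 := X_dvd_iff.1 h1 m hm
  rw [map_sub, sub_eq_zero] at h3
  rw [h3]

theorem prime_X_zero {n : ℕ} : Prime (X 0 : MvPowerSeries (Fin (n + 1)) ℂ) := by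
  rw [← MulEquiv.prime_iff (finSuccEquiv ℂ n).toMulEquiv]
  have : (finSuccEquiv ℂ n).toMulEquiv (X 0) = PowerSeries.X := finSuccEquiv_X_zero
  rw [this]
  exact PowerSeries.X_prime

end FormalCalculus

/-! ### Pullback of the tangency condition -/

section Tangency

/-- Formal power series in the variables `t`, `z`, `ζ`, `u` (with indices `0`, `1`, `2`, `3`) near a
real hypersurface `v = V(z, z̄, u)`; `ζ` stands for `z̄` and `t` for `v - V`. -/
abbrev GraphRing : Type := MvPowerSeries (Fin 4) ℂ

/-- The series `w = u + i (V + t)`. -/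
def wPlus (V : GraphRing) : GraphRing := X 3 + C Complex.I * (V + X 0)

/-- The series `w̄ = u - i (V + t)`. -/
def wMinus (V : GraphRing) : GraphRing := X 3 - C Complex.I * (V + X 0)

/-- The series `f(z, w)` in the variables `t`, `z`, `ζ`, `u`. -/
def holSub (V : GraphRing) (f : MvPowerSeries (Fin 2) ℂ) : GraphRing := subst ![X 1, wPlus V] f

/-- The series `f(ζ, w̄)` in the variables `t`, `z`, `ζ`, `u`. -/
def antiSub (V : GraphRing) (f : MvPowerSeries (Fin 2) ℂ) : GraphRing := subst ![X 2, wMinus V] f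

/-- The formal map `(z, w) ↦ Ψ(z, w)` and its conjugate in the variables `t`, `z`, `ζ`, `u`. -/
def coordMap (Ψ : Fin 2 → MvPowerSeries (Fin 2) ℂ) (V : GraphRing) : Fin 2 ⊕ Fin 2 → GraphRing :=
  Sum.elim (fun i => holSub V (Ψ i)) fun i => antiSub V (map (starRingEnd ℂ) (Ψ i))

variable {V : GraphRing} {Ψ : Fin 2 → MvPowerSeries (Fin 2) ℂ}

theorem constantCoeff_holVars (hV0 : constantCoeff V = 0) (i : Fin 2) :
    constantCoeff ((![X 1, wPlus V] : Fin 2 → GraphRing) i) = 0 := by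
  fin_cases i <;> simp [wPlus, hV0]

theorem constantCoeff_antiVars (hV0 : constantCoeff V = 0) (i : Fin 2) :
    constantCoeff ((![X 2, wMinus V] : Fin 2 → GraphRing) i) = 0 := by
  fin_cases i <;> simp [wMinus, hV0]

theorem hasSubst_holVars (hV0 : constantCoeff V = 0) :
    HasSubst (![X 1, wPlus V] : Fin 2 → GraphRing) :=
  hasSubst_of_constantCoeff_zero (constantCoeff_holVars hV0)

theorem hasSubst_antiVars (hV0 : constantCoeff V = 0) :
    HasSubst (![X 2, wMinus V] : Fin 2 → GraphRing) :=
  hasSubst_of_constantCoeff_zero (constantCoeff_antiVars hV0)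

theorem holSub_add (hV0 : constantCoeff V = 0) (f g : MvPowerSeries (Fin 2) ℂ) :
    holSub V (f + g) = holSub V f + holSub V g := subst_add (hasSubst_holVars hV0) f g

theorem holSub_mul (hV0 : constantCoeff V = 0) (f g : MvPowerSeries (Fin 2) ℂ) :
    holSub V (f * g) = holSub V f * holSub V g := subst_mul (hasSubst_holVars hV0) f g

theorem antiSub_add (hV0 : constantCoeff V = 0) (f g : MvPowerSeries (Fin 2) ℂ) :
    antiSub V (f + g) = antiSub V f + antiSub V g := subst_add (hasSubst_antiVars hV0) f g

theorem antiSub_mul (hV0 : constantCoeff V = 0) (f g : MvPowerSeries (Fin 2) ℂ) :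
    antiSub V (f * g) = antiSub V f * antiSub V g := subst_mul (hasSubst_antiVars hV0) f g

theorem holSub_X_one_pow (hV0 : constantCoeff V = 0) (k : ℕ) :
    holSub V (X 1 ^ k) = wPlus V ^ k := by
  rw [holSub, subst_pow (hasSubst_holVars hV0), subst_X (hasSubst_holVars hV0)]
  rfl

theorem antiSub_X_one_pow (hV0 : constantCoeff V = 0) (k : ℕ) :
    antiSub V (X 1 ^ k) = wMinus V ^ k := by
  rw [antiSub, subst_pow (hasSubst_antiVars hV0), subst_X (hasSubst_antiVars hV0)]
  rfl

theorem constantCoeff_coordMap (hV0 : constantCoeff V = 0) (hΨ0 : ∀ i, constantCoeff (Ψ i) = 0)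
    (i : Fin 2 ⊕ Fin 2) : constantCoeff (coordMap Ψ V i) = 0 := by
  rcases i with i | i
  · exact constantCoeff_subst_eq_zero (hasSubst_holVars hV0) (constantCoeff_holVars hV0) (hΨ0 i)
  · refine constantCoeff_subst_eq_zero (hasSubst_antiVars hV0) (constantCoeff_antiVars hV0) ?_
    rw [constantCoeff_map, hΨ0, map_zero]

theorem hasSubst_coordMap (hV0 : constantCoeff V = 0) (hΨ0 : ∀ i, constantCoeff (Ψ i) = 0) :
    HasSubst (coordMap Ψ V) := hasSubst_of_constantCoeff_zero (constantCoeff_coordMap hV0 hΨ0)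

theorem subst_coordMap_holo (hV0 : constantCoeff V = 0) (hΨ0 : ∀ i, constantCoeff (Ψ i) = 0)
    (P : MvPowerSeries (Fin 2) ℂ) :
    subst (coordMap Ψ V) (holo P) = holSub V (subst Ψ P) := by
  rw [holo, rename_eq_subst, subst_comp_subst_apply (HasSubst.X_comp _) (hasSubst_coordMap hV0 hΨ0),
    holSub, subst_comp_subst_apply (hasSubst_of_constantCoeff_zero hΨ0) (hasSubst_holVars hV0)]
  congr 1
  funext i
  rw [Function.comp_apply, subst_X (hasSubst_coordMap hV0 hΨ0)]
  rfl

theorem subst_coordMap_antiholo (hV0 : constantCoeff V = 0) (hΨ0 : ∀ i, constantCoeff (Ψ i) = 0)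
    (P : MvPowerSeries (Fin 2) ℂ) :
    subst (coordMap Ψ V) (antiholo P) = antiSub V (map (starRingEnd ℂ) (subst Ψ P)) := by
  have hΨ1 : ∀ i, constantCoeff (map (starRingEnd ℂ) (Ψ i)) = 0 := fun i => by
    rw [constantCoeff_map, hΨ0, map_zero]
  rw [antiholo, rename_eq_subst, subst_comp_subst_apply (HasSubst.X_comp _) (hasSubst_coordMap hV0 hΨ0),
    map_subst (hasSubst_of_constantCoeff_zero hΨ0),
    antiSub, subst_comp_subst_apply (hasSubst_of_constantCoeff_zero hΨ1) (hasSubst_antiVars hV0)]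
  congr 1
  funext i
  rw [Function.comp_apply, subst_X (hasSubst_coordMap hV0 hΨ0)]
  rfl

theorem pderiv_holSub (hV0 : constantCoeff V = 0) (f : MvPowerSeries (Fin 2) ℂ) (j : Fin 4) :
    pderiv ℂ j (holSub V f) = holSub V (pderiv ℂ 0 f) * pderiv ℂ j (X 1) +
      holSub V (pderiv ℂ 1 f) * pderiv ℂ j (wPlus V) := by
  rw [holSub, pderiv_subst (constantCoeff_holVars hV0), Fin.sum_univ_two]
  rfl

theorem pderiv_antiSub (hV0 : constantCoeff V = 0) (f : MvPowerSeries (Fin 2) ℂ) (j : Fin 4) :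
    pderiv ℂ j (antiSub V f) = antiSub V (pderiv ℂ 0 f) * pderiv ℂ j (X 2) +
      antiSub V (pderiv ℂ 1 f) * pderiv ℂ j (wMinus V) := by
  rw [antiSub, pderiv_subst (constantCoeff_antiVars hV0), Fin.sum_univ_two]
  rfl

/-- The pairing of the `x`-derivatives of `r` with the `j`-th derivative of `Ψ`. -/
def holDer (Ψ : Fin 2 → MvPowerSeries (Fin 2) ℂ) (V : GraphRing) (r : FormalRing) (j : Fin 2) :
    GraphRing :=
  ∑ i, subst (coordMap Ψ V) (pderiv ℂ (Sum.inl i) r) * holSub V (pderiv ℂ j (Ψ i))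

/-- The pairing of the `x̄`-derivatives of `r` with the `j`-th derivative of the conjugate of `Ψ`. -/
def antiDer (Ψ : Fin 2 → MvPowerSeries (Fin 2) ℂ) (V : GraphRing) (r : FormalRing) (j : Fin 2) :
    GraphRing :=
  ∑ i, subst (coordMap Ψ V) (pderiv ℂ (Sum.inr i) r) *
    antiSub V (pderiv ℂ j (map (starRingEnd ℂ) (Ψ i)))

theorem pderiv_subst_coordMap (hV0 : constantCoeff V = 0) (hΨ0 : ∀ i, constantCoeff (Ψ i) = 0)
    (r : FormalRing) (j : Fin 4) :
    pderiv ℂ j (subst (coordMap Ψ V) r) =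
      holDer Ψ V r 0 * pderiv ℂ j (X 1) + holDer Ψ V r 1 * pderiv ℂ j (wPlus V) +
      antiDer Ψ V r 0 * pderiv ℂ j (X 2) + antiDer Ψ V r 1 * pderiv ℂ j (wMinus V) := by
  have h1 : ∀ i, coordMap Ψ V (Sum.inl i) = holSub V (Ψ i) := fun _ => rfl
  have h2 : ∀ i, coordMap Ψ V (Sum.inr i) = antiSub V (map (starRingEnd ℂ) (Ψ i)) := fun _ => rfl
  rw [pderiv_subst (constantCoeff_coordMap hV0 hΨ0), Fintype.sum_sum_type]
  simp only [h1, h2, pderiv_holSub hV0, pderiv_antiSub hV0, holDer, antiDer, Fin.sum_univ_two]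
  ring

theorem pderiv_wPlus (j : Fin 4) :
    pderiv ℂ j (wPlus V) = pderiv ℂ j (X 3) + C Complex.I * (pderiv ℂ j V + pderiv ℂ j (X 0)) := by
  rw [wPlus, map_add, Derivation.leibniz, pderiv_C, smul_zero, add_zero, smul_eq_mul, map_add]

theorem pderiv_wMinus (j : Fin 4) :
    pderiv ℂ j (wMinus V) = pderiv ℂ j (X 3) - C Complex.I * (pderiv ℂ j V + pderiv ℂ j (X 0)) := by
  rw [wMinus, map_sub, Derivation.leibniz, pderiv_C, smul_zero, add_zero, smul_eq_mul, map_add]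

theorem pderiv_zero_subst_coordMap (hV0 : constantCoeff V = 0) (hVt : pderiv ℂ 0 V = 0)
    (hΨ0 : ∀ i, constantCoeff (Ψ i) = 0) (r : FormalRing) :
    pderiv ℂ 0 (subst (coordMap Ψ V) r) =
      C Complex.I * (holDer Ψ V r 1 - antiDer Ψ V r 1) := by
  rw [pderiv_subst_coordMap hV0 hΨ0, pderiv_wPlus, pderiv_wMinus, hVt]
  simp only [pderiv_X_self, pderiv_X_of_ne (show (1 : Fin 4) ≠ 0 by decide),
    pderiv_X_of_ne (show (2 : Fin 4) ≠ 0 by decide), pderiv_X_of_ne (show (3 : Fin 4) ≠ 0 by decide)]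
  ring

theorem pderiv_one_subst_coordMap (hV0 : constantCoeff V = 0)
    (hΨ0 : ∀ i, constantCoeff (Ψ i) = 0) (r : FormalRing) :
    pderiv ℂ 1 (subst (coordMap Ψ V) r) = holDer Ψ V r 0 +
      C Complex.I * pderiv ℂ 1 V * (holDer Ψ V r 1 - antiDer Ψ V r 1) := by
  rw [pderiv_subst_coordMap hV0 hΨ0, pderiv_wPlus, pderiv_wMinus]
  simp only [pderiv_X_self, pderiv_X_of_ne (show (0 : Fin 4) ≠ 1 by decide),
    pderiv_X_of_ne (show (2 : Fin 4) ≠ 1 by decide), pderiv_X_of_ne (show (3 : Fin 4) ≠ 1 by decide)]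
  ring

theorem pderiv_two_subst_coordMap (hV0 : constantCoeff V = 0)
    (hΨ0 : ∀ i, constantCoeff (Ψ i) = 0) (r : FormalRing) :
    pderiv ℂ 2 (subst (coordMap Ψ V) r) = antiDer Ψ V r 0 +
      C Complex.I * pderiv ℂ 2 V * (holDer Ψ V r 1 - antiDer Ψ V r 1) := by
  rw [pderiv_subst_coordMap hV0 hΨ0, pderiv_wPlus, pderiv_wMinus]
  simp only [pderiv_X_self, pderiv_X_of_ne (show (0 : Fin 4) ≠ 2 by decide),
    pderiv_X_of_ne (show (1 : Fin 4) ≠ 2 by decide), pderiv_X_of_ne (show (3 : Fin 4) ≠ 2 by decide)]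
  ring

theorem pderiv_three_subst_coordMap (hV0 : constantCoeff V = 0)
    (hΨ0 : ∀ i, constantCoeff (Ψ i) = 0) (r : FormalRing) :
    pderiv ℂ 3 (subst (coordMap Ψ V) r) = holDer Ψ V r 1 + antiDer Ψ V r 1 +
      C Complex.I * pderiv ℂ 3 V * (holDer Ψ V r 1 - antiDer Ψ V r 1) := by
  rw [pderiv_subst_coordMap hV0 hΨ0, pderiv_wPlus, pderiv_wMinus]
  simp only [pderiv_X_self, pderiv_X_of_ne (show (0 : Fin 4) ≠ 3 by decide),
    pderiv_X_of_ne (show (1 : Fin 4) ≠ 3 by decide), pderiv_X_of_ne (show (2 : Fin 4) ≠ 3 by decide)]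
  ring

theorem C_I_mul_C_I : (C Complex.I : GraphRing) * C Complex.I = -1 := by
  rw [← map_mul, Complex.I_mul_I, map_neg, map_one]

theorem C_I_ne_zero : (C Complex.I : GraphRing) ≠ 0 := by
  intro h
  have := C_I_mul_C_I
  rw [h, zero_mul] at this
  exact one_ne_zero (neg_eq_zero.1 this.symm)

/-- The Jacobian determinant of a formal self-map of `(ℂ², 0)`. -/
def jacDet (Ψ : Fin 2 → MvPowerSeries (Fin 2) ℂ) : MvPowerSeries (Fin 2) ℂ :=
  pderiv ℂ 0 (Ψ 0) * pderiv ℂ 1 (Ψ 1) - pderiv ℂ 1 (Ψ 0) * pderiv ℂ 0 (Ψ 1)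

theorem map_conj_pderiv (j : Fin 2) (f : MvPowerSeries (Fin 2) ℂ) :
    pderiv ℂ j (map (starRingEnd ℂ) f) = map (starRingEnd ℂ) (pderiv ℂ j f) := by
  ext d
  rw [coeff_pderiv, coeff_map, coeff_map, coeff_pderiv, map_mul, map_add, map_natCast, map_one]

theorem holSub_sub (hV0 : constantCoeff V = 0) (f g : MvPowerSeries (Fin 2) ℂ) :
    holSub V (f - g) = holSub V f - holSub V g := subst_sub (hasSubst_holVars hV0) f g

theorem antiSub_sub (hV0 : constantCoeff V = 0) (f g : MvPowerSeries (Fin 2) ℂ) :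
    antiSub V (f - g) = antiSub V f - antiSub V g := subst_sub (hasSubst_antiVars hV0) f g

/-- A formal map with non-zero Jacobian determinant induces an injective substitution: a non-zero
series of minimal order in the kernel would have a non-zero derivative in the kernel. -/
theorem subst_coordMap_ne_zero (hV0 : constantCoeff V = 0) (hVt : pderiv ℂ 0 V = 0)
    (hΨ0 : ∀ i, constantCoeff (Ψ i) = 0) (hJ : holSub V (jacDet Ψ) ≠ 0)
    (hJ' : antiSub V (map (starRingEnd ℂ) (jacDet Ψ)) ≠ 0) {r : FormalRing} (hr : r ≠ 0) :
    subst (coordMap Ψ V) r ≠ 0 := by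
  obtain ⟨d, hd⟩ := (ne_zero_iff_exists_coeff_ne_zero r).1 hr
  clear hr
  obtain ⟨n, hn⟩ : ∃ n, d.degree = n := ⟨_, rfl⟩
  induction n generalizing r d with
  | zero =>
    rw [Finsupp.degree_eq_zero_iff] at hn
    subst hn
    intro h
    have hc : constantCoeff (r - C (constantCoeff r)) = 0 := by simp
    have h1 := constantCoeff_subst_eq_zero (hasSubst_coordMap hV0 hΨ0)
      (constantCoeff_coordMap hV0 hΨ0) hc
    have hC : MvPowerSeries.subst (coordMap Ψ V) (C (constantCoeff r) : FormalRing) =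
      C (constantCoeff r) := subst_C _
    rw [subst_sub (hasSubst_coordMap hV0 hΨ0), h, hC, zero_sub, map_neg, constantCoeff_C,
      neg_eq_zero] at h1
    exact hd h1
  | succ n ih =>
    intro h
    have hder := fun j => congrArg (pderiv ℂ j) h
    have h0 := hder 0
    have h1 := hder 1
    have h2 := hder 2
    have h3 := hder 3
    rw [pderiv_zero_subst_coordMap hV0 hVt hΨ0, map_zero] at h0
    rw [pderiv_one_subst_coordMap hV0 hΨ0, map_zero] at h1
    rw [pderiv_two_subst_coordMap hV0 hΨ0, map_zero] at h2
    rw [pderiv_three_subst_coordMap hV0 hΨ0, map_zero] at h3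
    have h4 := (mul_eq_zero.1 h0).resolve_left C_I_ne_zero
    rw [h4, mul_zero, add_zero] at h1 h2 h3
    have htwo : (2 : GraphRing) ≠ 0 := by
      rw [← map_ofNat C 2]
      exact fun h => two_ne_zero (C_injective (h.trans (map_zero C).symm))
    have hA1 : holDer Ψ V r 1 = 0 := by
      have : (2 : GraphRing) * holDer Ψ V r 1 = 0 := by linear_combination h3 + h4
      exact (mul_eq_zero.1 this).resolve_left htwo
    have hB1 : antiDer Ψ V r 1 = 0 := by rw [← hA1]; linear_combination -h4
    simp only [holDer, Fin.sum_univ_two] at h1 hA1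
    simp only [antiDer, Fin.sum_univ_two, map_conj_pderiv] at h2 hB1
    have hJe : holSub V (jacDet Ψ) = holSub V (pderiv ℂ 0 (Ψ 0)) * holSub V (pderiv ℂ 1 (Ψ 1)) -
        holSub V (pderiv ℂ 1 (Ψ 0)) * holSub V (pderiv ℂ 0 (Ψ 1)) := by
      rw [jacDet, holSub_sub hV0, holSub_mul hV0, holSub_mul hV0]
    have hJe' : antiSub V (map (starRingEnd ℂ) (jacDet Ψ)) =
        antiSub V (map (starRingEnd ℂ) (pderiv ℂ 0 (Ψ 0))) *
          antiSub V (map (starRingEnd ℂ) (pderiv ℂ 1 (Ψ 1))) -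
        antiSub V (map (starRingEnd ℂ) (pderiv ℂ 1 (Ψ 0))) *
          antiSub V (map (starRingEnd ℂ) (pderiv ℂ 0 (Ψ 1))) := by
      rw [jacDet, map_sub, map_mul, map_mul, antiSub_sub hV0, antiSub_mul hV0, antiSub_mul hV0]
    have hl0 : subst (coordMap Ψ V) (pderiv ℂ (Sum.inl 0) r) = 0 := by
      refine (mul_eq_zero.1 ?_).resolve_right hJ
      rw [hJe]
      linear_combination holSub V (pderiv ℂ 1 (Ψ 1)) * h1 - holSub V (pderiv ℂ 0 (Ψ 1)) * hA1
    have hl1 : subst (coordMap Ψ V) (pderiv ℂ (Sum.inl 1) r) = 0 := by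
      refine (mul_eq_zero.1 ?_).resolve_right hJ
      rw [hJe]
      linear_combination holSub V (pderiv ℂ 0 (Ψ 0)) * hA1 - holSub V (pderiv ℂ 1 (Ψ 0)) * h1
    have hr0 : subst (coordMap Ψ V) (pderiv ℂ (Sum.inr 0) r) = 0 := by
      refine (mul_eq_zero.1 ?_).resolve_right hJ'
      rw [hJe']
      linear_combination antiSub V (map (starRingEnd ℂ) (pderiv ℂ 1 (Ψ 1))) * h2 -
        antiSub V (map (starRingEnd ℂ) (pderiv ℂ 0 (Ψ 1))) * hB1
    have hr1 : subst (coordMap Ψ V) (pderiv ℂ (Sum.inr 1) r) = 0 := by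
      refine (mul_eq_zero.1 ?_).resolve_right hJ'
      rw [hJe']
      linear_combination antiSub V (map (starRingEnd ℂ) (pderiv ℂ 0 (Ψ 0))) * hB1 -
        antiSub V (map (starRingEnd ℂ) (pderiv ℂ 1 (Ψ 0))) * h2
    have hall : ∀ i, subst (coordMap Ψ V) (pderiv ℂ i r) = 0 := by
      rintro (i | i) <;> fin_cases i
      exacts [hl0, hl1, hr0, hr1]
    obtain ⟨i, hi⟩ : ∃ i, d i ≠ 0 := by
      by_contra! hcon
      have : d = 0 := by ext i; exact hcon i
      rw [this, map_zero] at hn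
      omega
    have hdi : d - Finsupp.single i 1 + Finsupp.single i 1 = d :=
      tsub_add_cancel_of_le (Finsupp.single_le_iff.2 (Nat.one_le_iff_ne_zero.2 hi))
    refine ih (r := pderiv ℂ i r) (d - Finsupp.single i 1) ?_ ?_ (hall i)
    · rw [coeff_pderiv, hdi]
      exact mul_ne_zero hd (Nat.cast_add_one_ne_zero _)
    · have := congrArg Finsupp.degree hdi
      rw [map_add, Finsupp.degree_single] at this
      omega

/-- The tangency equation on the hypersurface `t = 0`. The vector field `L` is pulled back by `Ψ` to
`w⁻ᵏ (p ∂_z + q ∂_w)`; after multiplication by `2 w ᵏ w̄ ᵏ`, its real part acts on the pulled back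
defining series `R`, which is divisible by `t`. It multiplies `R` by a series, and comparing the
exact power of `t` in `R` on both sides shows that it maps `t` to a multiple of `t`. -/
theorem tangency (hV0 : constantCoeff V = 0) (hVt : pderiv ℂ 0 V = 0)
    (hΨ0 : ∀ i, constantCoeff (Ψ i) = 0) (hJ : holSub V (jacDet Ψ) ≠ 0)
    (hJ' : antiSub V (map (starRingEnd ℂ) (jacDet Ψ)) ≠ 0) {r : FormalRing} (hr : r ≠ 0)
    {L : FormalVectorField} (hL : r ∣ L.applyReal r) (ht : X 0 ∣ subst (coordMap Ψ V) r)
    {k : ℕ} {p q : MvPowerSeries (Fin 2) ℂ}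
    (hpq : ∀ i, p * pderiv ℂ 0 (Ψ i) + q * pderiv ℂ 1 (Ψ i) = X 1 ^ k * subst Ψ (L i)) :
    X 0 ∣ (wMinus V ^ k * holSub V q - wPlus V ^ k * antiSub V (map (starRingEnd ℂ) q)) -
      C Complex.I * (2 * pderiv ℂ 1 V * (wMinus V ^ k * holSub V p) +
        2 * pderiv ℂ 2 V * (wPlus V ^ k * antiSub V (map (starRingEnd ℂ) p)) +
        pderiv ℂ 3 V * (wMinus V ^ k * holSub V q +
          wPlus V ^ k * antiSub V (map (starRingEnd ℂ) q))) := by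
  obtain ⟨c, hc⟩ := hL
  set R := subst (coordMap Ψ V) r with hR
  have hR0 : R ≠ 0 := subst_coordMap_ne_zero hV0 hVt hΨ0 hJ hJ' hr
  obtain ⟨n, b, hb, hRb⟩ : ∃ n b, R = X 0 ^ n * b ∧ ¬ X 0 ∣ b :=
    ⟨_, (FiniteMultiplicity.of_not_isUnit prime_X_zero.not_isUnit
      hR0).exists_eq_pow_mul_and_not_dvd⟩
  have hn : n ≠ 0 := by
    rintro rfl
    rw [pow_zero, one_mul] at hb
    exact hRb (hb ▸ ht)
  set hp := wMinus V ^ k * holSub V p with hhp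
  set hq := wMinus V ^ k * holSub V q with hhq
  set ap := wPlus V ^ k * antiSub V (map (starRingEnd ℂ) p) with hap
  set aq := wPlus V ^ k * antiSub V (map (starRingEnd ℂ) q) with haq
  set Zt : GraphRing := -(C Complex.I) * (hq - aq) - (2 * pderiv ℂ 1 V * hp +
    2 * pderiv ℂ 2 V * ap + pderiv ℂ 3 V * (hq + aq)) with hZt
  -- the action of the vector field on an arbitrary series
  set Z : GraphRing → GraphRing := fun f => Zt * pderiv ℂ 0 f + 2 * hp * pderiv ℂ 1 f +
    2 * ap * pderiv ℂ 2 f + (hq + aq) * pderiv ℂ 3 f with hZ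
  have hstep : ∀ i, holSub V (pderiv ℂ 0 (Ψ i)) * holSub V p +
      holSub V (pderiv ℂ 1 (Ψ i)) * holSub V q =
      wPlus V ^ k * subst (coordMap Ψ V) (holo (L i)) := by
    intro i
    rw [subst_coordMap_holo hV0 hΨ0, ← holSub_X_one_pow hV0, ← holSub_mul hV0, ← holSub_mul hV0,
      ← holSub_mul hV0, ← holSub_add hV0, ← hpq]
    congr 1
    ring
  have hstep' : ∀ i, antiSub V (pderiv ℂ 0 (map (starRingEnd ℂ) (Ψ i))) *
        antiSub V (map (starRingEnd ℂ) p) +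
      antiSub V (pderiv ℂ 1 (map (starRingEnd ℂ) (Ψ i))) * antiSub V (map (starRingEnd ℂ) q) =
      wMinus V ^ k * subst (coordMap Ψ V) (antiholo (L i)) := by
    intro i
    have hX : map (starRingEnd ℂ) (X 1 ^ k : MvPowerSeries (Fin 2) ℂ) = X 1 ^ k := by
      rw [map_pow, map_X]
    rw [subst_coordMap_antiholo hV0 hΨ0, ← antiSub_X_one_pow hV0, ← antiSub_mul hV0,
      ← antiSub_mul hV0, ← antiSub_mul hV0, ← antiSub_add hV0, ← hX, ← map_mul, ← hpq]
    congr 1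
    simp only [map_add, map_mul, map_conj_pderiv]
    ring
  have hZR : Z R = 2 * (wPlus V ^ k * wMinus V ^ k) * subst (coordMap Ψ V) c * R := by
    have h1 : Z R = 2 * (hp * holDer Ψ V r 0 + hq * holDer Ψ V r 1 + ap * antiDer Ψ V r 0 +
        aq * antiDer Ψ V r 1) := by
      simp only [hZ]
      rw [hR, pderiv_zero_subst_coordMap hV0 hVt hΨ0, pderiv_one_subst_coordMap hV0 hΨ0,
        pderiv_two_subst_coordMap hV0 hΨ0, pderiv_three_subst_coordMap hV0 hΨ0, hZt]
      linear_combination (-(hq - aq) * (holDer Ψ V r 1 - antiDer Ψ V r 1)) * C_I_mul_C_I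
    have h2 : subst (coordMap Ψ V) (L.applyReal r) = subst (coordMap Ψ V) c * R := by
      rw [hc, subst_mul (hasSubst_coordMap hV0 hΨ0), mul_comm]
    have h3 : subst (coordMap Ψ V) (L.applyReal r) =
        ∑ i, (subst (coordMap Ψ V) (holo (L i)) * subst (coordMap Ψ V) (pderiv ℂ (Sum.inl i) r) +
          subst (coordMap Ψ V) (antiholo (L i)) *
            subst (coordMap Ψ V) (pderiv ℂ (Sum.inr i) r)) := by
      rw [FormalVectorField.applyReal, ← coe_substAlgHom (hasSubst_coordMap hV0 hΨ0), map_sum]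
      simp only [map_add, map_mul]
    rw [mul_assoc, ← h2, h3, h1]
    simp only [holDer, antiDer, Fin.sum_univ_two, hhp, hhq, hap, haq]
    linear_combination 2 * wMinus V ^ k *
      (subst (coordMap Ψ V) (pderiv ℂ (Sum.inl 0) r) * hstep 0 +
        subst (coordMap Ψ V) (pderiv ℂ (Sum.inl 1) r) * hstep 1) +
      2 * wPlus V ^ k * (subst (coordMap Ψ V) (pderiv ℂ (Sum.inr 0) r) * hstep' 0 +
        subst (coordMap Ψ V) (pderiv ℂ (Sum.inr 1) r) * hstep' 1)
  have hZb : Z R = (n : GraphRing) * X 0 ^ (n - 1) * b * Zt + X 0 ^ n * Z b := by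
    have hd : ∀ j : Fin 4, pderiv ℂ j R =
        (n : GraphRing) * X 0 ^ (n - 1) * pderiv ℂ j (X 0) * b + X 0 ^ n * pderiv ℂ j b := by
      intro j
      rw [hb, Derivation.leibniz, Derivation.leibniz_pow]
      simp only [smul_eq_mul, nsmul_eq_mul]
      ring
    simp only [hZ, hd, pderiv_X_self, pderiv_X_of_ne (show (0 : Fin 4) ≠ 1 by decide),
      pderiv_X_of_ne (show (0 : Fin 4) ≠ 2 by decide), pderiv_X_of_ne (show (0 : Fin 4) ≠ 3 by decide)]
    ring
  have hdvd : X 0 ∣ (n : GraphRing) * (b * Zt) := by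
    have h1 : X 0 ^ (n - 1) * X 0 ∣ X 0 ^ (n - 1) * ((n : GraphRing) * (b * Zt)) := by
      rw [← pow_succ, Nat.sub_add_cancel (Nat.one_le_iff_ne_zero.2 hn)]
      have h2 : X 0 ^ (n - 1) * ((n : GraphRing) * (b * Zt)) = Z R - X 0 ^ n * Z b := by
        rw [hZb]
        ring
      rw [h2, hZR]
      refine dvd_sub ?_ (Dvd.intro _ rfl)
      rw [hb]
      exact ⟨2 * (wPlus V ^ k * wMinus V ^ k) * subst (coordMap Ψ V) c * b, by ring⟩
    exact (mul_dvd_mul_iff_left (pow_ne_zero _ prime_X_zero.ne_zero)).1 h1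
  have hnu : IsUnit (n : GraphRing) := by
    have : (n : GraphRing) = C (n : ℂ) := by rw [map_natCast]
    rw [this]
    exact (IsUnit.mk0 _ (by exact_mod_cast hn)).map C
  have hdvd2 := (prime_X_zero.dvd_or_dvd ((hnu.dvd_mul_left).1 hdvd)).resolve_left hRb
  have hfin : (hq - aq) - C Complex.I * (2 * pderiv ℂ 1 V * hp + 2 * pderiv ℂ 2 V * ap +
      pderiv ℂ 3 V * (hq + aq)) = C Complex.I * Zt := by
    rw [hZt]
    linear_combination (hq - aq) * C_I_mul_C_I
  rw [hfin]
  exact hdvd2.mul_left _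

end Tangency

/-! ### Components of power series in z and its conjugate -/

section Components

/-- The exponent of `z ^ k * ζ ^ l * u ^ n`. -/
def expo (k l n : ℕ) : Fin 4 →₀ ℕ :=
  Finsupp.cons 0 (Finsupp.cons k (Finsupp.cons l (Finsupp.cons n 0)))

@[simp] theorem expo_zero (k l n : ℕ) : expo k l n 0 = 0 := rfl
@[simp] theorem expo_one (k l n : ℕ) : expo k l n 1 = k := rfl
@[simp] theorem expo_two (k l n : ℕ) : expo k l n 2 = l := rfl
@[simp] theorem expo_three (k l n : ℕ) : expo k l n 3 = n := rfl

theorem eq_expo {d : Fin 4 →₀ ℕ} (h : d 0 = 0) : d = expo (d 1) (d 2) (d 3) := by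
  ext i
  fin_cases i <;> simp [h]

/-- A power series in one variable, indexed by `Fin 1`, as a `PowerSeries`. -/
def uSeries : MvPowerSeries (Fin 1) ℂ →+* PowerSeries ℂ :=
  (PowerSeries.map constantCoeff).comp (finSuccEquiv ℂ 0).toRingEquiv.toRingHom

/-- Setting `t = 0`. -/
def tZero : GraphRing →+* MvPowerSeries (Fin 3) ℂ :=
  PowerSeries.constantCoeff.comp (finSuccEquiv ℂ 3).toRingEquiv.toRingHom

/-- The coefficient of `t⁰ z ^ k ζ ^ l`, a power series in `u`. -/
def cf (k l : ℕ) (f : GraphRing) : PowerSeries ℂ :=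
  uSeries (PowerSeries.coeff l (finSuccEquiv ℂ 1 (PowerSeries.coeff k (finSuccEquiv ℂ 2 (tZero f)))))

theorem coeff_cf (k l n : ℕ) (f : GraphRing) :
    PowerSeries.coeff n (cf k l f) = coeff (expo k l n) f := by
  have h0 : PowerSeries.coeff n (cf k l f) = coeff (0 : Fin 0 →₀ ℕ) (PowerSeries.coeff n
      (finSuccEquiv ℂ 0 (PowerSeries.coeff l (finSuccEquiv ℂ 1
        (PowerSeries.coeff k (finSuccEquiv ℂ 2 (PowerSeries.coeff 0 (finSuccEquiv ℂ 3 f)))))))) := by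
    rw [PowerSeries.coeff_zero_eq_constantCoeff_apply]
    rfl
  rw [h0, coeff_coeff_finSuccEquiv, coeff_coeff_finSuccEquiv, coeff_coeff_finSuccEquiv,
    coeff_coeff_finSuccEquiv]
  rfl

theorem cf_add (k l : ℕ) (f g : GraphRing) : cf k l (f + g) = cf k l f + cf k l g := by
  ext n; simp [coeff_cf]

theorem cf_sub (k l : ℕ) (f g : GraphRing) : cf k l (f - g) = cf k l f - cf k l g := by
  ext n; simp [coeff_cf]

theorem cf_zero (k l : ℕ) : cf k l 0 = 0 := by
  ext n; simp [coeff_cf]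

theorem cf_C_mul (k l : ℕ) (c : ℂ) (f : GraphRing) :
    cf k l (C c * f) = PowerSeries.C c * cf k l f := by
  ext n; simp [coeff_cf]

theorem cf_mul (k l : ℕ) (f g : GraphRing) : cf k l (f * g) =
    ∑ i ∈ Finset.range (k + 1), ∑ j ∈ Finset.range (l + 1), cf i j f * cf (k - i) (l - j) g := by
  simp only [cf]
  rw [map_mul, map_mul, PowerSeries.coeff_mul, Finset.Nat.sum_antidiagonal_eq_sum_range_succ
    (fun a b => PowerSeries.coeff a (finSuccEquiv ℂ 2 (tZero f)) *
      PowerSeries.coeff b (finSuccEquiv ℂ 2 (tZero g))), map_sum, map_sum, map_sum]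
  refine Finset.sum_congr rfl fun i _ => ?_
  rw [map_mul, PowerSeries.coeff_mul, map_sum, Finset.Nat.sum_antidiagonal_eq_sum_range_succ_mk]
  exact Finset.sum_congr rfl fun j _ => by rw [map_mul]

theorem cf_X_three_mul (k l : ℕ) (f : GraphRing) :
    cf k l (X 3 * f) = PowerSeries.X * cf k l f := by
  classical
  ext n
  rw [coeff_cf, X, coeff_monomial_mul, one_mul]
  rcases n with _ | n
  · rw [if_neg, PowerSeries.coeff_zero_X_mul]
    intro h
    simpa using h 3
  · rw [if_pos, PowerSeries.coeff_succ_X_mul, coeff_cf]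
    · congr 2
      ext i; fin_cases i <;> simp
    · intro i; fin_cases i <;> simp

theorem cf_X_three_pow_mul (k l a : ℕ) (f : GraphRing) :
    cf k l (X 3 ^ a * f) = PowerSeries.X ^ a * cf k l f := by
  induction a with
  | zero => simp
  | succ a ih => rw [pow_succ', pow_succ', mul_assoc, mul_assoc, cf_X_three_mul, ih]

/-- The Euler derivation `u d/du` shifted by `-N`: it acts on `φ` as `u d/du` acts on `u⁻ᴺ φ`. -/
def eul (N : ℕ) (φ : PowerSeries ℂ) : PowerSeries ℂ :=
  PowerSeries.mk fun n => ((n : ℂ) - N) * PowerSeries.coeff n φ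

@[simp] theorem coeff_eul (N n : ℕ) (φ : PowerSeries ℂ) :
    PowerSeries.coeff n (eul N φ) = ((n : ℂ) - N) * PowerSeries.coeff n φ :=
  PowerSeries.coeff_mk _ _

theorem cf_pderiv_one (k l : ℕ) (f : GraphRing) :
    cf k l (pderiv ℂ 1 f) = (k + 1 : PowerSeries ℂ) * cf (k + 1) l f := by
  ext n
  have h1 : (k + 1 : PowerSeries ℂ) = PowerSeries.C ((k : ℂ) + 1) := by simp
  rw [h1, PowerSeries.coeff_C_mul, coeff_cf, coeff_cf, coeff_pderiv, mul_comm]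
  congr 2
  congr 1
  ext i; fin_cases i <;> simp

theorem cf_eul (k l : ℕ) (f : GraphRing) :
    cf k l (X 3 * pderiv ℂ 3 f) = eul 0 (cf k l f) := by
  rw [cf_X_three_mul]
  ext n
  rcases n with _ | n
  · simp
  · rw [PowerSeries.coeff_succ_X_mul, coeff_cf, coeff_pderiv, coeff_eul, coeff_cf, mul_comm]
    have : expo k l n + Finsupp.single 3 1 = expo k l (n + 1) := by
      ext i; fin_cases i <;> simp
    rw [this]
    simp

/-- Complex conjugation of formal series: conjugate coefficients and exchange `z` and `ζ`. -/
def conjSwap : GraphRing →+* GraphRing :=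
  ((rename (R := ℂ) (Equiv.swap (1 : Fin 4) 2)).toRingHom).comp (map (starRingEnd ℂ))

theorem conjSwap_eq_subst (f : GraphRing) :
    conjSwap f = subst (X ∘ Equiv.swap (1 : Fin 4) 2) (map (starRingEnd ℂ) f) :=
  rename_eq_subst _ _

theorem coeff_conjSwap (k l n : ℕ) (f : GraphRing) :
    coeff (expo k l n) (conjSwap f) = starRingEnd ℂ (coeff (expo l k n) f) := by
  have h : expo k l n = Finsupp.embDomain (Equiv.swap (1 : Fin 4) 2).toEmbedding (expo l k n) := by
    ext i
    have hi : i = (Equiv.swap (1 : Fin 4) 2).toEmbedding (Equiv.swap (1 : Fin 4) 2 i) := by simp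
    conv_rhs => rw [hi, Finsupp.embDomain_apply_self]
    fin_cases i <;> rfl
  rw [h]
  exact (coeff_embDomain_rename (Equiv.swap (1 : Fin 4) 2).toEmbedding _ _).trans (coeff_map _ _ _)

theorem cf_conjSwap (k l : ℕ) (f : GraphRing) :
    cf k l (conjSwap f) = PowerSeries.map (starRingEnd ℂ) (cf l k f) := by
  ext n
  rw [coeff_cf, coeff_conjSwap, PowerSeries.coeff_map, coeff_cf]

theorem conjSwap_C (c : ℂ) : conjSwap (C c) = C (starRingEnd ℂ c) := by
  simp [conjSwap]

theorem conjSwap_X (i : Fin 4) : conjSwap (X i) = X (Equiv.swap 1 2 i) := by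
  simp [conjSwap]

theorem conjSwap_holSub {V : GraphRing} (hV0 : constantCoeff V = 0) (hV : conjSwap V = V)
    (f : MvPowerSeries (Fin 2) ℂ) :
    conjSwap (holSub V f) = antiSub V (map (starRingEnd ℂ) f) := by
  have hw : conjSwap (wPlus V) = wMinus V := by
    rw [wPlus, wMinus, map_add, map_mul, map_add, hV, conjSwap_C, conjSwap_X, conjSwap_X,
      Complex.conj_I, map_neg]
    have h3 : Equiv.swap (1 : Fin 4) 2 3 = 3 := by decide
    have h0 : Equiv.swap (1 : Fin 4) 2 0 = 0 := by decide
    rw [h3, h0]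
    ring
  have hconst : ∀ i, constantCoeff (map (starRingEnd ℂ) ((![X 1, wPlus V] : Fin 2 → GraphRing) i))
      = 0 := fun i => by rw [constantCoeff_map, constantCoeff_holVars hV0, map_zero]
  rw [conjSwap_eq_subst, holSub, map_subst (hasSubst_holVars hV0),
    subst_comp_subst_apply (hasSubst_of_constantCoeff_zero hconst) (HasSubst.X_comp _), antiSub]
  congr 1
  funext i
  rw [← conjSwap_eq_subst]
  fin_cases i
  · exact conjSwap_X 1
  · exact hw

/-- Series whose components of bidegree `(k, l)` in `(z, ζ)` on `t = 0` vanish if `k < 4` or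
`l < 4`. All computations are made modulo this ideal. -/
def negl : Ideal GraphRing where
  carrier := {f | ∀ k l, k < 4 ∨ l < 4 → cf k l f = 0}
  add_mem' ha hb k l h := by rw [cf_add, ha k l h, hb k l h, add_zero]
  zero_mem' k l _ := cf_zero k l
  smul_mem' c f hf k l h := by
    rw [smul_eq_mul, cf_mul]
    refine Finset.sum_eq_zero fun i _ => Finset.sum_eq_zero fun j _ => ?_
    rw [hf _ _ (by omega), mul_zero]

theorem mem_negl_of_X_dvd {f : GraphRing} (h : X 0 ∣ f) : f ∈ negl := by
  intro k l _
  ext n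
  rw [coeff_cf, X_dvd_iff.1 h _ (expo_zero k l n), map_zero]

theorem mem_negl_of_pow_dvd {f : GraphRing} (h1 : X 1 ^ 4 ∣ f) (h2 : X 2 ^ 4 ∣ f) : f ∈ negl := by
  intro k l h
  ext n
  rw [coeff_cf, map_zero]
  rcases h with h | h
  · exact X_pow_dvd_iff.1 h1 _ (by simpa using h)
  · exact X_pow_dvd_iff.1 h2 _ (by simpa using h)

theorem mem_negl_of_X_three_pow_mul {a : ℕ} {f : GraphRing} (h : X 3 ^ a * f ∈ negl) :
    f ∈ negl := by
  intro k l hkl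
  have := h k l hkl
  rw [cf_X_three_pow_mul] at this
  exact (mul_eq_zero.1 this).resolve_left (pow_ne_zero _ PowerSeries.X_ne_zero)

theorem conjSwap_mem_negl {f : GraphRing} (h : f ∈ negl) : conjSwap f ∈ negl := by
  intro k l hkl
  rw [cf_conjSwap, h l k hkl.symm, map_zero]

end Components

/-! ### Formal Taylor expansion along the hypersurface -/

section Taylor

/-- The binomial coefficients `x (x - 1) ⋯ (x - i + 1) / i!` for `i ≤ 3`. -/
def binomCoeff : ℕ → ℂ → ℂ
  | 0, _ => 1
  | 1, x => x
  | 2, x => x * (x - 1) * (1 / 2)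
  | _, x => x * (x - 1) * (x - 2) * (1 / 6)

/-- The operator `f ↦ w ^ (N + i) / i! * ∂_w ^ i (w⁻ᴺ f)`, for `i ≤ 3`. -/
def binomOp (N i : ℕ) (f : MvPowerSeries (Fin 2) ℂ) : MvPowerSeries (Fin 2) ℂ :=
  fun d => binomCoeff i ((d 1 : ℂ) - N) * coeff d f

theorem coeff_binomOp (N i : ℕ) (f : MvPowerSeries (Fin 2) ℂ) (d : Fin 2 →₀ ℕ) :
    coeff d (binomOp N i f) = binomCoeff i ((d 1 : ℂ) - N) * coeff d f := rfl

theorem binomOp_add (N i : ℕ) (f g : MvPowerSeries (Fin 2) ℂ) :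
    binomOp N i (f + g) = binomOp N i f + binomOp N i g := by
  ext d
  simp [coeff_binomOp, mul_add]

theorem binomOp_monomial (N i : ℕ) (d : Fin 2 →₀ ℕ) (c : ℂ) :
    binomOp N i (monomial d c) = monomial d (binomCoeff i ((d 1 : ℂ) - N) * c) := by
  classical
  ext e
  rw [coeff_binomOp, coeff_monomial, coeff_monomial]
  split_ifs with h
  · rw [h]
  · rw [mul_zero]

/-- The embedding `{z, w} → {t, z, ζ, u}` of the variables with `z ↦ z` and `w ↦ u`. -/
def baseEmb : Fin 2 ↪ Fin 4 := ⟨![1, 3], by decide⟩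

/-- The series `f(z, u)`. -/
def baseSub (f : MvPowerSeries (Fin 2) ℂ) : GraphRing := rename (R := ℂ) baseEmb f

/-- Truncated Taylor expansion of `(1 + s)⁻ᴺ f(z, u (1 + s))` in `s`. -/
def taylor (N : ℕ) (f : MvPowerSeries (Fin 2) ℂ) (s : GraphRing) : GraphRing :=
  ∑ i ∈ Finset.range 4, baseSub (binomOp N i f) * s ^ i

/-- The coefficient of `z ^ k` in `f(z, u)`, as a power series in `u`. -/
def row (k : ℕ) (f : MvPowerSeries (Fin 2) ℂ) : PowerSeries ℂ :=
  PowerSeries.mk fun n => coeff (Finsupp.cons k (Finsupp.cons n 0)) f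

theorem coeff_row (k n : ℕ) (f : MvPowerSeries (Fin 2) ℂ) :
    PowerSeries.coeff n (row k f) = coeff (Finsupp.cons k (Finsupp.cons n 0)) f :=
  PowerSeries.coeff_mk _ _

theorem expo_eq_embDomain (k n : ℕ) : expo k 0 n =
    Finsupp.embDomain baseEmb (Finsupp.cons k (Finsupp.cons n 0)) := by
  ext i
  fin_cases i
  · exact (Finsupp.embDomain_of_notMem_range _ _ _ (by decide)).symm
  · exact (Finsupp.embDomain_apply_self baseEmb (Finsupp.cons k (Finsupp.cons n 0)) 0).symm
  · exact (Finsupp.embDomain_of_notMem_range _ _ _ (by decide)).symm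
  · exact (Finsupp.embDomain_apply_self baseEmb (Finsupp.cons k (Finsupp.cons n 0)) 1).symm

theorem cf_baseSub_zero (k : ℕ) (f : MvPowerSeries (Fin 2) ℂ) : cf k 0 (baseSub f) = row k f := by
  ext n
  rw [coeff_cf, coeff_row, baseSub, expo_eq_embDomain, coeff_embDomain_rename]

theorem cf_baseSub_of_ne_zero (k : ℕ) {l : ℕ} (hl : l ≠ 0) (f : MvPowerSeries (Fin 2) ℂ) :
    cf k l (baseSub f) = 0 := by
  ext n
  rw [coeff_cf, baseSub, map_zero]
  refine coeff_rename_eq_zero _ _ ?_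
  rintro ⟨x, hx⟩
  have h1 : (Finsupp.mapDomain baseEmb x) 2 = 0 := by
    rw [← Finsupp.embDomain_eq_mapDomain]
    exact Finsupp.embDomain_of_notMem_range _ _ _ (by decide)
  rw [hx] at h1
  exact hl h1

/-- The truncated binomial series `(1 + s) ^ x`. -/
def binomSeries (x : ℂ) (s : GraphRing) : GraphRing :=
  ∑ i ∈ Finset.range 4, C (binomCoeff i x) * s ^ i

theorem pow_four_dvd_binomSeries_succ (x : ℂ) (s : GraphRing) :
    s ^ 4 ∣ (1 + s) * binomSeries x s - binomSeries (x + 1) s := by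
  refine ⟨C (x * (x - 1) * (x - 2) * (1 / 6)), ?_⟩
  have h2 : (2 : GraphRing) * C (1 / 2) = 1 := by
    rw [← map_ofNat C 2, ← map_mul]; norm_num
  have h6 : (3 : GraphRing) * C (1 / 6) = C (1 / 2) := by
    rw [← map_ofNat C 3, ← map_mul]; norm_num
  simp only [binomSeries, Finset.sum_range_succ, Finset.sum_range_zero, binomCoeff, map_mul,
    map_sub, map_add, map_one, map_ofNat]
  linear_combination (-(C x) * s ^ 2) * h2 - (C x * (C x - 1) * s ^ 3) * h6

theorem pow_four_dvd_binomSeries_add (x : ℂ) (N : ℕ) (s : GraphRing) :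
    s ^ 4 ∣ (1 + s) ^ N * binomSeries x s - binomSeries (x + N) s := by
  induction N with
  | zero => simp
  | succ N ih =>
    have h := pow_four_dvd_binomSeries_succ (x + N) s
    have e : (1 + s) ^ (N + 1) * binomSeries x s - binomSeries (x + (N + 1 : ℕ)) s =
        (1 + s) * ((1 + s) ^ N * binomSeries x s - binomSeries (x + N) s) +
        ((1 + s) * binomSeries (x + N) s - binomSeries (x + N + 1) s) := by
      push_cast
      rw [← add_assoc]
      ring
    rw [e]
    exact dvd_add (ih.mul_left _) h

theorem pow_four_dvd_binomSeries_sub (a N : ℕ) (s : GraphRing) :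
    s ^ 4 ∣ (1 + s) ^ a - (1 + s) ^ N * binomSeries ((a : ℂ) - N) s := by
  have h1 := pow_four_dvd_binomSeries_add ((a : ℂ) - N) N s
  have h2 := pow_four_dvd_binomSeries_add 0 a s
  have h0 : binomSeries 0 s = 1 := by
    simp [binomSeries, Finset.sum_range_succ, binomCoeff]
  rw [h0, mul_one, zero_add] at h2
  rw [sub_add_cancel] at h1
  have := dvd_sub h2 h1
  rwa [sub_sub_sub_cancel_right] at this

variable {S : GraphRing}

theorem wPlus_eq : wPlus (X 3 * S) = X 3 * (1 + C Complex.I * S) + C Complex.I * X 0 := by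
  rw [wPlus]
  ring

theorem X_zero_dvd_wPlus_pow_sub (n : ℕ) :
    X 0 ∣ wPlus (X 3 * S) ^ n - (X 3 * (1 + C Complex.I * S)) ^ n := by
  refine dvd_trans ?_ (sub_dvd_pow_sub_pow _ _ _)
  rw [wPlus_eq, add_sub_cancel_left]
  exact Dvd.intro_left _ rfl

theorem coeff_expo_wPlus_eq_zero {j a k l n : ℕ} (h : k < j ∨ n < a) :
    coeff (expo k l n) (X 1 ^ j * wPlus (X 3 * S) ^ a) = 0 := by
  rcases h with h | h
  · exact X_pow_dvd_iff.1 (Dvd.intro _ rfl) _ (by simpa using h)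
  · have h1 : X 0 ∣ X 1 ^ j * wPlus (X 3 * S) ^ a - X 1 ^ j * (X 3 * (1 + C Complex.I * S)) ^ a := by
      rw [← mul_sub]
      exact (X_zero_dvd_wPlus_pow_sub a).mul_left _
    have h2 := X_dvd_iff.1 h1 _ (expo_zero k l n)
    rw [map_sub, sub_eq_zero] at h2
    rw [h2, mul_pow]
    have h3 : (X 3 : GraphRing) ^ a ∣ X 1 ^ j * (X 3 ^ a * (1 + C Complex.I * S) ^ a) :=
      ⟨X 1 ^ j * (1 + C Complex.I * S) ^ a, by ring⟩
    exact X_pow_dvd_iff.1 h3 _ (by simpa using h)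

theorem holSub_monomial (hS : constantCoeff (X 3 * S) = 0) (d : Fin 2 →₀ ℕ) (c : ℂ) :
    holSub (X 3 * S) (monomial d c) = C c * (X 1 ^ d 0 * wPlus (X 3 * S) ^ d 1) := by
  rw [holSub, subst_monomial (hasSubst_holVars hS), Finsupp.prod_fintype _ _ (fun _ => pow_zero _),
    Fin.prod_univ_two]
  rfl

theorem baseSub_monomial (d : Fin 2 →₀ ℕ) (c : ℂ) :
    baseSub (monomial d c) = C c * (X 1 ^ d 0 * X 3 ^ d 1) := by
  have h : Finsupp.mapDomain baseEmb d = Finsupp.single 1 (d 0) + Finsupp.single 3 (d 1) := by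
    have hd : d = Finsupp.single 0 (d 0) + Finsupp.single 1 (d 1) := by
      ext i; fin_cases i <;> simp
    conv_lhs => rw [hd]
    rw [Finsupp.mapDomain_add, Finsupp.mapDomain_single, Finsupp.mapDomain_single]
    rfl
  rw [baseSub, rename_monomial, h, X_pow_eq, X_pow_eq, monomial_mul_monomial, ← smul_eq_C_mul,
    ← map_smul, smul_eq_mul, one_mul, mul_one]

/-- A series of high order in `(z, u)` does not contribute to a given coefficient; this allows one
to check identities linear in `f` on polynomials. -/
theorem coeff_mul_baseSub_eq_zero {f : MvPowerSeries (Fin 2) ℂ} {k l n : ℕ}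
    (hf : ∀ d, d.degree < k + n + 1 → coeff d f = 0) (g : GraphRing) :
    coeff (expo k l n) (baseSub f * g) = 0 := by
  classical
  rw [coeff_mul]
  refine Finset.sum_eq_zero fun q hq => ?_
  rw [Finset.HasAntidiagonal.mem_antidiagonal] at hq
  have h1 : coeff q.1 (baseSub f) = 0 := by
    by_cases hr : q.1 ∈ Set.range (Finsupp.mapDomain baseEmb)
    · obtain ⟨x, hx⟩ := hr
      rw [← Finsupp.embDomain_eq_mapDomain] at hx
      rw [← hx, baseSub, coeff_embDomain_rename]
      refine hf x ?_
      have hk : x 0 ≤ k := by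
        have e1 : q.1 1 = x 0 := by
          rw [← hx]; exact Finsupp.embDomain_apply_self baseEmb x 0
        have e2 := DFunLike.congr_fun hq 1
        rw [Finsupp.add_apply, expo_one, e1] at e2
        omega
      have hn : x 1 ≤ n := by
        have e1 : q.1 3 = x 1 := by
          rw [← hx]; exact Finsupp.embDomain_apply_self baseEmb x 1
        have e2 := DFunLike.congr_fun hq 3
        rw [Finsupp.add_apply, expo_three, e1] at e2
        omega
      rw [Finsupp.degree_eq_sum, Fin.sum_univ_two]
      omega
    · exact coeff_rename_eq_zero _ _ hr
  rw [h1, zero_mul]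

theorem taylor_add (N : ℕ) (f g : MvPowerSeries (Fin 2) ℂ) (s : GraphRing) :
    taylor N (f + g) s = taylor N f s + taylor N g s := by
  rw [taylor, taylor, taylor, ← Finset.sum_add_distrib]
  refine Finset.sum_congr rfl fun i _ => ?_
  rw [binomOp_add, baseSub, map_add, add_mul]
  rfl

/-- Taylor expansion of `f(z, w)` at `w = u (1 + i S)` on `t = 0`, with the factor
`w ^ N = u ^ N (1 + i S) ^ N` split off. -/
theorem holSub_sub_taylor_mem (h1 : X 1 ∣ S) (h2 : X 2 ∣ S) (N : ℕ)
    (f : MvPowerSeries (Fin 2) ℂ) :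
    holSub (X 3 * S) f - (1 + C Complex.I * S) ^ N * taylor N f (C Complex.I * S) ∈ negl := by
  have hS : constantCoeff (X 3 * S) = 0 := by simp
  set s := C Complex.I * S with hs
  set F : MvPowerSeries (Fin 2) ℂ → GraphRing := fun f =>
    holSub (X 3 * S) f - (1 + s) ^ N * taylor N f s with hF
  have hadd : ∀ f g, F (f + g) = F f + F g := by
    intro f g
    simp only [hF]
    rw [holSub_add hS, taylor_add]
    ring
  have hmon : ∀ d c, F (monomial d c) ∈ negl := by
    intro d c
    have e : F (monomial d c) = C c * X 1 ^ d 0 * (wPlus (X 3 * S) ^ d 1 - (X 3 * (1 + s)) ^ d 1) +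
        C c * X 1 ^ d 0 * X 3 ^ d 1 *
          ((1 + s) ^ d 1 - (1 + s) ^ N * binomSeries ((d 1 : ℂ) - N) s) := by
      have ht : taylor N (monomial d c) s =
          C c * X 1 ^ d 0 * X 3 ^ d 1 * binomSeries ((d 1 : ℂ) - N) s := by
        rw [taylor, binomSeries, Finset.mul_sum]
        refine Finset.sum_congr rfl fun i _ => ?_
        rw [binomOp_monomial, baseSub_monomial, map_mul]
        ring
      simp only [hF]
      rw [holSub_monomial hS, ht, mul_pow]
      ring
    rw [e]
    refine add_mem (negl.mul_mem_left _ (mem_negl_of_X_dvd (X_zero_dvd_wPlus_pow_sub _)))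
      (negl.mul_mem_left _ (negl.mem_of_dvd (pow_four_dvd_binomSeries_sub _ _ _) ?_))
    have hs1 : X 1 ∣ s := h1.mul_left _
    have hs2 : X 2 ∣ s := h2.mul_left _
    exact mem_negl_of_pow_dvd (pow_dvd_pow_of_dvd hs1 4) (pow_dvd_pow_of_dvd hs2 4)
  have hpoly : ∀ p : MvPolynomial (Fin 2) ℂ, F p ∈ negl := by
    intro p
    induction p using MvPolynomial.induction_on' with
    | monomial d c =>
      rw [MvPolynomial.coe_monomial]
      exact hmon d c
    | add p q hp hq =>
      rw [MvPolynomial.coe_add, hadd]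
      exact add_mem hp hq
  have hrest : ∀ (k l n : ℕ) (f : MvPowerSeries (Fin 2) ℂ),
      (∀ d, d.degree < k + n + 1 → coeff d f = 0) → coeff (expo k l n) (F f) = 0 := by
    intro k l n f hf
    simp only [hF]
    rw [map_sub, holSub, coeff_subst (hasSubst_holVars hS), finsum_eq_zero_of_forall_eq_zero,
      zero_sub, neg_eq_zero, taylor, Finset.mul_sum, map_sum]
    · refine Finset.sum_eq_zero fun i _ => ?_
      rw [mul_left_comm]
      refine coeff_mul_baseSub_eq_zero (fun d hd => ?_) _
      rw [coeff_binomOp, hf d hd, mul_zero]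
    · intro d
      by_cases hd : d.degree < k + n + 1
      · rw [hf d hd, zero_smul]
      · rw [Finsupp.prod_fintype _ _ (fun _ => pow_zero _), Fin.prod_univ_two]
        rw [Finsupp.degree_eq_sum, Fin.sum_univ_two] at hd
        have := coeff_expo_wPlus_eq_zero (S := S) (j := d 0) (a := d 1) (k := k) (l := l) (n := n)
          (by omega)
        simp only [Matrix.cons_val_zero, Matrix.cons_val_one]
        rw [this, smul_zero]
  intro k l hkl
  ext n
  have hsplit : f = (truncTotal (k + n + 1) f : MvPowerSeries (Fin 2) ℂ) +
      (f - (truncTotal (k + n + 1) f : MvPolynomial (Fin 2) ℂ)) := by ring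
  have hp := hpoly (truncTotal (k + n + 1) f) k l hkl
  have hp' := congrArg (PowerSeries.coeff n) hp
  rw [coeff_cf] at hp' ⊢
  change coeff (expo k l n) (F f) = _
  rw [hsplit, hadd, map_add, hp', hrest, map_zero, add_zero]
  intro d hd
  rw [map_sub, MvPolynomial.coeff_coe, coeff_truncTotal _ hd, sub_self]

end Taylor

/-! ### Components of products -/

section Normal

/-- The only component of bidegree `(k, l)` in `(z, ζ)` with `k < 2` or `l < 2` is the one of
bidegree `(1, 1)`. -/
def IsNormal (S : GraphRing) : Prop := ∀ k l, k < 2 ∨ l < 2 → ¬ (k = 1 ∧ l = 1) → cf k l S = 0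

variable {S T : GraphRing}

theorem IsNormal.cf_zero_right (hS : IsNormal S) (k : ℕ) : cf k 0 S = 0 :=
  hS k 0 (Or.inr (by norm_num)) (by omega)

theorem IsNormal.cf_zero_left (hS : IsNormal S) (l : ℕ) : cf 0 l S = 0 :=
  hS 0 l (Or.inl (by norm_num)) (by omega)

theorem IsNormal.cf_mul_zero_right (hS : IsNormal S) (k : ℕ) (T : GraphRing) :
    cf k 0 (S * T) = 0 := by
  rw [cf_mul]
  refine Finset.sum_eq_zero fun i _ => ?_
  rw [Finset.sum_range_one, hS.cf_zero_right, zero_mul]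

theorem IsNormal.cf_mul_zero_left (hS : IsNormal S) (l : ℕ) (T : GraphRing) :
    cf 0 l (S * T) = 0 := by
  rw [cf_mul, Finset.sum_range_one]
  refine Finset.sum_eq_zero fun i _ => ?_
  rw [hS.cf_zero_left, zero_mul]

theorem IsNormal.cf_mul_one_right (hS : IsNormal S) (k : ℕ) (T : GraphRing) :
    cf (k + 1) 1 (S * T) = cf 1 1 S * cf k 0 T := by
  rw [cf_mul, Finset.sum_eq_single 1]
  · rw [Finset.sum_range_succ, Finset.sum_range_one, hS.cf_zero_right]
    simp
  · intro i _ hi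
    rw [Finset.sum_range_succ, Finset.sum_range_one, hS.cf_zero_right,
      hS i 1 (Or.inr (by norm_num)) (by omega)]
    simp
  · intro h
    simp at h

theorem IsNormal.cf_mul_one_left (hS : IsNormal S) (l : ℕ) (T : GraphRing) :
    cf 1 (l + 1) (S * T) = cf 1 1 S * cf 0 l T := by
  rw [cf_mul, Finset.sum_range_succ, Finset.sum_range_one, Finset.sum_eq_zero, zero_add,
    Finset.sum_eq_single 1]
  · simp
  · intro i _ hi
    rw [hS 1 i (Or.inl (by norm_num)) (by omega)]
    simp
  · intro h
    simp at h
  · intro i _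
    rw [hS.cf_zero_left, zero_mul]

theorem IsNormal.cf_mul_two_two (hS : IsNormal S) (T : GraphRing) :
    cf 2 2 (S * T) = cf 1 1 S * cf 1 1 T + cf 2 2 S * cf 0 0 T := by
  have h12 := hS 1 2 (by omega) (by omega)
  have h21 := hS 2 1 (by omega) (by omega)
  simp [cf_mul, Finset.sum_range_succ, hS.cf_zero_left, hS.cf_zero_right, h12, h21]

theorem IsNormal.cf_mul_three_two (hS : IsNormal S) (T : GraphRing) :
    cf 3 2 (S * T) = cf 1 1 S * cf 2 1 T + cf 2 2 S * cf 1 0 T + cf 3 2 S * cf 0 0 T := by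
  have h12 := hS 1 2 (by omega) (by omega)
  have h21 := hS 2 1 (by omega) (by omega)
  have h31 := hS 3 1 (by omega) (by omega)
  simp [cf_mul, Finset.sum_range_succ, hS.cf_zero_left, hS.cf_zero_right, h12, h21, h31]

theorem IsNormal.cf_mul_two_three (hS : IsNormal S) (T : GraphRing) :
    cf 2 3 (S * T) = cf 1 1 S * cf 1 2 T + cf 2 2 S * cf 0 1 T + cf 2 3 S * cf 0 0 T := by
  have h12 := hS 1 2 (by omega) (by omega)
  have h13 := hS 1 3 (by omega) (by omega)
  have h21 := hS 2 1 (by omega) (by omega)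
  simp [cf_mul, Finset.sum_range_succ, hS.cf_zero_left, hS.cf_zero_right, h12, h21, h13]
  ring

theorem IsNormal.cf_mul_three_three (hS : IsNormal S) (T : GraphRing) :
    cf 3 3 (S * T) = cf 1 1 S * cf 2 2 T + cf 2 2 S * cf 1 1 T + cf 2 3 S * cf 1 0 T +
      cf 3 2 S * cf 0 1 T + cf 3 3 S * cf 0 0 T := by
  have h12 := hS 1 2 (by omega) (by omega)
  have h13 := hS 1 3 (by omega) (by omega)
  have h21 := hS 2 1 (by omega) (by omega)
  have h31 := hS 3 1 (by omega) (by omega)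
  simp [cf_mul, Finset.sum_range_succ, hS.cf_zero_left, hS.cf_zero_right, h12, h21, h13, h31]
  ring

theorem IsNormal.mul (hS : IsNormal S) (hT : IsNormal T) : IsNormal (S * T) := by
  intro k l h hkl
  rw [cf_mul]
  refine Finset.sum_eq_zero fun i hi => Finset.sum_eq_zero fun j hj => ?_
  rw [Finset.mem_range] at hi hj
  by_cases h1 : (i < 2 ∨ j < 2) ∧ ¬ (i = 1 ∧ j = 1)
  · rw [hS i j h1.1 h1.2, zero_mul]
  · rw [hT (k - i) (l - j) (by omega) (by omega), mul_zero]

theorem IsNormal.add (hS : IsNormal S) (hT : IsNormal T) : IsNormal (S + T) := by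
  intro k l h hkl
  rw [cf_add, hS k l h hkl, hT k l h hkl, add_zero]

theorem IsNormal.C_mul (hS : IsNormal S) (c : ℂ) : IsNormal (C c * S) := by
  intro k l h hkl
  rw [cf_C_mul, hS k l h hkl, mul_zero]

theorem eul_zero (N : ℕ) : eul N 0 = 0 := by
  ext n
  simp

theorem IsNormal.euler (hS : IsNormal S) : IsNormal (X 3 * pderiv ℂ 3 S) := by
  intro k l h hkl
  rw [cf_eul, hS k l h hkl, eul_zero]

/-- The derivative of `S` with respect to `z` has no component of bidegree `(k, 0)`. -/
theorem IsNormal.cf_pderiv_mul_zero_right (hS : IsNormal S) (k : ℕ) (T : GraphRing) :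
    cf k 0 (pderiv ℂ 1 S * T) = 0 := by
  rw [cf_mul]
  refine Finset.sum_eq_zero fun i _ => ?_
  rw [Finset.sum_range_one, cf_pderiv_one, hS.cf_zero_right, mul_zero, zero_mul]

theorem IsNormal.cf_pderiv_zero_left (hS : IsNormal S) {l : ℕ} (hl : l ≠ 1) :
    cf 0 l (pderiv ℂ 1 S) = 0 := by
  rw [cf_pderiv_one, hS (0 + 1) l (by omega) (by omega), mul_zero]

theorem IsNormal.cf_pderiv_zero_one : cf 0 1 (pderiv ℂ 1 S) = cf 1 1 S := by
  rw [cf_pderiv_one]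
  simp

theorem IsNormal.cf_pderiv_one_right (hS : IsNormal S) {k : ℕ} (hk : k ≠ 0) :
    cf k 1 (pderiv ℂ 1 S) = 0 := by
  rw [cf_pderiv_one, hS (k + 1) 1 (by omega) (by omega), mul_zero]

theorem IsNormal.cf_pderiv_mul_zero_left (hS : IsNormal S) (l : ℕ) (T : GraphRing) :
    cf 0 (l + 1) (pderiv ℂ 1 S * T) = cf 1 1 S * cf 0 l T := by
  rw [cf_mul, Finset.sum_range_one, Finset.sum_eq_single 1]
  · rw [cf_pderiv_zero_one]
    simp
  · intro i _ hi
    rw [hS.cf_pderiv_zero_left hi, zero_mul]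
  · intro h
    simp at h

theorem IsNormal.cf_pderiv_mul_one_right (hS : IsNormal S) (k : ℕ) (T : GraphRing) :
    cf k 1 (pderiv ℂ 1 S * T) = cf 1 1 S * cf k 0 T := by
  rw [cf_mul, Finset.sum_eq_single 0]
  · rw [Finset.sum_range_succ, Finset.sum_range_one, cf_pderiv_zero_one,
      hS.cf_pderiv_zero_left (by omega)]
    simp
  · intro i _ hi
    rw [Finset.sum_range_succ, Finset.sum_range_one, hS.cf_pderiv_one_right hi, cf_pderiv_one,
      hS.cf_zero_right]
    simp
  · intro h
    simp at h

/-- If `cf 0 l T = 0` for all `l ≠ 0`, the component of bidegree `(1, l + 2)` of `S_z T` has only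
two terms. -/
theorem IsNormal.cf_pderiv_mul_one_left (hS : IsNormal S) (l : ℕ)
    (hT : ∀ l, cf 0 (l + 1) T = 0) :
    cf 1 (l + 2) (pderiv ℂ 1 S * T) = cf 1 1 S * cf 1 (l + 1) T +
      2 * cf 2 (l + 2) S * cf 0 0 T := by
  rw [cf_mul, Finset.sum_range_succ, Finset.sum_range_one]
  congr 1
  · rw [Finset.sum_eq_single 1]
    · rw [cf_pderiv_zero_one]
      congr 2
    · intro i _ hi
      rw [hS.cf_pderiv_zero_left hi, zero_mul]
    · intro h
      simp at h
  · rw [Finset.sum_range_succ, Finset.sum_eq_zero, zero_add, cf_pderiv_one]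
    · simp only [Nat.sub_self, Nat.cast_one]
      norm_num
    · intro i hi
      rw [Finset.mem_range] at hi
      obtain ⟨j, hj⟩ : ∃ j, l + 2 - i = j + 1 := ⟨l + 2 - i - 1, by omega⟩
      rw [Nat.sub_self, hj, hT, mul_zero]

theorem IsNormal.cf_pderiv_mul_two_two (hS : IsNormal S) (T : GraphRing) :
    cf 2 2 (pderiv ℂ 1 S * T) = cf 1 1 S * cf 2 1 T + 2 * cf 2 2 S * cf 1 0 T +
      3 * cf 3 2 S * cf 0 0 T := by
  have h12 := hS 1 2 (by omega) (by omega)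
  have h21 := hS 2 1 (by omega) (by omega)
  have h31 := hS 3 1 (by omega) (by omega)
  simp [cf_mul, Finset.sum_range_succ, cf_pderiv_one, hS.cf_zero_right, h12, h21, h31]
  norm_num

theorem IsNormal.cf_pderiv_mul_three_two (hS : IsNormal S) (T : GraphRing) :
    cf 3 2 (pderiv ℂ 1 S * T) = cf 1 1 S * cf 3 1 T + 2 * cf 2 2 S * cf 2 0 T +
      3 * cf 3 2 S * cf 1 0 T + 4 * cf 4 2 S * cf 0 0 T := by
  have h12 := hS 1 2 (by omega) (by omega)
  have h21 := hS 2 1 (by omega) (by omega)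
  have h31 := hS 3 1 (by omega) (by omega)
  have h41 := hS 4 1 (by omega) (by omega)
  simp [cf_mul, Finset.sum_range_succ, cf_pderiv_one, hS.cf_zero_right, h12, h21, h31, h41]
  norm_num

theorem IsNormal.cf_pderiv_mul_two_three (hS : IsNormal S) (T : GraphRing) :
    cf 2 3 (pderiv ℂ 1 S * T) = cf 1 1 S * cf 2 2 T + 2 * cf 2 2 S * cf 1 1 T +
      3 * cf 3 2 S * cf 0 1 T + 2 * cf 2 3 S * cf 1 0 T + 3 * cf 3 3 S * cf 0 0 T := by
  have h12 := hS 1 2 (by omega) (by omega)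
  have h13 := hS 1 3 (by omega) (by omega)
  have h21 := hS 2 1 (by omega) (by omega)
  have h31 := hS 3 1 (by omega) (by omega)
  simp [cf_mul, Finset.sum_range_succ, cf_pderiv_one, hS.cf_zero_right, h12, h21, h31, h13]
  ring

theorem IsNormal.cf_pderiv_mul_three_three (hS : IsNormal S) (T : GraphRing) :
    cf 3 3 (pderiv ℂ 1 S * T) = cf 1 1 S * cf 3 2 T + 2 * cf 2 2 S * cf 2 1 T +
      3 * cf 3 2 S * cf 1 1 T + 4 * cf 4 2 S * cf 0 1 T + 2 * cf 2 3 S * cf 2 0 T +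
      3 * cf 3 3 S * cf 1 0 T + 4 * cf 4 3 S * cf 0 0 T := by
  have h12 := hS 1 2 (by omega) (by omega)
  have h13 := hS 1 3 (by omega) (by omega)
  have h21 := hS 2 1 (by omega) (by omega)
  have h31 := hS 3 1 (by omega) (by omega)
  have h41 := hS 4 1 (by omega) (by omega)
  simp [cf_mul, Finset.sum_range_succ, cf_pderiv_one, hS.cf_zero_right, h12, h21, h31, h13, h41]
  ring

end Normal

section TaylorComponents

variable {S : GraphRing} (N : ℕ) (f : MvPowerSeries (Fin 2) ℂ)

theorem taylor_C_I_mul : taylor N f (C Complex.I * S) = baseSub (binomOp N 0 f) +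
    (C Complex.I * (S * baseSub (binomOp N 1 f)) - S * (S * baseSub (binomOp N 2 f)) -
      C Complex.I * (S * (S * (S * baseSub (binomOp N 3 f))))) := by
  simp only [taylor, Finset.sum_range_succ, Finset.sum_range_zero]
  linear_combination (baseSub (binomOp N 2 f) * S ^ 2 +
    C Complex.I * baseSub (binomOp N 3 f) * S ^ 3) * C_I_mul_C_I

theorem binomOp_zero : binomOp N 0 f = f := by
  ext d
  rw [coeff_binomOp, binomCoeff, one_mul]

theorem row_binomOp_one (k : ℕ) : row k (binomOp N 1 f) = eul N (row k f) := by
  ext n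
  rw [coeff_row, coeff_binomOp, coeff_eul, coeff_row]
  rfl

/-- The operators `binomOp` are polynomials in the Euler derivation. -/
theorem two_mul_row_binomOp_two (k : ℕ) :
    2 * row k (binomOp N 2 f) = eul N (eul N (row k f)) - eul N (row k f) := by
  have h2 : (2 : PowerSeries ℂ) = PowerSeries.C 2 := (map_ofNat _ 2).symm
  ext n
  rw [h2, PowerSeries.coeff_C_mul, coeff_row, coeff_binomOp, map_sub, coeff_eul, coeff_eul,
    coeff_row]
  change 2 * (((n : ℂ) - N) * ((n : ℂ) - N - 1) * (1 / 2) * _) = _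
  ring

theorem six_mul_row_binomOp_three (k : ℕ) :
    6 * row k (binomOp N 3 f) = eul N (eul N (eul N (row k f))) - 3 * eul N (eul N (row k f)) +
      2 * eul N (row k f) := by
  have h2 : (2 : PowerSeries ℂ) = PowerSeries.C 2 := (map_ofNat _ 2).symm
  have h3 : (3 : PowerSeries ℂ) = PowerSeries.C 3 := (map_ofNat _ 3).symm
  have h6 : (6 : PowerSeries ℂ) = PowerSeries.C 6 := (map_ofNat _ 6).symm
  ext n
  rw [h2, h3, h6, map_add, map_sub, PowerSeries.coeff_C_mul, PowerSeries.coeff_C_mul,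
    PowerSeries.coeff_C_mul, coeff_row, coeff_binomOp, coeff_eul, coeff_eul, coeff_eul, coeff_row]
  change 6 * (((n : ℂ) - N) * ((n : ℂ) - N - 1) * ((n : ℂ) - N - 2) * (1 / 6) * _) = _
  ring

end TaylorComponents

/-! ### The tangency equation modulo high components -/

section TaylorRows

variable {S : GraphRing}

theorem cf_taylor_zero_right (hS : IsNormal S) (N k : ℕ) (f : MvPowerSeries (Fin 2) ℂ) :
    cf k 0 (taylor N f (C Complex.I * S)) = row k f := by
  simp [taylor_C_I_mul, cf_add, cf_sub, cf_C_mul, hS.cf_mul_zero_right, cf_baseSub_zero,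
    binomOp_zero]

theorem cf_taylor_zero_left (hS : IsNormal S) (N l : ℕ) (f : MvPowerSeries (Fin 2) ℂ) :
    cf 0 (l + 1) (taylor N f (C Complex.I * S)) = 0 := by
  simp [taylor_C_I_mul, cf_add, cf_sub, cf_C_mul, hS.cf_mul_zero_left, cf_baseSub_of_ne_zero]

theorem cf_taylor_one_right (hS : IsNormal S) (N k : ℕ) (f : MvPowerSeries (Fin 2) ℂ) :
    cf (k + 1) 1 (taylor N f (C Complex.I * S)) =
      PowerSeries.C Complex.I * (cf 1 1 S * row k (binomOp N 1 f)) := by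
  simp [taylor_C_I_mul, cf_add, cf_sub, cf_C_mul, hS.cf_mul_one_right, hS.cf_mul_zero_right,
    cf_baseSub_of_ne_zero, cf_baseSub_zero]

theorem cf_taylor_one_left (hS : IsNormal S) (N l : ℕ) (f : MvPowerSeries (Fin 2) ℂ) :
    cf 1 (l + 2) (taylor N f (C Complex.I * S)) = 0 := by
  simp [taylor_C_I_mul, cf_add, cf_sub, cf_C_mul, hS.cf_mul_one_left, hS.cf_mul_zero_left,
    cf_baseSub_of_ne_zero]

theorem cf_taylor_two_two (hS : IsNormal S) (N : ℕ) (f : MvPowerSeries (Fin 2) ℂ) :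
    cf 2 2 (taylor N f (C Complex.I * S)) =
      PowerSeries.C Complex.I * (cf 2 2 S * row 0 (binomOp N 1 f)) -
        cf 1 1 S * (cf 1 1 S * row 0 (binomOp N 2 f)) := by
  have h11 := fun T => hS.cf_mul_one_right 0 T
  simp only [zero_add] at h11
  simp [taylor_C_I_mul, cf_add, cf_sub, cf_C_mul, hS.cf_mul_two_two, h11, hS.cf_mul_zero_right,
    cf_baseSub_of_ne_zero, cf_baseSub_zero]

theorem cf_taylor_three_two (hS : IsNormal S) (N : ℕ) (f : MvPowerSeries (Fin 2) ℂ) :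
    cf 3 2 (taylor N f (C Complex.I * S)) =
      PowerSeries.C Complex.I * (cf 2 2 S * row 1 (binomOp N 1 f) +
        cf 3 2 S * row 0 (binomOp N 1 f)) -
        cf 1 1 S * (cf 1 1 S * row 1 (binomOp N 2 f)) := by
  have h21 := fun T => hS.cf_mul_one_right 1 T
  simp only [Nat.reduceAdd] at h21
  simp [taylor_C_I_mul, cf_add, cf_sub, cf_C_mul, hS.cf_mul_three_two, h21, hS.cf_mul_zero_right,
    cf_baseSub_of_ne_zero, cf_baseSub_zero]

theorem cf_taylor_two_three (hS : IsNormal S) (N : ℕ) (f : MvPowerSeries (Fin 2) ℂ) :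
    cf 2 3 (taylor N f (C Complex.I * S)) =
      PowerSeries.C Complex.I * (cf 2 3 S * row 0 (binomOp N 1 f)) := by
  have h12 := fun T => hS.cf_mul_one_left 1 T
  simp only [Nat.reduceAdd] at h12
  have h01 := fun T => hS.cf_mul_zero_left 1 T
  simp [taylor_C_I_mul, cf_add, cf_sub, cf_C_mul, hS.cf_mul_two_three, h12, h01,
    hS.cf_mul_zero_right, cf_baseSub_of_ne_zero, cf_baseSub_zero]

theorem cf_taylor_three_three (hS : IsNormal S) (N : ℕ) (f : MvPowerSeries (Fin 2) ℂ) :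
    cf 3 3 (taylor N f (C Complex.I * S)) =
      PowerSeries.C Complex.I * (cf 2 3 S * row 1 (binomOp N 1 f) +
        cf 3 3 S * row 0 (binomOp N 1 f)) -
        2 * cf 1 1 S * cf 2 2 S * row 0 (binomOp N 2 f) -
        PowerSeries.C Complex.I * (cf 1 1 S ^ 3 * row 0 (binomOp N 3 f)) := by
  have h11 := fun T => hS.cf_mul_one_right 0 T
  simp only [zero_add] at h11
  have h01 := fun T => hS.cf_mul_zero_left 1 T
  simp [taylor_C_I_mul, cf_add, cf_sub, cf_C_mul, hS.cf_mul_three_three, hS.cf_mul_two_two, h11, h01,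
    hS.cf_mul_zero_right, cf_baseSub_of_ne_zero, cf_baseSub_zero]
  ring

end TaylorRows

section TangencyComponents

/-- The elimination of the powers of `w` and `w̄` from the tangency equation. -/
theorem cancel_powers {R : Type*} [CommRing R] (k : ℕ)
    {I x α β wP wM hp hq ap aq Γ Γ' Φ Φ' Sz Sζ Su : R} (hP : wP = x * α) (hM : wM = x * β)
    (hΓ : hq = α ^ (k + 1) * Γ) (hΓ' : aq = β ^ (k + 1) * Γ') (hΦ : wP * hp = α ^ (k + 1) * Φ)
    (hΦ' : wM * ap = β ^ (k + 1) * Φ')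
    (h : (wM ^ k * hq - wP ^ k * aq) - I * (2 * (x * Sz) * (wM ^ k * hp) +
      2 * (x * Sζ) * (wP ^ k * ap) + Su * (wM ^ k * hq + wP ^ k * aq)) = 0) :
    x ^ (k + 2) * ((α * β) ^ (k + 1) * (α * (1 - I * Su) * Γ - β * (1 + I * Su) * Γ' -
      I * (2 * (Sz * Φ + Sζ * Φ')))) = 0 := by
  have h1 : wM ^ (k + 1) * wP * hq - wP ^ (k + 1) * wM * aq -
      I * (2 * (x * Sz) * (wM ^ (k + 1) * (wP * hp)) +
        2 * (x * Sζ) * (wP ^ (k + 1) * (wM * ap)) +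
        Su * (wM ^ (k + 1) * wP * hq + wP ^ (k + 1) * wM * aq)) = 0 := by
    linear_combination wP * wM * h
  rw [hΦ, hΦ', hP, hM, hΓ, hΓ'] at h1
  linear_combination h1

variable {S : GraphRing}

theorem pderiv_conjSwap (f : GraphRing) (j : Fin 4) :
    pderiv ℂ (Equiv.swap 1 2 j) (conjSwap f) = conjSwap (pderiv ℂ j f) := by
  have hmap : ∀ i, pderiv ℂ i (map (starRingEnd ℂ) f) = map (starRingEnd ℂ) (pderiv ℂ i f) := by
    intro i
    ext d
    rw [coeff_pderiv, coeff_map, coeff_map, coeff_pderiv, map_mul, map_add, map_natCast, map_one]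
  rw [conjSwap_eq_subst, pderiv_subst (fun i => by simp), Finset.sum_eq_single j]
  · rw [Function.comp_apply, pderiv_X_self, mul_one, hmap, conjSwap_eq_subst]
  · intro i _ hi
    rw [Function.comp_apply, pderiv_X_of_ne, mul_zero]
    exact fun h => hi ((Equiv.swap 1 2).injective h)
  · intro h
    exact absurd (Finset.mem_univ j) h

/-- The factor `(1 + i S) (1 - i (S + u S_u)) - 1`. -/
def tangFactor (S : GraphRing) : GraphRing :=
  -(C Complex.I) * (X 3 * pderiv ℂ 3 S) + S * (S + X 3 * pderiv ℂ 3 S)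

/-- The tangency equation, modulo components of bidegree `(k, l)` with `k, l ≥ 4`. -/
theorem cf_tangency (h1 : X 1 ∣ S) (h2 : X 2 ∣ S) (hc : conjSwap S = S) {k : ℕ}
    {p q : MvPowerSeries (Fin 2) ℂ}
    (h : X 0 ∣ (wMinus (X 3 * S) ^ k * holSub (X 3 * S) q -
        wPlus (X 3 * S) ^ k * antiSub (X 3 * S) (map (starRingEnd ℂ) q)) -
      C Complex.I * (2 * pderiv ℂ 1 (X 3 * S) * (wMinus (X 3 * S) ^ k * holSub (X 3 * S) p) +
        2 * pderiv ℂ 2 (X 3 * S) *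
          (wPlus (X 3 * S) ^ k * antiSub (X 3 * S) (map (starRingEnd ℂ) p)) +
        pderiv ℂ 3 (X 3 * S) * (wMinus (X 3 * S) ^ k * holSub (X 3 * S) q +
          wPlus (X 3 * S) ^ k * antiSub (X 3 * S) (map (starRingEnd ℂ) q))))
    {Γ Φ Ξ Υ : GraphRing} (hΓ : Γ = taylor (k + 1) q (C Complex.I * S))
    (hΦ : Φ = taylor (k + 1) (X 1 * p) (C Complex.I * S))
    (hΞ : Ξ = Γ + tangFactor S * Γ) (hΥ : Υ = pderiv ℂ 1 S * Φ) {a b : ℕ} (hab : a < 4 ∨ b < 4) :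
    cf a b Ξ - PowerSeries.map (starRingEnd ℂ) (cf b a Ξ) =
      PowerSeries.C Complex.I * (2 * (cf a b Υ + PowerSeries.map (starRingEnd ℂ) (cf b a Υ))) := by
  have hV0 : constantCoeff (X 3 * S) = 0 := by simp
  set m := Ideal.Quotient.mk negl with hm
  have hcV : conjSwap (X 3 * S) = X 3 * S := by
    rw [map_mul, hc, conjSwap_X]
    rfl
  have hC' : conjSwap (C Complex.I) = -C Complex.I := by
    rw [conjSwap_C, Complex.conj_I, map_neg]
  have hmem : ∀ f, m (holSub (X 3 * S) f) =
      m (1 + C Complex.I * S) ^ (k + 1) * m (taylor (k + 1) f (C Complex.I * S)) := by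
    intro f
    rw [← map_pow, ← map_mul]
    exact Ideal.Quotient.eq.2 (holSub_sub_taylor_mem h1 h2 (k + 1) f)
  have hmem' : ∀ f, m (antiSub (X 3 * S) (map (starRingEnd ℂ) f)) =
      m (1 - C Complex.I * S) ^ (k + 1) * m (conjSwap (taylor (k + 1) f (C Complex.I * S))) := by
    intro f
    rw [← map_pow, ← map_mul]
    refine Ideal.Quotient.eq.2 ?_
    have := conjSwap_mem_negl (holSub_sub_taylor_mem h1 h2 (k + 1) f)
    rw [map_sub, conjSwap_holSub hV0 hcV, map_mul, map_pow, map_add, map_one, map_mul, hC', hc] at this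
    convert this using 4
    ring
  have hX0 : m (X 0) = 0 := Ideal.Quotient.eq_zero_iff_mem.2 (mem_negl_of_X_dvd dvd_rfl)
  have hP : m (wPlus (X 3 * S)) = m (X 3) * m (1 + C Complex.I * S) := by
    rw [wPlus_eq, map_add, map_mul, map_mul m _ (X 0), hX0, mul_zero, add_zero]
  have hM : m (wMinus (X 3 * S)) = m (X 3) * m (1 - C Complex.I * S) := by
    have : wMinus (X 3 * S) = X 3 * (1 - C Complex.I * S) - C Complex.I * X 0 := by
      rw [wMinus]; ring
    rw [this, map_sub, map_mul, map_mul m _ (X 0), hX0, mul_zero, sub_zero]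
  have hX1 : holSub (X 3 * S) (X 1 * p) = wPlus (X 3 * S) * holSub (X 3 * S) p := by
    have := holSub_X_one_pow hV0 1
    rw [pow_one, pow_one] at this
    rw [holSub_mul hV0, this]
  have hX1' : antiSub (X 3 * S) (map (starRingEnd ℂ) (X 1 * p)) =
      wMinus (X 3 * S) * antiSub (X 3 * S) (map (starRingEnd ℂ) p) := by
    have := antiSub_X_one_pow hV0 1
    rw [pow_one, pow_one] at this
    rw [map_mul, map_X, antiSub_mul hV0, this]
  have hVz : pderiv ℂ 1 (X 3 * S) = X 3 * pderiv ℂ 1 S := by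
    rw [Derivation.leibniz, pderiv_X_of_ne (by decide), smul_zero, add_zero, smul_eq_mul]
  have hVζ : pderiv ℂ 2 (X 3 * S) = X 3 * pderiv ℂ 2 S := by
    rw [Derivation.leibniz, pderiv_X_of_ne (by decide), smul_zero, add_zero, smul_eq_mul]
  have hVu : pderiv ℂ 3 (X 3 * S) = S + X 3 * pderiv ℂ 3 S := by
    rw [Derivation.leibniz, pderiv_X_self, smul_eq_mul, smul_eq_mul]
    ring
  have hSζ : pderiv ℂ 2 S = conjSwap (pderiv ℂ 1 S) := by
    rw [← pderiv_conjSwap, hc]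
    rfl
  have hSu : pderiv ℂ 3 S = conjSwap (pderiv ℂ 3 S) := by
    rw [← pderiv_conjSwap, hc]
    rfl
  have h0 : m _ = 0 := Ideal.Quotient.eq_zero_iff_mem.2 (mem_negl_of_X_dvd h)
  rw [hVz, hVζ, hVu] at h0
  have h3 := cancel_powers k (I := m (C Complex.I)) (x := m (X 3)) (Sz := m (pderiv ℂ 1 S))
    (Sζ := m (pderiv ℂ 2 S)) (Su := m (S + X 3 * pderiv ℂ 3 S)) (hp := m (holSub (X 3 * S) p))
    (ap := m (antiSub (X 3 * S) (map (starRingEnd ℂ) p))) hP hM (hmem q) (hmem' q)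
    (by rw [← map_mul, ← hX1]; exact hmem _) (by rw [← map_mul, ← hX1']; exact hmem' _)
    (by rw [← h0]; simp only [map_sub m, map_mul m, map_pow m, map_ofNat m, map_add m _ (_ * _)])
  have hα : IsUnit (((1 + C Complex.I * S) * (1 - C Complex.I * S)) ^ (k + 1)) := by
    have hS0 : constantCoeff S = 0 := by
      obtain ⟨T, rfl⟩ := h1
      simp
    refine IsUnit.pow _ (isUnit_iff_constantCoeff.2 ?_)
    simp [hS0]
  rw [← hΓ, ← hΦ] at h3
  set E : GraphRing := (1 + C Complex.I * S) * (1 - C Complex.I * (S + X 3 * pderiv ℂ 3 S)) * Γ -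
    (1 - C Complex.I * S) * (1 + C Complex.I * (S + X 3 * pderiv ℂ 3 S)) * conjSwap Γ -
    C Complex.I * (2 * (pderiv ℂ 1 S * Φ + pderiv ℂ 2 S * conjSwap Φ)) with hE
  have h4 : E ∈ negl := by
    rw [← Ideal.unit_mul_mem_iff_mem _ hα]
    refine mem_negl_of_X_three_pow_mul (a := k + 2) (Ideal.Quotient.eq_zero_iff_mem.1 ?_)
    rw [← h3]
    simp only [hE, map_sub m, map_mul m, map_add m, map_one m]
    rfl
  have hE' : E = (Ξ - conjSwap Ξ) - C Complex.I * (C 2 * (Υ + conjSwap Υ)) := by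
    have h2 : (C 2 : GraphRing) = 2 := map_ofNat C 2
    have hc3 : conjSwap (X 3) = X 3 := by
      rw [conjSwap_X]
      rfl
    rw [hE, hΞ, hΥ, tangFactor, h2]
    simp only [map_add conjSwap, map_mul conjSwap, map_neg conjSwap, hC', hc, hc3, ← hSu, ← hSζ]
    linear_combination (-S * (S + X 3 * pderiv ℂ 3 S) * Γ +
      S * (S + X 3 * pderiv ℂ 3 S) * conjSwap Γ) * C_I_mul_C_I
  have h5 := h4 a b hab
  rw [hE', cf_sub, cf_sub, cf_conjSwap, cf_C_mul, cf_C_mul, cf_add, cf_conjSwap, map_ofNat] at h5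
  exact sub_eq_zero.1 h5

end TangencyComponents

/-! ### The first component equations -/

section Rows

/-- Complex conjugation of the coefficients of a power series in `u`. -/
abbrev conjU : PowerSeries ℂ →+* PowerSeries ℂ := PowerSeries.map (starRingEnd ℂ)

theorem conjU_conjU (f : PowerSeries ℂ) : conjU (conjU f) = f := by
  ext n
  simp

theorem conjU_eul (N : ℕ) (f : PowerSeries ℂ) : conjU (eul N f) = eul N (conjU f) := by
  ext n
  simp

theorem conjU_C_I : conjU (PowerSeries.C Complex.I) = -PowerSeries.C Complex.I := by
  rw [PowerSeries.map_C, Complex.conj_I, map_neg]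

theorem eul_add (N : ℕ) (f g : PowerSeries ℂ) : eul N (f + g) = eul N f + eul N g := by
  ext n
  simp [mul_add]

theorem eul_sub (N : ℕ) (f g : PowerSeries ℂ) : eul N (f - g) = eul N f - eul N g := by
  ext n
  simp [mul_sub]

theorem eul_C_mul (N : ℕ) (c : ℂ) (f : PowerSeries ℂ) :
    eul N (PowerSeries.C c * f) = PowerSeries.C c * eul N f := by
  ext n
  simp
  ring

/-- The twisted Leibniz rule for Euler derivations. -/
theorem eul_mul (N : ℕ) (f g : PowerSeries ℂ) :
    eul N (f * g) = eul 0 f * g + f * eul N g := by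
  ext n
  rw [coeff_eul, map_add, PowerSeries.coeff_mul, PowerSeries.coeff_mul, PowerSeries.coeff_mul,
    Finset.mul_sum, ← Finset.sum_add_distrib]
  refine Finset.sum_congr rfl fun x hx => ?_
  rw [Finset.HasAntidiagonal.mem_antidiagonal] at hx
  rw [coeff_eul, coeff_eul, ← hx]
  push_cast
  ring

theorem eul_X_pow (n : ℕ) : eul 0 (PowerSeries.X ^ n) = (n : PowerSeries ℂ) * PowerSeries.X ^ n := by
  ext i
  have h1 : (n : PowerSeries ℂ) = PowerSeries.C (n : ℂ) := by simp
  rw [coeff_eul, h1, PowerSeries.coeff_C_mul, PowerSeries.coeff_X_pow]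
  split_ifs with h
  · simp [h]
  · simp

/-- The equations between the components of bidegree `(k, l)`, `k < 4` or `l < 4`, which express
tangency of the vector field `w⁻ᴺ (π ∂_z + w γ ∂_w)` to the hypersurface `v = u S`. -/
structure IsTangent (N : ℕ) (S : GraphRing) (γ π : MvPowerSeries (Fin 2) ℂ) : Prop where
  normal : IsNormal S
  symm : ∀ k l, conjU (cf k l S) = cf l k S
  eqn : ∀ k l, k < 4 ∨ l < 4 →
    cf k l (taylor N γ (C Complex.I * S) + tangFactor S * taylor N γ (C Complex.I * S)) -
      conjU (cf l k (taylor N γ (C Complex.I * S) +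
        tangFactor S * taylor N γ (C Complex.I * S))) =
    PowerSeries.C Complex.I * (2 * (cf k l (pderiv ℂ 1 S * taylor N π (C Complex.I * S)) +
      conjU (cf l k (pderiv ℂ 1 S * taylor N π (C Complex.I * S)))))

variable {N : ℕ} {S : GraphRing} {γ π : MvPowerSeries (Fin 2) ℂ}

theorem IsNormal.tangFactor (hS : IsNormal S) : IsNormal (tangFactor S) := by
  have h := (hS.euler.C_mul (-Complex.I)).add (hS.mul (hS.add hS.euler))
  rwa [map_neg] at h

theorem cf_tangFactor (k l : ℕ) : cf k l (tangFactor S) =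
    -PowerSeries.C Complex.I * eul 0 (cf k l S) + cf k l (S * (S + X 3 * pderiv ℂ 3 S)) := by
  rw [FuchsianCR.tangFactor, cf_add, ← map_neg, cf_C_mul, cf_eul, map_neg]

theorem cf_tangFactor_one_one (hS : IsNormal S) : cf 1 1 (tangFactor S) =
    -PowerSeries.C Complex.I * eul 0 (cf 1 1 S) := by
  have h11 := fun T => hS.cf_mul_one_right 0 T
  simp only [zero_add] at h11
  rw [cf_tangFactor, h11, (hS.add hS.euler).cf_zero_left, mul_zero, add_zero]

theorem cf_tangFactor_two_two (hS : IsNormal S) : cf 2 2 (tangFactor S) =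
    -PowerSeries.C Complex.I * eul 0 (cf 2 2 S) +
      cf 1 1 S * (cf 1 1 S + eul 0 (cf 1 1 S)) := by
  rw [cf_tangFactor, hS.cf_mul_two_two, (hS.add hS.euler).cf_zero_left, cf_add, cf_eul,
    mul_zero, add_zero]

theorem cf_tangFactor_three_two (hS : IsNormal S) : cf 3 2 (tangFactor S) =
    -PowerSeries.C Complex.I * eul 0 (cf 3 2 S) := by
  have h := hS.add hS.euler
  rw [cf_tangFactor, hS.cf_mul_three_two, h.cf_zero_left, h.cf_zero_right,
    h 2 1 (by omega) (by omega)]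
  simp

theorem cf_tangFactor_two_three (hS : IsNormal S) : cf 2 3 (tangFactor S) =
    -PowerSeries.C Complex.I * eul 0 (cf 2 3 S) := by
  have h := hS.add hS.euler
  rw [cf_tangFactor, hS.cf_mul_two_three, h.cf_zero_left, h.cf_zero_left,
    h 1 2 (by omega) (by omega)]
  simp

theorem cf_tangFactor_three_three (hS : IsNormal S) : cf 3 3 (tangFactor S) =
    -PowerSeries.C Complex.I * eul 0 (cf 3 3 S) + cf 1 1 S * (cf 2 2 S + eul 0 (cf 2 2 S)) +
      cf 2 2 S * (cf 1 1 S + eul 0 (cf 1 1 S)) := by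
  have h := hS.add hS.euler
  rw [cf_tangFactor, hS.cf_mul_three_three, h.cf_zero_left, h.cf_zero_left, h.cf_zero_right]
  simp only [cf_add, cf_eul]
  ring

theorem C_I_sq : (PowerSeries.C Complex.I : PowerSeries ℂ) * PowerSeries.C Complex.I = -1 := by
  rw [← map_mul, Complex.I_mul_I, map_neg, map_one]

theorem two_ne_zero_powerSeries : (2 : PowerSeries ℂ) ≠ 0 := by
  rw [← map_ofNat (PowerSeries.C (R := ℂ)) 2]
  exact fun h => two_ne_zero (PowerSeries.C_injective (h.trans (map_zero _).symm))

theorem three_ne_zero_powerSeries : (3 : PowerSeries ℂ) ≠ 0 := by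
  rw [← map_ofNat (PowerSeries.C (R := ℂ)) 3]
  exact fun h => three_ne_zero (PowerSeries.C_injective (h.trans (map_zero _).symm))

/-- The equation in bidegree `(0, 0)`. -/
theorem IsTangent.row_zero_real (h : IsTangent N S γ π) : conjU (row 0 γ) = row 0 γ := by
  have hS := h.normal
  have e := h.eqn 0 0 (by omega)
  simp only [cf_add, hS.tangFactor.cf_mul_zero_right, cf_taylor_zero_right hS,
    hS.cf_pderiv_mul_zero_right, map_zero, add_zero, mul_zero] at e
  exact (sub_eq_zero.1 e).symm

/-- The equation in bidegree `(1, 0)`. -/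
theorem IsTangent.row_one (h : IsTangent N S γ π) :
    row 1 γ = 2 * PowerSeries.C Complex.I * cf 1 1 S * conjU (row 0 π) := by
  have hS := h.normal
  have e := h.eqn 1 0 (by omega)
  have h1 := cf_taylor_zero_left hS N 0 γ
  have h2 := hS.cf_pderiv_mul_zero_left 0 (taylor N π (C Complex.I * S))
  rw [zero_add] at h1 h2
  simp only [cf_add, hS.tangFactor.cf_mul_zero_right, cf_taylor_zero_right hS, h1, h2,
    hS.tangFactor.cf_mul_zero_left, hS.cf_pderiv_mul_zero_right, map_zero, add_zero, zero_add,
    sub_zero, map_mul, h.symm] at e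
  rw [e]
  ring

theorem IsTangent.eul_row_one (h : IsTangent N S γ π) :
    eul N (row 1 γ) = 2 * PowerSeries.C Complex.I *
      (eul 0 (cf 1 1 S) * conjU (row 0 π) + cf 1 1 S * eul N (conjU (row 0 π))) := by
  have h2 : 2 * (PowerSeries.C Complex.I : PowerSeries ℂ) = PowerSeries.C (2 * Complex.I) := by
    rw [map_mul, map_ofNat]
  rw [h.row_one, h2, mul_assoc, eul_C_mul, eul_mul]

/-- The equations in bidegree `(k, 0)` for `k ≥ 2`. -/
theorem IsTangent.row_add_two (h : IsTangent N S γ π) (k : ℕ) : row (k + 2) γ = 0 := by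
  have hS := h.normal
  have e := h.eqn (k + 2) 0 (by omega)
  have h2 := hS.cf_pderiv_mul_zero_left (k + 1) (taylor N π (C Complex.I * S))
  rw [cf_taylor_zero_left hS] at h2
  simp only [cf_add, hS.tangFactor.cf_mul_zero_right, cf_taylor_zero_right hS,
    cf_taylor_zero_left hS N (k + 1), h2,
    hS.tangFactor.cf_mul_zero_left, hS.cf_pderiv_mul_zero_right, map_zero, add_zero,
    sub_zero, mul_zero] at e
  exact e

/-- The equation in bidegree `(1, 1)`. -/
theorem IsTangent.eq_one_one (h : IsTangent N S γ π) :
    cf 1 1 S * (row 1 π + conjU (row 1 π)) =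
      cf 1 1 S * eul N (row 0 γ) - eul 0 (cf 1 1 S) * row 0 γ := by
  have hS := h.normal
  have e := h.eqn 1 1 (by omega)
  have h1 := cf_taylor_one_right hS N 0 γ
  have h2 := hS.tangFactor.cf_mul_one_right 0 (taylor N γ (C Complex.I * S))
  rw [zero_add] at h1 h2
  simp only [cf_add, h1, h2, hS.cf_pderiv_mul_one_right, cf_taylor_zero_right hS, map_add, map_mul,
    cf_tangFactor_one_one hS, h.symm, map_neg, conjU_C_I, conjU_eul, h.row_zero_real,
    row_binomOp_one] at e
  refine mul_left_cancel₀ two_ne_zero_powerSeries ?_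
  linear_combination (PowerSeries.C Complex.I) * e + (2 * cf 1 1 S * (row 1 π + conjU (row 1 π)) -
      2 * (cf 1 1 S * eul N (row 0 γ) - eul 0 (cf 1 1 S) * row 0 γ)) * C_I_sq

/-- The equation in bidegree `(2, 1)`. -/
theorem IsTangent.eq_two_one (h : IsTangent N S γ π) :
    cf 1 1 S * row 2 π = 2 * PowerSeries.C Complex.I * cf 1 1 S ^ 2 * eul N (conjU (row 0 π)) -
      2 * cf 2 2 S * conjU (row 0 π) := by
  have hS := h.normal
  have e := h.eqn 2 1 (by omega)
  have h1 := cf_taylor_one_right hS N 0 π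
  have h2 := cf_taylor_one_right hS N 1 γ
  have h3 := hS.tangFactor.cf_mul_one_right 1 (taylor N γ (C Complex.I * S))
  have h4 := hS.tangFactor.cf_mul_one_left 1 (taylor N γ (C Complex.I * S))
  have h5 := cf_taylor_zero_left hS N 0 γ
  have h6 := hS.cf_pderiv_mul_one_left 0 (fun l => cf_taylor_zero_left hS N l π)
  have h7 := cf_taylor_one_left hS N 0 γ
  simp only [zero_add, Nat.reduceAdd] at h1 h2 h3 h4 h5 h6 h7
  rw [h1] at h6
  rw [h5] at h4
  simp only [cf_add, h2, h3, h4, h6, h7, hS.cf_pderiv_mul_one_right, cf_taylor_zero_right hS,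
    map_add, map_mul, map_zero, map_ofNat,
    cf_tangFactor_one_one hS, h.symm, conjU_C_I, conjU_eul,
    row_binomOp_one, h.eul_row_one] at e
  rw [h.row_one] at e
  refine mul_left_cancel₀ two_ne_zero_powerSeries ?_
  have hI := C_I_sq
  grind

/-- The equations in bidegree `(k, 1)` for `k ≥ 3`. -/
theorem IsTangent.eq_add_three_one (h : IsTangent N S γ π) (k : ℕ) :
    cf 1 1 S * row (k + 3) π = -(2 * cf (k + 3) 2 S * conjU (row 0 π)) := by
  have hS := h.normal
  have e := h.eqn (k + 3) 1 (by omega)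
  have h2 := cf_taylor_one_right hS N (k + 2) γ
  have h3 := hS.tangFactor.cf_mul_one_right (k + 2) (taylor N γ (C Complex.I * S))
  have h4 := hS.tangFactor.cf_mul_one_left (k + 2) (taylor N γ (C Complex.I * S))
  have h6 := hS.cf_pderiv_mul_one_left (k + 1) (fun l => cf_taylor_zero_left hS N l π)
  rw [cf_taylor_one_left hS] at h6
  rw [cf_taylor_zero_left hS] at h4
  simp only [cf_add, h2, h3, h4, h6, cf_taylor_one_left hS N (k + 1), hS.cf_pderiv_mul_one_right,
    cf_taylor_zero_right hS,
    map_add, map_mul, map_zero, map_ofNat, h.symm, row_binomOp_one, h.row_add_two, eul_zero] at e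
  refine mul_left_cancel₀ two_ne_zero_powerSeries ?_
  linear_combination (PowerSeries.C Complex.I) * e + (2 * cf 1 1 S * row (k + 3) π +
    4 * cf (k + 3) 2 S * conjU (row 0 π)) * C_I_sq

/-- The equation in bidegree `(2, 2)`. -/
theorem IsTangent.eq_two_two (h : IsTangent N S γ π) :
    cf 2 2 S * eul N (row 0 γ) - eul 0 (cf 2 2 S) * row 0 γ =
      PowerSeries.C Complex.I * cf 1 1 S ^ 2 * (eul N (row 1 π) - eul N (conjU (row 1 π))) +
      2 * cf 2 2 S * (row 1 π + conjU (row 1 π)) + 3 * cf 3 2 S * row 0 π +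
      3 * cf 2 3 S * conjU (row 0 π) := by
  have hS := h.normal
  have e := h.eqn 2 2 (by omega)
  have h1 := cf_taylor_one_right hS N 0 γ
  have h2 := cf_taylor_one_right hS N 1 π
  simp only [zero_add, Nat.reduceAdd] at h1 h2
  have hΔ : conjU (row 0 (binomOp N 2 γ)) = row 0 (binomOp N 2 γ) := by
    refine mul_left_cancel₀ two_ne_zero_powerSeries ?_
    have := congrArg conjU (two_mul_row_binomOp_two N γ 0)
    simp only [map_mul, map_ofNat, map_sub, conjU_eul, h.row_zero_real] at this
    rw [this, two_mul_row_binomOp_two]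
  simp only [cf_add, hS.tangFactor.cf_mul_two_two, hS.cf_pderiv_mul_two_two, h1, h2,
    cf_taylor_two_two hS, cf_taylor_zero_right hS, cf_tangFactor_one_one hS,
    cf_tangFactor_two_two hS,
    map_add, map_sub, map_mul, map_neg, map_ofNat, h.symm, conjU_C_I, conjU_eul, hΔ,
    row_binomOp_one, h.row_zero_real] at e
  refine mul_left_cancel₀ two_ne_zero_powerSeries ?_
  have hI := C_I_sq
  grind

/-- The equation in bidegree `(3, 2)`. -/
theorem IsTangent.eq_three_two (h : IsTangent N S γ π) :
    2 * PowerSeries.C Complex.I * cf 3 2 S * eul N (row 0 γ) -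
      2 * PowerSeries.C Complex.I * eul 0 (cf 3 2 S) * row 0 γ +
      PowerSeries.C Complex.I * cf 2 2 S * eul N (row 1 γ) -
      PowerSeries.C Complex.I * eul 0 (cf 2 2 S) * row 1 γ +
      cf 1 1 S * (eul 0 (cf 1 1 S) * (eul N (row 1 γ) + row 1 γ) + cf 1 1 S * row 1 γ) -
      cf 1 1 S ^ 2 * row 1 (binomOp N 2 γ) =
    2 * PowerSeries.C Complex.I * (PowerSeries.C Complex.I * cf 1 1 S ^ 2 * eul N (row 2 π) +
      2 * cf 2 2 S * row 2 π + 3 * cf 3 2 S * row 1 π + 4 * cf 4 2 S * row 0 π -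
      3 * PowerSeries.C Complex.I * cf 1 1 S * cf 2 2 S * eul N (conjU (row 0 π)) -
      cf 1 1 S ^ 3 * conjU (row 0 (binomOp N 2 π)) + 2 * cf 3 2 S * conjU (row 1 π) +
      3 * cf 3 3 S * conjU (row 0 π)) := by
  have hS := h.normal
  have e := h.eqn 3 2 (by omega)
  have h1 := cf_taylor_one_right hS N 0 π
  have h2 := cf_taylor_one_right hS N 1 γ
  have h3 := cf_taylor_one_right hS N 2 π
  have h4 := cf_taylor_zero_left hS N 0 γ
  have h5 := cf_taylor_zero_left hS N 0 π
  have h6 := cf_taylor_one_left hS N 0 γ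
  simp only [zero_add, Nat.reduceAdd] at h1 h2 h3 h4 h5 h6
  simp only [cf_add, hS.tangFactor.cf_mul_three_two, hS.tangFactor.cf_mul_two_three,
    hS.cf_pderiv_mul_three_two, hS.cf_pderiv_mul_two_three, h1, h2, h3, h4, h5, h6,
    cf_taylor_three_two hS, cf_taylor_two_three hS, cf_taylor_two_two hS, cf_taylor_zero_right hS,
    cf_tangFactor_one_one hS, cf_tangFactor_two_two hS, cf_tangFactor_three_two hS,
    cf_tangFactor_two_three hS,
    map_add, map_sub, map_mul, map_neg, map_zero, map_ofNat, h.symm, conjU_C_I, conjU_eul,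
    row_binomOp_one, h.row_zero_real] at e
  have hI := C_I_sq
  generalize (PowerSeries.C Complex.I : PowerSeries ℂ) = I at *
  generalize row 1 (binomOp N 2 γ) = x1 at *
  generalize conjU (row 0 (binomOp N 2 π)) = x2 at *
  linear_combination e + (cf 1 1 S * eul 0 (cf 1 1 S) * eul N (row 1 γ)) * hI

/-- The equation in bidegree `(3, 3)`. -/
theorem IsTangent.eq_three_three (h : IsTangent N S γ π) :
    2 * (cf 3 3 S * eul N (row 0 γ) - eul 0 (cf 3 3 S) * row 0 γ) +
      2 * cf 1 1 S ^ 2 * (cf 1 1 S + eul 0 (cf 1 1 S)) * eul N (row 0 γ) +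
      2 * cf 1 1 S ^ 2 * eul 0 (cf 1 1 S) * row 0 (binomOp N 2 γ) -
      2 * cf 1 1 S ^ 3 * row 0 (binomOp N 3 γ) +
      cf 2 3 S * eul N (row 1 γ) - eul 0 (cf 2 3 S) * row 1 γ +
      cf 3 2 S * eul N (conjU (row 1 γ)) - eul 0 (cf 3 2 S) * conjU (row 1 γ) =
    2 * (3 * PowerSeries.C Complex.I * cf 1 1 S * cf 2 2 S *
        (eul N (row 1 π) - eul N (conjU (row 1 π))) +
      4 * PowerSeries.C Complex.I * cf 1 1 S *
        (cf 3 2 S * eul N (row 0 π) - cf 2 3 S * eul N (conjU (row 0 π))) -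
      cf 1 1 S ^ 3 * (row 1 (binomOp N 2 π) + conjU (row 1 (binomOp N 2 π))) +
      2 * (cf 2 3 S * row 2 π + cf 3 2 S * conjU (row 2 π)) +
      3 * cf 3 3 S * (row 1 π + conjU (row 1 π)) +
      4 * (cf 4 3 S * row 0 π + cf 3 4 S * conjU (row 0 π))) := by
  have hS := h.normal
  have e := h.eqn 3 3 (by omega)
  have h1 := cf_taylor_one_right hS N 0 π
  have h2 := cf_taylor_one_right hS N 1 π
  have h3 := cf_taylor_one_right hS N 0 γ
  have h4 := cf_taylor_zero_left hS N 0 γ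
  have h5 := cf_taylor_zero_left hS N 0 π
  simp only [zero_add, Nat.reduceAdd] at h1 h2 h3 h4 h5
  have hΔ : conjU (row 0 (binomOp N 2 γ)) = row 0 (binomOp N 2 γ) := by
    refine mul_left_cancel₀ two_ne_zero_powerSeries ?_
    have := congrArg conjU (two_mul_row_binomOp_two N γ 0)
    simp only [map_mul, map_ofNat, map_sub, conjU_eul, h.row_zero_real] at this
    rw [this, two_mul_row_binomOp_two]
  have hΔ3 : conjU (row 0 (binomOp N 3 γ)) = row 0 (binomOp N 3 γ) := by
    refine mul_left_cancel₀ (mul_ne_zero two_ne_zero_powerSeries three_ne_zero_powerSeries) ?_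
    have h23 : (2 * 3 : PowerSeries ℂ) = 6 := by norm_num
    have := congrArg conjU (six_mul_row_binomOp_three N γ 0)
    simp only [map_mul, map_ofNat, map_sub, map_add, conjU_eul, h.row_zero_real] at this
    rw [h23, this, six_mul_row_binomOp_three]
  simp only [cf_add, hS.tangFactor.cf_mul_three_three,
    hS.cf_pderiv_mul_three_three, h1, h2, h3, h4, h5,
    cf_taylor_three_three hS, cf_taylor_three_two hS, cf_taylor_two_two hS, cf_taylor_zero_right hS,
    cf_tangFactor_one_one hS, cf_tangFactor_two_two hS, cf_tangFactor_three_two hS,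
    cf_tangFactor_two_three hS, cf_tangFactor_three_three hS,
    map_add, map_sub, map_mul, map_neg, map_zero, map_pow, map_ofNat, h.symm, conjU_C_I, conjU_eul,
    row_binomOp_one, h.row_zero_real, hΔ, hΔ3] at e
  have hI := C_I_sq
  generalize (PowerSeries.C Complex.I : PowerSeries ℂ) = I at *
  have hI0 : I ≠ 0 := by
    rintro rfl
    simp at hI
  refine mul_left_cancel₀ hI0 ?_
  generalize row 0 (binomOp N 3 γ) = x1 at *
  generalize row 0 (binomOp N 2 γ) = x2 at *
  generalize conjU (row 1 (binomOp N 2 π)) = x3 at *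
  generalize row 1 (binomOp N 2 π) = x4 at *
  linear_combination e

end Rows

/-! ### Reduction to a Fuchsian system -/

section ConvSpan

variable {ι : Type*} [Fintype ι]

/-- The combinations of the series `y i` with convergent coefficients. -/
def convSpan (y : ι → PowerSeries ℂ) : AddSubgroup (PowerSeries ℂ) where
  carrier := {x | ∃ c : ι → PowerSeries ℂ, (∀ j, Conv (c j)) ∧ x = ∑ j, c j * y j}
  add_mem' := by
    rintro _ _ ⟨c, hc, rfl⟩ ⟨d, hd, rfl⟩
    exact ⟨c + d, fun j => (hc j).add (hd j), by
      simp only [Pi.add_apply, add_mul, Finset.sum_add_distrib]⟩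
  zero_mem' := ⟨0, fun _ => by simpa using conv_C (σ := Unit) 0, by simp⟩
  neg_mem' := by
    rintro _ ⟨c, hc, rfl⟩
    exact ⟨-c, fun j => (hc j).neg, by simp⟩

variable {y : ι → PowerSeries ℂ}

theorem mul_mem_convSpan {r x : PowerSeries ℂ} (hr : Conv r) (hx : x ∈ convSpan y) :
    r * x ∈ convSpan y := by
  obtain ⟨c, hc, rfl⟩ := hx
  exact ⟨fun j => r * c j, fun j => hr.mul (hc j), by simp only [Finset.mul_sum, mul_assoc]⟩

theorem self_mem_convSpan (i : ι) : y i ∈ convSpan y := by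
  classical
  refine ⟨Pi.single i 1, fun j => ?_, ?_⟩
  · by_cases h : j = i
    · subst h
      rw [Pi.single_eq_same]
      exact (convSubring (σ := Unit)).one_mem
    · rw [Pi.single_eq_of_ne h]
      exact (convSubring (σ := Unit)).zero_mem
  · rw [Finset.sum_eq_single i]
    · simp
    · intro j _ hj
      rw [Pi.single_eq_of_ne hj, zero_mul]
    · simp

theorem conv_C_unit (c : ℂ) : Conv (PowerSeries.C c : PowerSeries ℂ) := conv_C c

theorem conv_natCast (n : ℕ) : Conv (n : PowerSeries ℂ) := by
  rw [← map_natCast (PowerSeries.C (R := ℂ))]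
  exact conv_C_unit _

theorem conv_ofNat (n : ℕ) [n.AtLeastTwo] : Conv (OfNat.ofNat n : PowerSeries ℂ) := by
  rw [← Nat.cast_ofNat]
  exact conv_natCast n

theorem Conv.conjU {f : PowerSeries ℂ} (hf : Conv f) : Conv (conjU f) := hf.map_conj

theorem conjU_mem_convSpan (hy : ∀ i, conjU (y i) ∈ convSpan y) {x : PowerSeries ℂ}
    (hx : x ∈ convSpan y) : conjU x ∈ convSpan y := by
  obtain ⟨c, hc, rfl⟩ := hx
  rw [map_sum]
  refine sum_mem fun j _ => ?_
  rw [map_mul]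
  exact mul_mem_convSpan (hc j).conjU (hy j)

/-- A finite family of formal power series whose convergent span is stable under the Euler
derivation solves a linear system with a Fuchsian singularity, and hence converges. -/
theorem conv_of_eul_mem (N : ℕ) (hy : ∀ i, eul N (y i) ∈ convSpan y) (i : ι) : Conv (y i) := by
  have h : ∀ i, eul 0 (y i) ∈ convSpan y := by
    intro i
    have : eul 0 (y i) = eul N (y i) + (N : PowerSeries ℂ) * y i := by
      ext n
      rw [← map_natCast (PowerSeries.C (R := ℂ)), map_add, PowerSeries.coeff_C_mul, coeff_eul,
        coeff_eul]
      push_cast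
      ring
    rw [this]
    exact add_mem (hy i) (mul_mem_convSpan (conv_natCast N) (self_mem_convSpan i))
  choose A hA hAy using h
  refine conv_of_fuchs_system hA (fun i n => ?_) i
  rw [← hAy i, coeff_eul]
  simp

theorem Conv.euler {f : PowerSeries ℂ} (hf : Conv f) (N : ℕ) : Conv (eul N f) := by
  have h : eul N f = PowerSeries.X * MvPowerSeries.pderiv ℂ () f - (N : PowerSeries ℂ) * f := by
    ext n
    rw [← map_natCast (PowerSeries.C (R := ℂ)), map_sub, PowerSeries.coeff_C_mul, coeff_eul]
    have h2 : ∀ n, PowerSeries.coeff n (MvPowerSeries.pderiv ℂ () f : PowerSeries ℂ) =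
        PowerSeries.coeff (n + 1) f * (n + 1) := by
      intro n
      rw [PowerSeries.coeff, MvPowerSeries.coeff_pderiv, PowerSeries.coeff, Finsupp.single_add]
      simp
    rcases n with _ | n
    · simp
    · rw [PowerSeries.coeff_succ_X_mul, h2]
      push_cast
      ring
  rw [h]
  exact ((conv_X ()).mul (Conv.pderiv hf ())).sub ((conv_natCast N).mul hf)

end ConvSpan

section FuchsianSystem

theorem eul_X_pow_pow_mul (μ k : ℕ) (t : PowerSeries ℂ) :
    eul 0 ((PowerSeries.X ^ μ) ^ k * t) =
      (PowerSeries.X ^ μ) ^ k * ((k : PowerSeries ℂ) * (μ : PowerSeries ℂ) * t + eul 0 t) := by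
  rw [← pow_mul, eul_mul, eul_X_pow]
  push_cast
  ring

variable {N μ : ℕ} {S : GraphRing} {γ π : MvPowerSeries (Fin 2) ℂ}
  {E t22 t23 t32 t33 t24 t42 t34 t43 : PowerSeries ℂ}

/-- The equation in bidegree `(2, 1)`, divided by `u ^ μ`. -/
theorem IsTangent.row_two (h : IsTangent N S γ π) (hE : E ^ 2 = 1)
    (h11 : cf 1 1 S = E * PowerSeries.X ^ μ) (h22 : cf 2 2 S = (PowerSeries.X ^ μ) ^ 2 * t22) :
    row 2 π = PowerSeries.X ^ μ * (2 * PowerSeries.C Complex.I * E * eul N (conjU (row 0 π)) -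
      2 * E * t22 * conjU (row 0 π)) := by
  have hU : (PowerSeries.X ^ μ : PowerSeries ℂ) ≠ 0 := pow_ne_zero _ PowerSeries.X_ne_zero
  have e := h.eq_two_one
  rw [h11, h22] at e
  refine mul_left_cancel₀ hU ?_
  generalize (PowerSeries.X ^ μ : PowerSeries ℂ) = U at *
  linear_combination E * e + (-U * row 2 π +
    2 * PowerSeries.C Complex.I * E * U ^ 2 * eul N (conjU (row 0 π))) * hE

/-- The equation in bidegree `(1, 1)`, divided by `u ^ μ`. -/
theorem IsTangent.add_conj (h : IsTangent N S γ π) (hE : E ^ 2 = 1) (hθE : eul 0 E = 0)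
    (h11 : cf 1 1 S = E * PowerSeries.X ^ μ) :
    row 1 π + conjU (row 1 π) = eul N (row 0 γ) - (μ : PowerSeries ℂ) * row 0 γ := by
  have hU : (PowerSeries.X ^ μ : PowerSeries ℂ) ≠ 0 := pow_ne_zero _ PowerSeries.X_ne_zero
  have hE0 : E ≠ 0 := by
    rintro rfl
    simp at hE
  have e := h.eq_one_one
  rw [h11, eul_mul, hθE, zero_mul, zero_add, eul_X_pow] at e
  refine mul_left_cancel₀ (mul_ne_zero hE0 hU) ?_
  linear_combination e

/-- The equation in bidegree `(2, 2)`, divided by `u ^ (2 * μ)`. Together with the derivative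
of `IsTangent.add_conj` it determines the first derivative of `row 1 π`. -/
theorem IsTangent.eul_sub_conj (h : IsTangent N S γ π) (hE : E ^ 2 = 1)
    (h11 : cf 1 1 S = E * PowerSeries.X ^ μ) (h22 : cf 2 2 S = (PowerSeries.X ^ μ) ^ 2 * t22)
    (h23 : cf 2 3 S = (PowerSeries.X ^ μ) ^ 3 * t23)
    (h32 : cf 3 2 S = (PowerSeries.X ^ μ) ^ 3 * t32) {M : PowerSeries ℂ} (hM : M = (μ : PowerSeries ℂ)) :
    eul N (row 1 π) - eul N (conjU (row 1 π)) = PowerSeries.C Complex.I *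
      ((2 * M * t22 + eul 0 t22) * row 0 γ - t22 * eul N (row 0 γ) +
        2 * t22 * (row 1 π + conjU (row 1 π)) +
        PowerSeries.X ^ μ * (3 * t32 * row 0 π + 3 * t23 * conjU (row 0 π))) := by
  have hU : (PowerSeries.X ^ μ : PowerSeries ℂ) ≠ 0 := pow_ne_zero _ PowerSeries.X_ne_zero
  have e := h.eq_two_two
  have hI := C_I_sq
  rw [h11, h22, h23, h32, eul_X_pow_pow_mul] at e
  refine mul_left_cancel₀ (pow_ne_zero 2 hU) ?_
  push_cast at e
  rw [← hM] at e
  generalize (PowerSeries.X ^ μ : PowerSeries ℂ) = U at *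
  generalize (PowerSeries.C Complex.I : PowerSeries ℂ) = I at *
  generalize eul N (row 1 π) = b1 at *
  generalize eul N (conjU (row 1 π)) = bb1 at *
  linear_combination I * e + (b1 - bb1) * U ^ 2 * (I ^ 2 * hE + hI)

/-- The equation in bidegree `(3, 2)`, divided by `u ^ (3 * μ)`: a second order equation for the
conjugate of `row 0 π`, with convergent coefficients. -/
theorem IsTangent.eul_eul_conj (h : IsTangent N S γ π) (hE : E ^ 2 = 1) (hθE : eul 0 E = 0)
    (hDE : ∀ f, eul N (E * f) = E * eul N f)
    (h11 : cf 1 1 S = E * PowerSeries.X ^ μ) (h22 : cf 2 2 S = (PowerSeries.X ^ μ) ^ 2 * t22)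
    (h32 : cf 3 2 S = (PowerSeries.X ^ μ) ^ 3 * t32)
    (h33 : cf 3 3 S = (PowerSeries.X ^ μ) ^ 3 * t33)
    (h42 : cf 4 2 S = (PowerSeries.X ^ μ) ^ 4 * t42)
    {M I A B B1 g g1 b bb : PowerSeries ℂ} (hM : M = (μ : PowerSeries ℂ)) (hI : I = PowerSeries.C Complex.I)
    (hA : A = row 0 π) (hB : B = conjU (row 0 π)) (hB1 : B1 = eul N B)
    (hg : g = row 0 γ) (hg1 : g1 = eul N g) (hb : b = row 1 π) (hbb : bb = conjU (row 1 π)) :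
    8 * I ^ 3 * E ^ 3 * eul N B1 =
      2 * (2 * I * t32 * g1 - 2 * I * (3 * M * t32 + eul 0 t32) * g +
        I * t22 * (2 * I * E * (M * B + B1)) - I * (2 * M * t22 + eul 0 t22) * (2 * I * E * B) +
        E * (M * E * (2 * I * E * (M * B + B1) + 2 * I * E * B) + E * (2 * I * E * B))) -
      E ^ 2 * (2 * I * E * (M ^ 2 * B + 2 * M * B1 - M * B - B1)) -
      4 * I * (I * E ^ 2 * (2 * I * E * M * B1 -
        2 * E * (M * t22 * B + eul 0 t22 * B + t22 * B1)) +
        2 * t22 * (2 * I * E * B1 - 2 * E * t22 * B) + 3 * t32 * b +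
        4 * PowerSeries.X ^ μ * t42 * A - 3 * I * E * t22 * B1 + 2 * t32 * bb + 3 * t33 * B) -
      2 * I * E ^ 3 * B1 := by
  have hU : (PowerSeries.X ^ μ : PowerSeries ℂ) ≠ 0 := pow_ne_zero _ PowerSeries.X_ne_zero
  have e := h.eq_three_two
  have hθ11 : eul 0 (cf 1 1 S) = M * E * PowerSeries.X ^ μ := by
    rw [h11, eul_mul, hθE, zero_mul, zero_add, eul_X_pow, ← hM]
    ring
  have h2I : ∀ f : PowerSeries ℂ, eul N (2 * I * f) = 2 * I * eul N f := by
    intro f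
    have h2 : 2 * (PowerSeries.C Complex.I : PowerSeries ℂ) = PowerSeries.C (2 * Complex.I) := by
      rw [map_mul, map_ofNat]
    rw [hI, h2, eul_C_mul]
  have hc := h.row_two hE h11 h22
  rw [← hI, ← hB, ← hB1] at hc
  have h2 : ∀ f : PowerSeries ℂ, eul N (2 * f) = 2 * eul N f := by
    intro f
    rw [← map_ofNat (PowerSeries.C (R := ℂ)) 2, eul_C_mul]
  have hDU : ∀ f : PowerSeries ℂ, eul N (PowerSeries.X ^ μ * f) =
      PowerSeries.X ^ μ * (M * f + eul N f) := by
    intro f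
    rw [eul_mul, eul_X_pow, ← hM]
    ring
  have hDc : eul N (row 2 π) = PowerSeries.X ^ μ * (2 * I * E * (M * B1 + eul N B1) -
      2 * E * (M * t22 * B + eul 0 t22 * B + t22 * B1)) := by
    have r1 : 2 * I * E * B1 = 2 * I * (E * B1) := by ring
    have r2 : 2 * E * t22 * B = 2 * (E * (t22 * B)) := by ring
    rw [hc, hDU, eul_sub, r1, r2, h2I, hDE, h2, hDE, eul_mul, ← hB1]
    ring
  have he1 : eul N (row 1 γ) = PowerSeries.X ^ μ * (2 * I * (E * (M * B + B1))) := by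
    rw [h.eul_row_one, hθ11, h11, ← hI, ← hB, ← hB1]
    ring
  have he2 : eul N (eul N (row 1 γ)) = PowerSeries.X ^ μ * (2 * I * E *
      (M ^ 2 * B + 2 * M * B1 + eul N B1)) := by
    have hm : ∀ f : PowerSeries ℂ, eul N (M * f) = M * eul N f := by
      intro f
      rw [hM, ← map_natCast (PowerSeries.C (R := ℂ)), eul_C_mul]
    rw [he1, hDU, h2I, hDE, eul_add, hm, ← hB1]
    ring
  have hD2 := two_mul_row_binomOp_two N γ 1
  rw [he2, he1] at hD2
  have hD2' := congrArg conjU (two_mul_row_binomOp_two N π 0)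
  simp only [map_mul, map_sub, map_ofNat, conjU_eul, ← hB, ← hB1] at hD2'
  rw [he1, hDc, hc, hθ11, h11, h22, h32, h33, h42, eul_X_pow_pow_mul, eul_X_pow_pow_mul,
    h.row_one, h11, ← hI, ← hB, ← hA, ← hB1, ← hbb, ← hb, ← hg, ← hg1] at e
  push_cast at e
  rw [← hM] at e
  refine mul_left_cancel₀ (pow_ne_zero 3 hU) ?_
  generalize (PowerSeries.X ^ μ : PowerSeries ℂ) = U at *
  linear_combination (-2) * e - (E ^ 2 * U ^ 2) * hD2 + 2 * I * E ^ 3 * U ^ 3 * hD2'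

end FuchsianSystem

/-! ### Convergence of the leading coefficients -/

section FuchsianSystem

variable {N μ : ℕ} {S : GraphRing} {γ π : MvPowerSeries (Fin 2) ℂ}
  {E t22 t23 t32 t33 t24 t42 t34 t43 : PowerSeries ℂ}

/-- The equation in bidegree `(3, 3)`, divided by `u ^ (3 * μ)`: a third order equation for
`row 0 γ`, with convergent coefficients. -/
theorem IsTangent.eul_eul_eul_row_zero (h : IsTangent N S γ π) (hE : E ^ 2 = 1)
    (hθE : eul 0 E = 0) (hcE : conjU E = E)
    (h11 : cf 1 1 S = E * PowerSeries.X ^ μ) (h22 : cf 2 2 S = (PowerSeries.X ^ μ) ^ 2 * t22)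
    (h23 : cf 2 3 S = (PowerSeries.X ^ μ) ^ 3 * t23)
    (h32 : cf 3 2 S = (PowerSeries.X ^ μ) ^ 3 * t32)
    (h33 : cf 3 3 S = (PowerSeries.X ^ μ) ^ 3 * t33)
    (h34 : cf 3 4 S = (PowerSeries.X ^ μ) ^ 4 * t34)
    (h43 : cf 4 3 S = (PowerSeries.X ^ μ) ^ 4 * t43)
    {M I A A1 B B1 g g1 g2 b bb d U : PowerSeries ℂ} (hM : M = (μ : PowerSeries ℂ))
    (hI : I = PowerSeries.C Complex.I) (hA : A = row 0 π) (hA1 : A1 = eul N A)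
    (hB : B = conjU (row 0 π)) (hB1 : B1 = eul N B)
    (hg : g = row 0 γ) (hg1 : g1 = eul N g) (hg2 : g2 = eul N g1)
    (hb : b = row 1 π) (hbb : bb = conjU (row 1 π)) (hd : d = eul N b - eul N bb)
    (hU : U = PowerSeries.X ^ μ) :
    2 * E ^ 3 * eul N g2 =
      -(6 * (t33 * g1 - (3 * M * t33 + eul 0 t33) * g) + 6 * E ^ 2 * (E + M * E) * g1 +
        3 * E ^ 2 * M * E * (g2 - g1) - E ^ 3 * (2 * g1 - 3 * g2) +
        U * (3 * (t23 * (2 * I * E * (M * B + B1)) - (3 * M * t23 + eul 0 t23) * (2 * I * E * B)) +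
          3 * ((3 * M * t32 + eul 0 t32) * (2 * I * E * A) - t32 * (2 * I * E * (M * A + A1))))) +
      6 * (3 * I * E * t22 * d + U * (4 * I * E * (t32 * A1 - t23 * B1)) +
        2 * U * (t23 * (2 * I * E * B1 - 2 * E * t22 * B) -
          t32 * (2 * I * E * A1 + 2 * E * t22 * A)) +
        3 * t33 * (b + bb) + 4 * U * (t43 * A + t34 * B)) -
      3 * E ^ 3 * (M * g1 - M * g2 - g2) := by
  have hU0 : U ≠ 0 := hU ▸ pow_ne_zero _ PowerSeries.X_ne_zero
  have e := h.eq_three_three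
  have hθ11 : eul 0 (cf 1 1 S) = M * E * U := by
    rw [h11, eul_mul, hθE, zero_mul, zero_add, eul_X_pow, ← hM, hU]
    ring
  have hcA : conjU B = A := by rw [hB, conjU_conjU, hA]
  have hcI : conjU I = -I := by rw [hI, conjU_C_I]
  have hcU : conjU U = U := by rw [hU, map_pow, PowerSeries.map_X]
  have hct : U ^ 2 * conjU t22 = U ^ 2 * t22 := by
    have := h.symm 2 2
    rwa [h22, ← hU, map_mul, map_pow, hcU] at this
  have hcM : conjU M = M := by rw [hM, map_natCast]
  have hc : U * row 2 π = U ^ 2 * (2 * I * E * B1) - 2 * E * (U ^ 2 * t22) * B := by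
    rw [h.row_two hE h11 h22, ← hI, ← hB, ← hB1, ← hU]
    ring
  have hcc := congrArg conjU hc
  simp only [map_mul, map_sub, map_pow, map_ofNat, hcI, hcE, hcU, hcA, hB1, conjU_eul] at hcc
  rw [hct, ← hA1] at hcc
  have he1 : eul N (row 1 γ) = U * (2 * I * (E * (M * B + B1))) := by
    rw [h.eul_row_one, hθ11, h11, ← hI, ← hB, ← hB1, ← hU]
    ring
  have he1c := congrArg conjU he1
  simp only [map_mul, map_add, map_ofNat, hcI, hcE, hcU, hcA, hcM, hB1, conjU_eul] at he1c
  rw [← hA1] at he1c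
  have he := h.row_one
  rw [h11, ← hI, ← hB, ← hU] at he
  have hec := congrArg conjU he
  simp only [map_mul, map_ofNat, hcI, hcE, hcU, hcA] at hec
  have hD2 := two_mul_row_binomOp_two N γ 0
  have hD3 := six_mul_row_binomOp_three N γ 0
  rw [← hg, ← hg1, ← hg2] at hD2 hD3
  -- the second derivatives of `b` enter only through `b + b̄`
  have hsum := h.add_conj hE hθE h11
  rw [← hbb, ← hb, ← hg, ← hg1, ← hM] at hsum
  have hm : ∀ f : PowerSeries ℂ, eul N (M * f) = M * eul N f := by
    intro f
    rw [hM, ← map_natCast (PowerSeries.C (R := ℂ)), eul_C_mul]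
  have hsum1 := congrArg (eul N) hsum
  rw [eul_add, eul_sub, hm, ← hg2, ← hg1] at hsum1
  have hsum2 := congrArg (eul N) hsum1
  rw [eul_add, eul_sub, hm, ← hg2] at hsum2
  have hb2 := two_mul_row_binomOp_two N π 1
  have hb2' := congrArg conjU hb2
  simp only [map_mul, map_sub, map_ofNat, conjU_eul, ← hbb] at hb2'
  rw [← hb] at hb2
  rw [hθ11, h11, h22, h23, h32, h33, h34, h43, eul_X_pow_pow_mul, eul_X_pow_pow_mul,
    eul_X_pow_pow_mul, he1, he1c, hec, he, ← hI, ← hB, ← hA, ← hB1, ← hbb, ← hb, ← hg, ← hg1,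
    ← hU, ← hM, ← hA1, ← hd] at e
  push_cast at e
  refine mul_left_cancel₀ (pow_ne_zero 3 hU0) ?_
  linear_combination 3 * e - 3 * E ^ 3 * M * U ^ 3 * hD2 + E ^ 3 * U ^ 3 * hD3 -
    3 * E ^ 3 * U ^ 3 * (hb2 + hb2' + hsum2 - hsum1) + 12 * U ^ 2 * (t23 * hc + t32 * hcc)

/-- The series `A = row 0 π`, `b = row 1 π`, `g = row 0 γ`, the conjugates of `A` and `b`, the first
derivatives of `A`, of its conjugate and of `g`, and the second derivative of `g` form a closed
Fuchsian system. -/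
theorem IsTangent.conv_rows (h : IsTangent N S γ π) {ε : ℂ} (hε : ε = 1 ∨ ε = -1)
    (h11 : cf 1 1 S = PowerSeries.C ε * PowerSeries.X ^ μ)
    (h22 : cf 2 2 S = (PowerSeries.X ^ μ) ^ 2 * t22)
    (h23 : cf 2 3 S = (PowerSeries.X ^ μ) ^ 3 * t23)
    (h32 : cf 3 2 S = (PowerSeries.X ^ μ) ^ 3 * t32)
    (h33 : cf 3 3 S = (PowerSeries.X ^ μ) ^ 3 * t33)
    (h34 : cf 3 4 S = (PowerSeries.X ^ μ) ^ 4 * t34)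
    (h43 : cf 4 3 S = (PowerSeries.X ^ μ) ^ 4 * t43)
    (h42 : cf 4 2 S = (PowerSeries.X ^ μ) ^ 4 * t42)
    (c22 : Conv t22) (c23 : Conv t23) (c32 : Conv t32) (c33 : Conv t33) (c34 : Conv t34)
    (c43 : Conv t43) (c42 : Conv t42) :
    Conv (row 0 γ) ∧ Conv (row 0 π) ∧ Conv (row 1 π) := by
  obtain ⟨E, hEε⟩ : ∃ E : PowerSeries ℂ, E = PowerSeries.C ε := ⟨_, rfl⟩
  obtain ⟨U, hU⟩ : ∃ U : PowerSeries ℂ, U = PowerSeries.X ^ μ := ⟨_, rfl⟩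
  obtain ⟨M, hM⟩ : ∃ M : PowerSeries ℂ, M = (μ : PowerSeries ℂ) := ⟨_, rfl⟩
  obtain ⟨I, hI⟩ : ∃ I : PowerSeries ℂ, I = PowerSeries.C Complex.I := ⟨_, rfl⟩
  obtain ⟨A, hA⟩ : ∃ A, A = row 0 π := ⟨_, rfl⟩
  obtain ⟨B, hB⟩ : ∃ B, B = conjU (row 0 π) := ⟨_, rfl⟩
  obtain ⟨b, hb⟩ : ∃ b, b = row 1 π := ⟨_, rfl⟩
  obtain ⟨bb, hbb⟩ : ∃ bb, bb = conjU (row 1 π) := ⟨_, rfl⟩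
  obtain ⟨g, hg⟩ : ∃ g, g = row 0 γ := ⟨_, rfl⟩
  obtain ⟨A1, hA1⟩ : ∃ A1, A1 = eul N A := ⟨_, rfl⟩
  obtain ⟨B1, hB1⟩ : ∃ B1, B1 = eul N B := ⟨_, rfl⟩
  obtain ⟨g1, hg1⟩ : ∃ g1, g1 = eul N g := ⟨_, rfl⟩
  obtain ⟨g2, hg2⟩ : ∃ g2, g2 = eul N g1 := ⟨_, rfl⟩
  obtain ⟨d, hd⟩ : ∃ d, d = eul N b - eul N bb := ⟨_, rfl⟩
  rw [← hEε] at h11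
  have hE : E ^ 2 = 1 := by
    rcases hε with rfl | rfl <;> simp [hEε]
  have hθE : eul 0 E = 0 := by
    ext n
    rw [hEε, coeff_eul, PowerSeries.coeff_C]
    rcases n with _ | n <;> simp
  have hcE : conjU E = E := by
    rw [hEε, PowerSeries.map_C]
    rcases hε with rfl | rfl <;> simp
  have hDE : ∀ f, eul N (E * f) = E * eul N f := fun f => by rw [hEε, eul_C_mul]
  have cE : Conv E := hEε ▸ conv_C_unit ε
  have cI : Conv I := hI ▸ conv_C_unit _
  have cM : Conv M := hM ▸ conv_natCast μ
  have cU : Conv U := hU ▸ Conv.pow (conv_X (σ := Unit) ()) μ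
  have k22 := c22.euler 0
  have k23 := c23.euler 0
  have k32 := c32.euler 0
  have k33 := c33.euler 0
  obtain ⟨y, hy⟩ : ∃ y : Fin 9 → PowerSeries ℂ, y = ![A, B, A1, B1, b, bb, g, g1, g2] := ⟨_, rfl⟩
  have mA : A ∈ convSpan y := by simpa [hy] using self_mem_convSpan (y := y) 0
  have mB : B ∈ convSpan y := by simpa [hy] using self_mem_convSpan (y := y) 1
  have mA1 : A1 ∈ convSpan y := by simpa [hy] using self_mem_convSpan (y := y) 2
  have mB1 : B1 ∈ convSpan y := by simpa [hy] using self_mem_convSpan (y := y) 3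
  have mb : b ∈ convSpan y := by simpa [hy] using self_mem_convSpan (y := y) 4
  have mbb : bb ∈ convSpan y := by simpa [hy] using self_mem_convSpan (y := y) 5
  have mg : g ∈ convSpan y := by simpa [hy] using self_mem_convSpan (y := y) 6
  have mg1 : g1 ∈ convSpan y := by simpa [hy] using self_mem_convSpan (y := y) 7
  have mg2 : g2 ∈ convSpan y := by simpa [hy] using self_mem_convSpan (y := y) 8
  have md : d ∈ convSpan y := by
    have := h.eul_sub_conj hE h11 h22 h23 h32 hM
    rw [← hI, ← hB, ← hA, ← hbb, ← hb, ← hg, ← hg1, ← hd, ← hU] at this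
    rw [this]
    repeat' with_reducible first
      | assumption | exact conv_ofNat _ | apply AddSubgroup.add_mem | apply AddSubgroup.sub_mem
      | apply mul_mem_convSpan | apply Conv.mul | apply Conv.add
  have h8 : (PowerSeries.C (1 / 8 : ℂ)) * 8 = 1 := by
    rw [← map_ofNat (PowerSeries.C (R := ℂ)) 8, ← map_mul]
    norm_num
  have h2 : (PowerSeries.C (1 / 2 : ℂ)) * 2 = 1 := by
    rw [← map_ofNat (PowerSeries.C (R := ℂ)) 2, ← map_mul]
    norm_num
  have hI2 : I * I = -1 := hI ▸ C_I_sq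
  have hconj : ∀ i, conjU (y i) ∈ convSpan y := by
    have hcB : conjU B = A := by rw [hB, conjU_conjU, hA]
    have hcA : conjU A = B := by rw [hA, hB]
    have hcbb : conjU bb = b := by rw [hbb, conjU_conjU, hb]
    have hcb : conjU b = bb := by rw [hb, hbb]
    have hcA1 : conjU A1 = B1 := by rw [hA1, conjU_eul, hcA, hB1]
    have hcB1 : conjU B1 = A1 := by rw [hB1, conjU_eul, hcB, hA1]
    have hcg : conjU g = g := by rw [hg, h.row_zero_real]
    have hcg1 : conjU g1 = g1 := by rw [hg1, conjU_eul, hcg]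
    have hcg2 : conjU g2 = g2 := by rw [hg2, conjU_eul, hcg1]
    have : ∀ i, conjU ((![A, B, A1, B1, b, bb, g, g1, g2] : Fin 9 → PowerSeries ℂ) i) ∈
        convSpan y := by
      intro i
      fin_cases i
      exacts [hcA.symm ▸ mB, hcB.symm ▸ mA, hcA1.symm ▸ mB1, hcB1.symm ▸ mA1, hcb.symm ▸ mbb,
        hcbb.symm ▸ mb, hcg.symm ▸ mg, hcg1.symm ▸ mg1, hcg2.symm ▸ mg2]
    intro i
    have := this i
    rwa [← hy] at this
  have mB2 : eul N B1 ∈ convSpan y := by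
    have key := h.eul_eul_conj hE hθE hDE h11 h22 h32 h33 h42 hM hI hA hB hB1 hg hg1 hb hbb
    have hlead : eul N B1 = PowerSeries.C (1 / 8) * I * E * (8 * I ^ 3 * E ^ 3 * eul N B1) := by
      linear_combination (-(I ^ 4 * E ^ 4 * eul N B1)) * h8 - E ^ 4 * eul N B1 * (I ^ 2 - 1) * hI2 -
        eul N B1 * (E ^ 2 + 1) * hE
    rw [hlead, key, ← hU]
    repeat' with_reducible first
      | assumption | exact conv_ofNat _ | exact conv_C_unit _ | apply AddSubgroup.add_mem
      | apply AddSubgroup.sub_mem | apply AddSubgroup.neg_mem | apply mul_mem_convSpan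
      | apply Conv.mul | apply Conv.add | apply Conv.pow
  have mA2 : eul N A1 ∈ convSpan y := by
    have := conjU_mem_convSpan hconj mB2
    rwa [conjU_eul, hB1, conjU_eul, hB, conjU_conjU, ← hA, ← hA1] at this
  have hsum : eul N b + eul N bb = g2 - M * g1 := by
    have hm : eul N (M * g) = M * eul N g := by
      rw [hM, ← map_natCast (PowerSeries.C (R := ℂ)), eul_C_mul]
    have := congrArg (eul N) (h.add_conj hE hθE h11)
    rwa [← hbb, ← hb, ← hg, ← hg1, ← hM, eul_add, eul_sub, hm, ← hg1, ← hg2] at this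
  have mb1 : eul N b ∈ convSpan y := by
    have : eul N b = PowerSeries.C (1 / 2) * (g2 - M * g1 + d) := by
      linear_combination (-eul N b) * h2 + PowerSeries.C (1 / 2) * (hsum - hd)
    rw [this]
    exact mul_mem_convSpan (conv_C_unit _) (add_mem (sub_mem mg2 (mul_mem_convSpan cM mg1)) md)
  have mbb1 : eul N bb ∈ convSpan y := by
    have : eul N bb = g2 - M * g1 - eul N b := by linear_combination hsum
    rw [this]
    exact sub_mem (sub_mem mg2 (mul_mem_convSpan cM mg1)) mb1
  have mg3 : eul N g2 ∈ convSpan y := by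
    have key := h.eul_eul_eul_row_zero hE hθE hcE h11 h22 h23 h32 h33 h34 h43 hM hI hA hA1 hB hB1
      hg hg1 hg2 hb hbb hd hU
    have hlead : eul N g2 = PowerSeries.C (1 / 2) * E * (2 * E ^ 3 * eul N g2) := by
      linear_combination (-(E ^ 4 * eul N g2)) * h2 - eul N g2 * (E ^ 2 + 1) * hE
    have c1 : Conv (E + M * E) := cE.add (cM.mul cE)
    rw [hlead, key]
    repeat' with_reducible first
      | assumption | exact conv_ofNat _ | exact conv_C_unit _ | apply AddSubgroup.add_mem
      | apply AddSubgroup.sub_mem | apply AddSubgroup.neg_mem | apply mul_mem_convSpan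
      | apply Conv.mul | apply Conv.add | apply Conv.pow
  have hstable : ∀ i, eul N (y i) ∈ convSpan y := by
    have : ∀ i, eul N ((![A, B, A1, B1, b, bb, g, g1, g2] : Fin 9 → PowerSeries ℂ) i) ∈
        convSpan y := by
      intro i
      fin_cases i
      exacts [hA1 ▸ mA1, hB1 ▸ mB1, mA2, mB2, mb1, mbb1, hg1 ▸ mg1, hg2 ▸ mg2, mg3]
    intro i
    have := this i
    rwa [← hy] at this
  have hfin := conv_of_eul_mem N hstable
  refine ⟨?_, ?_, ?_⟩
  · simpa [hy, ← hg] using hfin 6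
  · simpa [hy, ← hA] using hfin 0
  · simpa [hy, ← hb] using hfin 4

end FuchsianSystem

/-! ### Convergence of the pulled back vector field -/

section Subseries

variable {σ τ : Type*}

/-- A series whose coefficients form a subfamily of those of a convergent series, with a fixed shift
of the degrees, is convergent. -/
theorem Conv.of_coeff {F : MvPowerSeries τ ℂ} (hF : Conv F) {f : MvPowerSeries σ ℂ}
    {φ : (σ →₀ ℕ) → τ →₀ ℕ} (hφ : Function.Injective φ) {c : ℕ}
    (hdeg : ∀ d, (φ d).degree = d.degree + c) (hf : ∀ d, coeff d f = coeff (φ d) F) : Conv f := by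
  obtain ⟨t, ht, h⟩ := hF
  refine ⟨t, ht, fun htop => h ?_⟩
  have h1 : wnorm t f * (t : ℝ≥0∞) ^ c ≤ wnorm t F := by
    rw [wnorm, wnorm, ← ENNReal.tsum_mul_right]
    refine le_trans (le_of_eq (tsum_congr fun d => ?_))
      (ENNReal.tsum_comp_le_tsum_of_injective hφ fun d => ‖coeff d F‖ₑ * (t : ℝ≥0∞) ^ d.degree)
    rw [hf, hdeg, pow_add, mul_assoc]
  rw [htop, ENNReal.top_mul (pow_ne_zero _ (by exact_mod_cast ht.ne'))] at h1
  exact top_le_iff.1 h1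

theorem Conv.of_X_pow_mul {i : σ} {a : ℕ} {f : MvPowerSeries σ ℂ} (h : Conv (X i ^ a * f)) :
    Conv f := by
  classical
  refine h.of_coeff (φ := fun d => Finsupp.single i a + d) (c := a) (add_right_injective _) ?_ ?_
  · intro d
    rw [map_add, Finsupp.degree_single, add_comm]
  · intro d
    rw [X_pow_eq, coeff_add_monomial_mul, one_mul]

theorem Conv.cf {f : GraphRing} (hf : Conv f) (k l : ℕ) : Conv (cf k l f) := by
  refine Conv.of_coeff (σ := Unit) hf (φ := fun d => expo k l (d ())) (c := k + l) ?_ ?_ ?_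
  · intro d e h
    have := DFunLike.congr_fun h 3
    ext
    exact this
  · intro d
    rw [Finsupp.degree_eq_sum, Finsupp.degree_eq_sum, Fin.sum_univ_four, Fintype.sum_unique]
    change 0 + k + l + d () = d () + (k + l)
    omega
  · intro d
    rw [← coeff_cf, PowerSeries.coeff]
    congr 2
    ext
    simp

end Subseries

section RowCalculus

variable {F G : MvPowerSeries (Fin 2) ℂ}

theorem row_ext (h : ∀ k, row k F = row k G) : F = G := by
  ext d
  have hd : d = Finsupp.cons (d 0) (Finsupp.cons (d 1) 0) := by
    ext i
    fin_cases i <;> rfl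
  rw [hd, ← coeff_row, ← coeff_row, h]

theorem row_add (k : ℕ) (F G : MvPowerSeries (Fin 2) ℂ) : row k (F + G) = row k F + row k G := by
  ext n
  simp [coeff_row]

theorem row_sub (k : ℕ) (F G : MvPowerSeries (Fin 2) ℂ) : row k (F - G) = row k F - row k G := by
  ext n
  simp [coeff_row]

theorem row_mul (k : ℕ) (F G : MvPowerSeries (Fin 2) ℂ) :
    row k (F * G) = ∑ i ∈ Finset.range (k + 1), row i F * row (k - i) G := by
  rw [← cf_baseSub_zero, baseSub, map_mul, cf_mul]
  refine Finset.sum_congr rfl fun i _ => ?_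
  rw [Finset.sum_range_one, ← cf_baseSub_zero, ← cf_baseSub_zero]
  rfl

/-- A power series in one variable, as a series in `w`. -/
def inW (f : PowerSeries ℂ) : MvPowerSeries (Fin 2) ℂ :=
  rename (R := ℂ) (Function.Embedding.mk (fun _ : Unit => (1 : Fin 2)) fun _ _ _ => rfl) f

theorem Conv.inW {f : PowerSeries ℂ} (hf : Conv f) : Conv (inW f) := by
  rw [FuchsianCR.inW, rename_eq_subst]
  exact Conv.comp hf (fun _ => conv_X _) (fun _ => constantCoeff_X _)

theorem row_zero_inW (f : PowerSeries ℂ) : row 0 (inW f) = f := by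
  ext n
  have h : (Finsupp.cons 0 (Finsupp.cons n 0) : Fin 2 →₀ ℕ) = Finsupp.embDomain
      (Function.Embedding.mk (fun _ : Unit => (1 : Fin 2)) fun _ _ _ => rfl)
      (Finsupp.single () n) := by
    rw [Finsupp.embDomain_single]
    ext i
    fin_cases i
    · exact (Finsupp.single_eq_of_ne (by decide)).symm
    · exact Finsupp.single_eq_same.symm
  rw [coeff_row, inW, h, coeff_embDomain_rename]
  rfl

theorem row_succ_inW (k : ℕ) (f : PowerSeries ℂ) : row (k + 1) (inW f) = 0 := by
  ext n
  rw [coeff_row, inW, map_zero]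
  refine coeff_rename_eq_zero _ _ ?_
  rintro ⟨x, hx⟩
  have h1 : (Finsupp.mapDomain (fun _ : Unit => (1 : Fin 2)) x) 0 = 0 :=
    Finsupp.mapDomain_of_notMem_range _ _ (by simp)
  have h2 := DFunLike.congr_fun hx 0
  exact absurd (h2.symm.trans h1) (Nat.succ_ne_zero k)

theorem row_inW_mul (k : ℕ) (f : PowerSeries ℂ) (F : MvPowerSeries (Fin 2) ℂ) :
    row k (inW f * F) = f * row k F := by
  rw [row_mul, Finset.sum_range_succ', Finset.sum_eq_zero, zero_add, row_zero_inW, Nat.sub_zero]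
  intro i _
  rw [row_succ_inW, zero_mul]

theorem row_X_zero_pow_mul (k j : ℕ) (F : MvPowerSeries (Fin 2) ℂ) :
    row k (X 0 ^ j * F) = if j ≤ k then row (k - j) F else 0 := by
  classical
  ext n
  rw [coeff_row, X_pow_eq, coeff_monomial_mul, one_mul]
  have : Finsupp.single 0 j ≤ (Finsupp.cons k (Finsupp.cons n 0) : Fin 2 →₀ ℕ) ↔ j ≤ k := by
    rw [Finsupp.single_le_iff]
    rfl
  simp only [this]
  split_ifs with h
  · rw [coeff_row]
    congr 2
    ext i
    fin_cases i
    · rw [Finsupp.tsub_apply]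
      exact congrArg (k - ·) Finsupp.single_eq_same
    · simp
      rfl
  · rw [map_zero]

end RowCalculus

section FieldConvergence

variable {N μ : ℕ} {S : GraphRing} {γ π : MvPowerSeries (Fin 2) ℂ}
  {t22 t23 t32 t33 t42 t34 t43 : PowerSeries ℂ}

/-- The coefficient `γ` is affine in `z`, with coefficients determined by `row 0 γ` and `row 0 π`. -/
theorem IsTangent.conv_snd (h : IsTangent N S γ π) {ε : ℂ}
    (h11 : cf 1 1 S = PowerSeries.C ε * PowerSeries.X ^ μ)
    (hg : Conv (row 0 γ)) (ha : Conv (row 0 π)) : Conv γ := by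
  have e : γ = inW (row 0 γ) + X 0 ^ 1 * inW (row 1 γ) := by
    refine row_ext fun k => ?_
    rw [row_add, row_X_zero_pow_mul]
    rcases k with _ | _ | k
    · simp [row_zero_inW]
    · simp [row_zero_inW, row_succ_inW]
    · rw [h.row_add_two, row_succ_inW, if_pos (by omega)]
      simp [row_succ_inW]
  rw [e]
  refine hg.inW.add (((conv_X 0).pow 1).mul (Conv.inW ?_))
  rw [h.row_one, h11]
  exact (((conv_ofNat 2).mul (conv_C_unit _)).mul ((conv_C_unit _).mul
    (Conv.pow (conv_X (σ := Unit) ()) μ))).mul ha.conjU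

/-- The coefficients of `z ^ k` in `π` are determined for `k ≥ 3` by the components `(k, 2)` of `S`,
which form a convergent series. -/
theorem IsTangent.conv_fst (h : IsTangent N S γ π) {ε : ℂ} (hε : ε = 1 ∨ ε = -1)
    (h11 : cf 1 1 S = PowerSeries.C ε * PowerSeries.X ^ μ)
    (h22 : cf 2 2 S = (PowerSeries.X ^ μ) ^ 2 * t22) {H : MvPowerSeries (Fin 2) ℂ} (hH : Conv H)
    (hH2 : ∀ k, cf k 2 S = PowerSeries.X ^ μ * row k H)
    (ha : Conv (row 0 π)) (hb : Conv (row 1 π)) : Conv π := by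
  have hU : (PowerSeries.X ^ μ : PowerSeries ℂ) ≠ 0 := pow_ne_zero _ PowerSeries.X_ne_zero
  obtain ⟨E, hE⟩ : ∃ E : PowerSeries ℂ, E = PowerSeries.C ε := ⟨_, rfl⟩
  rw [← hE] at h11
  have hE2 : E ^ 2 = 1 := by rcases hε with rfl | rfl <;> simp [hE]
  have hHk : ∀ k, k < 2 → row k H = 0 := fun k hk => by
    have := hH2 k
    rw [h.normal k 2 (by omega) (by omega)] at this
    exact (mul_eq_zero.1 this.symm).resolve_left hU
  have hH22 : row 2 H = PowerSeries.X ^ μ * t22 := by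
    refine mul_left_cancel₀ hU ?_
    rw [← hH2, h22]
    ring
  have e : π = inW (row 0 π) + X 0 ^ 1 * inW (row 1 π) + X 0 ^ 2 * inW (PowerSeries.X ^ μ *
      (2 * PowerSeries.C Complex.I * E * eul N (conjU (row 0 π)))) -
      inW (2 * E * conjU (row 0 π)) * H := by
    refine row_ext fun k => ?_
    rw [row_sub, row_add, row_add, row_X_zero_pow_mul, row_X_zero_pow_mul, row_inW_mul]
    rcases k with _ | _ | _ | k
    · simp [row_zero_inW, hHk]
    · simp [row_zero_inW, row_succ_inW, hHk]
    · have := h.row_two hE2 h11 h22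
      simp only [zero_add, Nat.reduceAdd, row_succ_inW, if_pos (show 1 ≤ 2 by norm_num),
        if_pos (le_refl 2), Nat.sub_self, row_zero_inW, hH22, this]
      ring
    · have h3 := h.eq_add_three_one k
      have r1 : row (k + 1 + 1 + 1 - 1) (inW (row 1 π)) = 0 := row_succ_inW (k + 1) _
      have r2 : ∀ f, row (k + 1 + 1 + 1 - 2) (inW f) = 0 := fun f => row_succ_inW k f
      rw [row_succ_inW, if_pos (by omega), if_pos (by omega), r1, r2]
      rw [hH2, h11] at h3
      refine mul_left_cancel₀ hU ?_
      change _ * row (k + 3) π = _ * (0 + 0 + 0 - _ * row (k + 3) H)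
      linear_combination E * h3 - PowerSeries.X ^ μ * row (k + 3) π * hE2
  have cE : Conv E := hE ▸ conv_C_unit ε
  rw [e]
  refine ((ha.inW.add (((conv_X 0).pow 1).mul hb.inW)).add (((conv_X 0).pow 2).mul
    (Conv.inW ?_))).sub ((Conv.inW (((conv_ofNat 2).mul cE).mul ha.conjU)).mul hH)
  exact (Conv.pow (conv_X (σ := Unit) ()) μ).mul
    ((((conv_ofNat 2).mul (conv_C_unit _)).mul cE).mul (ha.conjU.euler N))

end FieldConvergence

/-! ### The defining series of a Fuchsian hypersurface -/

section HypersurfaceSeries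

variable {m μ : ℕ} {ε : ℝ} {h : ℕ → ℕ → PowerSeries ℂ}

/-- The series `∑ h_{k l}(u) z ^ k ζ ^ l`. -/
def restSeries (h : ℕ → ℕ → PowerSeries ℂ) : GraphRing :=
  fun d => if d 0 = 0 then PowerSeries.coeff (d 3) (h (d 1) (d 2)) else 0

theorem coeff_restSeries (h : ℕ → ℕ → PowerSeries ℂ) (d : Fin 4 →₀ ℕ) : coeff d (restSeries h) =
    if d 0 = 0 then PowerSeries.coeff (d 3) (h (d 1) (d 2)) else 0 := rfl

theorem cf_restSeries (h : ℕ → ℕ → PowerSeries ℂ) (k l : ℕ) : cf k l (restSeries h) = h k l := by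
  ext n
  rw [coeff_cf, coeff_restSeries]
  simp

/-- The series `S = u ^ μ (ε z ζ + ∑ h_{k l}(u) z ^ k ζ ^ l)`; the hypersurface is `v = u S`. -/
def graphSeries (μ : ℕ) (ε : ℝ) (h : ℕ → ℕ → PowerSeries ℂ) : GraphRing :=
  X 3 ^ μ * (C (ε : ℂ) * (X 1 * X 2) + restSeries h)

theorem cf_X_one_mul_X_two (k l : ℕ) :
    cf k l (X 1 * X 2) = if k = 1 ∧ l = 1 then 1 else 0 := by
  classical
  ext n
  have h1 : (X 1 * X 2 : GraphRing) = monomial (expo 1 1 0) 1 := by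
    rw [X, X, monomial_mul_monomial, mul_one]
    congr 2
    ext i
    fin_cases i <;> simp
  rw [coeff_cf, h1, coeff_monomial]
  have h2 : expo k l n = expo 1 1 0 ↔ k = 1 ∧ l = 1 ∧ n = 0 :=
    ⟨fun h => ⟨DFunLike.congr_fun h 1, DFunLike.congr_fun h 2, DFunLike.congr_fun h 3⟩,
      fun ⟨h1, h2, h3⟩ => by rw [h1, h2, h3]⟩
  rw [if_congr h2 rfl rfl]
  by_cases hkl : k = 1 ∧ l = 1
  · rw [if_pos hkl, PowerSeries.coeff_one]
    simp [hkl.1, hkl.2]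
  · rw [if_neg hkl, if_neg (fun h' => hkl ⟨h'.1, h'.2.1⟩), map_zero]

theorem cf_graphSeries (k l : ℕ) : cf k l (graphSeries μ ε h) =
    PowerSeries.X ^ μ * (PowerSeries.C (ε : ℂ) * (if k = 1 ∧ l = 1 then 1 else 0) + h k l) := by
  rw [graphSeries, cf_X_three_pow_mul, cf_add, cf_C_mul, cf_restSeries, cf_X_one_mul_X_two]

theorem isNormal_graphSeries (h0 : ∀ k l, k < 2 ∨ l < 2 → h k l = 0) :
    IsNormal (graphSeries μ ε h) := by
  intro k l hkl h1
  rw [cf_graphSeries, if_neg h1, h0 k l hkl]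
  simp

theorem X_one_dvd_graphSeries (h0 : ∀ k l, k < 2 ∨ l < 2 → h k l = 0) :
    X 1 ∣ graphSeries μ ε h := by
  refine Dvd.dvd.mul_left (dvd_add ?_ (X_dvd_iff.2 fun d hd => ?_)) _
  · exact ⟨C (ε : ℂ) * X 2, by ring⟩
  · rw [coeff_restSeries, hd, h0 _ _ (by omega)]
    simp

theorem X_two_dvd_graphSeries (h0 : ∀ k l, k < 2 ∨ l < 2 → h k l = 0) :
    X 2 ∣ graphSeries μ ε h := by
  refine Dvd.dvd.mul_left (dvd_add ?_ (X_dvd_iff.2 fun d hd => ?_)) _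
  · exact ⟨C (ε : ℂ) * X 1, by ring⟩
  · rw [coeff_restSeries, hd, h0 _ _ (by omega)]
    simp

theorem pderiv_zero_graphSeries : pderiv ℂ 0 (graphSeries μ ε h) = 0 := by
  have h1 : pderiv ℂ 0 (restSeries h) = 0 := by
    ext d
    rw [coeff_pderiv, coeff_restSeries, if_neg (by simp), zero_mul, map_zero]
  have hX : ∀ i : Fin 4, i ≠ 0 → pderiv ℂ 0 (X i : GraphRing) = 0 := fun i hi =>
    pderiv_X_of_ne hi
  rw [graphSeries, Derivation.leibniz, Derivation.leibniz_pow, hX 3 (by decide), map_add, h1,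
    Derivation.leibniz, Derivation.leibniz, hX 1 (by decide), hX 2 (by decide), pderiv_C]
  simp

/-- The sum of the real-analytic part of an admissible equation. -/
def IsRestSum (h : ℕ → ℕ → PowerSeries ℂ) (H : ℂ → ℝ → ℝ) : Prop :=
  ∀ᶠ x in 𝓝 (0 : C2),
    HasSum (fun n : ℕ × ℕ × ℕ =>
        PowerSeries.coeff n.2.2 (h n.1 n.2.1) * ((x 1).re : ℂ) ^ n.2.2 *
          x 0 ^ n.1 * (starRingEnd ℂ (x 0)) ^ n.2.1)
      ((H (x 0) (x 1).re : ℝ) : ℂ)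

theorem expo_injective : Function.Injective fun n : ℕ × ℕ × ℕ => expo n.1 n.2.1 n.2.2 := by
  intro a b hab
  exact Prod.ext (DFunLike.congr_fun hab 1)
    (Prod.ext (DFunLike.congr_fun hab 2) (DFunLike.congr_fun hab 3))

theorem coeff_restSeries_of_notMem {d : Fin 4 →₀ ℕ}
    (hd : d ∉ Set.range fun n : ℕ × ℕ × ℕ => expo n.1 n.2.1 n.2.2) :
    coeff d (restSeries h) = 0 := by
  rw [coeff_restSeries, if_neg]
  exact fun h0 => hd ⟨(d 1, d 2, d 3), (eq_expo h0).symm⟩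

theorem coeff_restSeries_expo_mul (x : Fin 4 → ℂ) (n : ℕ × ℕ × ℕ) :
    coeff (expo n.1 n.2.1 n.2.2) (restSeries h) * ∏ i, x i ^ (expo n.1 n.2.1 n.2.2 i) =
      PowerSeries.coeff n.2.2 (h n.1 n.2.1) * x 3 ^ n.2.2 * x 1 ^ n.1 * x 2 ^ n.2.1 := by
  rw [coeff_restSeries, Fin.prod_univ_four]
  simp only [expo_zero, expo_one, expo_two, expo_three, if_true, pow_zero]
  ring

theorem IsRestSum.conv {H : ℂ → ℝ → ℝ} (hH : IsRestSum h H) : Conv (restSeries h) := by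
  obtain ⟨δ, hδ, hb⟩ := Metric.eventually_nhds_iff.1 hH
  have hδ2 : 0 < δ / 2 := by positivity
  have h1 := (hb (y := fun _ => ((δ / 2 : ℝ) : ℂ)) (by
    rw [dist_zero_right]
    refine lt_of_le_of_lt ((pi_norm_le_iff_of_nonneg hδ2.le).2 fun i => ?_) (half_lt_self hδ)
    rw [Complex.norm_real, Real.norm_of_nonneg hδ2.le])).summable
  refine conv_of_summable (t := (δ / 2).toNNReal) (by simpa using hδ2) ?_
  rw [← expo_injective.summable_iff]
  · refine h1.congr fun n => ?_
    rw [Function.comp_apply, coeff_restSeries_expo_mul]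
    simp only [Complex.conj_ofReal, Complex.ofReal_re, Real.coe_toNNReal _ hδ2.le]
  · intro d hd
    rw [coeff_restSeries_of_notMem hd, zero_mul]

/-- The point `(t, z, z̄, u)`. -/
def realPoint (q : ℂ × ℝ × ℝ) : Fin 4 → ℂ :=
  ![(q.2.1 : ℂ), q.1, starRingEnd ℂ q.1, (q.2.2 : ℂ)]

theorem tendsto_realPoint : Tendsto realPoint (𝓝 0) (𝓝 0) := by
  have hc : Continuous realPoint := by
    refine continuous_pi fun i => ?_
    fin_cases i
    · exact Complex.continuous_ofReal.comp (continuous_fst.comp continuous_snd)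
    · exact continuous_fst
    · exact Complex.continuous_conj.comp continuous_fst
    · exact Complex.continuous_ofReal.comp (continuous_snd.comp continuous_snd)
  have h0 : realPoint 0 = 0 := by
    funext i
    fin_cases i <;> simp [realPoint]
  simpa [h0] using hc.tendsto 0

theorem IsRestSum.eventually_ev {H : ℂ → ℝ → ℝ} (hH : IsRestSum h H) :
    ∀ᶠ q in 𝓝 (0 : ℂ × ℝ × ℝ), ev (realPoint q) (restSeries h) = (H q.1 q.2.2 : ℂ) := by
  have hc : Tendsto (fun q : ℂ × ℝ × ℝ => (![q.1, (q.2.2 : ℂ)] : C2)) (𝓝 0) (𝓝 0) := by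
    have : Continuous fun q : ℂ × ℝ × ℝ => (![q.1, (q.2.2 : ℂ)] : C2) := by
      refine continuous_pi fun i => ?_
      fin_cases i
      · exact continuous_fst
      · exact Complex.continuous_ofReal.comp (continuous_snd.comp continuous_snd)
    have h0 : (![(0 : ℂ), ((0 : ℝ) : ℂ)] : C2) = 0 := by
      funext i
      fin_cases i <;> simp
    have h1 := this.tendsto 0
    rwa [show (0 : ℂ × ℝ × ℝ).1 = 0 from rfl, show (0 : ℂ × ℝ × ℝ).2.2 = 0 from rfl, h0] at h1
  filter_upwards [hc.eventually hH] with q hq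
  refine HasSum.tsum_eq ((expo_injective.hasSum_iff fun d hd => ?_).1 ?_)
  · rw [coeff_restSeries_of_notMem hd, zero_mul]
  · convert hq using 1
    · funext n
      rw [Function.comp_apply, coeff_restSeries_expo_mul]
      rfl
    · rfl

theorem ev_X_pow {σ : Type*} [Fintype σ] (i : σ) (k : ℕ) (x : σ → ℂ) :
    ev x (X i ^ k : MvPowerSeries σ ℂ) = x i ^ k := by
  have ht : ∀ j, ‖x j‖ₑ ≤ ((∑ j, ‖x j‖₊ : ℝ≥0) : ℝ≥0∞) := fun j => by
    rw [enorm_eq_nnnorm]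
    exact_mod_cast Finset.single_le_sum (f := fun j => ‖x j‖₊) (fun _ _ => zero_le)
      (Finset.mem_univ j)
  rw [ev_pow (t := ((∑ j, ‖x j‖₊ : ℝ≥0) : ℝ≥0∞)) (by rw [wnorm_X]; exact ENNReal.coe_ne_top) ht,
    ev_X]

theorem ev_conj_map_conj {σ : Type*} [Fintype σ] (x : σ → ℂ) (f : MvPowerSeries σ ℂ) :
    ev (fun i => starRingEnd ℂ (x i)) (map (starRingEnd ℂ) f) = starRingEnd ℂ (ev x f) := by
  rw [ev, ev, Complex.conj_tsum]
  refine tsum_congr fun d => ?_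
  rw [coeff_map, map_mul, map_prod]
  simp only [map_pow]

theorem IsRestSum.conjSwap_eq {H : ℂ → ℝ → ℝ} (hH : IsRestSum h H) :
    conjSwap (restSeries h) = restSeries h := by
  have hc := hH.conv
  have hX : ∀ i, Conv ((X ∘ Equiv.swap (1 : Fin 4) 2) i : GraphRing) := fun i => conv_X _
  have hX0 : ∀ i, constantCoeff ((X ∘ Equiv.swap (1 : Fin 4) 2) i : GraphRing) = 0 := fun i =>
    constantCoeff_X _
  have hc' : Conv (conjSwap (restSeries h)) := by
    rw [conjSwap_eq_subst]
    exact hc.map_conj.comp hX hX0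
  refine sub_eq_zero.1 (Conv.eq_zero_of_conj (hc'.sub hc) ?_)
  filter_upwards [hH.eventually_ev, tendsto_realPoint.eventually (hc'.eventually_ev_add hc.neg),
    tendsto_realPoint.eventually (hc.map_conj.eventually_ev_subst hX hX0)] with q h1 h2 h3
  change ev (realPoint q) _ = 0
  have h4 : (fun i => ev (realPoint q) ((X ∘ Equiv.swap (1 : Fin 4) 2) i : GraphRing)) =
      fun i => starRingEnd ℂ (realPoint q i) := by
    funext i
    rw [Function.comp_apply, ev_X]
    fin_cases i <;> simp [realPoint, Equiv.swap_apply_of_ne_of_ne]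
  have h5 : ev (realPoint q) (-restSeries h) = - ev (realPoint q) (restSeries h) := by
    have := ev_C_mul (-1) (restSeries h) (realPoint q)
    rwa [map_neg, map_one, neg_one_mul, neg_one_mul] at this
  rw [sub_eq_add_neg, h2, h5, conjSwap_eq_subst, h3, h4, ev_conj_map_conj, h1, Complex.conj_ofReal]
  ring

theorem conjSwap_graphSeries {H : ℂ → ℝ → ℝ} (hH : IsRestSum h H) :
    conjSwap (graphSeries μ ε h) = graphSeries μ ε h := by
  have h3 : conjSwap (X 3) = X 3 := conjSwap_X 3
  have h1 : conjSwap (X 1) = X 2 := conjSwap_X 1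
  have h2 : conjSwap (X 2) = X 1 := conjSwap_X 2
  rw [graphSeries, map_mul, map_pow, map_add, map_mul, map_mul, hH.conjSwap_eq, conjSwap_C, h1, h2,
    h3, Complex.conj_ofReal, mul_comm (X 2)]

theorem IsRestSum.conv_graphSeries {H : ℂ → ℝ → ℝ} (hH : IsRestSum h H) :
    Conv (graphSeries μ ε h) :=
  ((conv_X 3).pow μ).mul (((conv_C _).mul ((conv_X 1).mul (conv_X 2))).add hH.conv)

theorem IsRestSum.eventually_ev_graphSeries {H : ℂ → ℝ → ℝ} (hH : IsRestSum h H) :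
    ∀ᶠ q in 𝓝 (0 : ℂ × ℝ × ℝ), ev (realPoint q) (X 3 * graphSeries μ ε h) =
      ((q.2.2 ^ (μ + 1) * (ε * ‖q.1‖ ^ 2 + H q.1 q.2.2) : ℝ) : ℂ) := by
  have c1 : Conv (C (ε : ℂ) * (X 1 * X 2) : GraphRing) := (conv_C _).mul ((conv_X 1).mul (conv_X 2))
  have e : X 3 * graphSeries μ ε h =
      X 3 ^ (μ + 1) * (C (ε : ℂ) * (X 1 * X 2) + restSeries h) := by
    rw [graphSeries, pow_succ']
    ring
  filter_upwards [hH.eventually_ev,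
    tendsto_realPoint.eventually (((conv_X 3).pow (μ + 1)).eventually_ev_mul (c1.add hH.conv)),
    tendsto_realPoint.eventually (c1.eventually_ev_add hH.conv),
    tendsto_realPoint.eventually ((conv_X 1).eventually_ev_mul (conv_X (2 : Fin 4)))] with q h1 h2 h3 h4
  rw [e, h2, h3, h1, ev_C_mul, h4, ev_X, ev_X, ev_X_pow]
  have h5 : realPoint q 1 * realPoint q 2 = ((‖q.1‖ ^ 2 : ℝ) : ℂ) := by
    rw [← Complex.normSq_eq_norm_sq]
    exact Complex.mul_conj q.1
  have h6 : realPoint q 3 = (q.2.2 : ℂ) := rfl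
  rw [h5, h6]
  push_cast
  ring

/-- Power series in `u` vanishing to order `a` are divisible by `u ^ a`, and the quotient
inherits convergence. -/
theorem exists_eq_X_pow_mul {f : PowerSeries ℂ} (hf : Conv f) {a : ℕ} (ha : (a : ℕ∞) ≤ f.order) :
    ∃ t : PowerSeries ℂ, Conv t ∧ f = PowerSeries.X ^ a * t := by
  obtain ⟨t, ht⟩ := PowerSeries.X_pow_dvd_iff.2 fun n hn =>
    PowerSeries.coeff_of_lt_order n (lt_of_lt_of_le (by exact_mod_cast hn) ha)
  refine ⟨t, ?_, ht⟩
  rw [ht] at hf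
  exact Conv.of_X_pow_mul (i := ()) (a := a) hf

end HypersurfaceSeries

/-! ### Pulling back a formal automorphism -/

section Pullback

variable {V : GraphRing} {Ψ : Fin 2 → MvPowerSeries (Fin 2) ℂ}

theorem wPlus_ne_zero (hVt : pderiv ℂ 0 V = 0) : wPlus V ≠ 0 := by
  intro h
  have := congrArg (pderiv ℂ 0) h
  rw [pderiv_wPlus, hVt, pderiv_X_self, pderiv_X_of_ne (by decide), map_zero, zero_add, zero_add,
    mul_one] at this
  exact C_I_ne_zero this

theorem wMinus_ne_zero (hVt : pderiv ℂ 0 V = 0) : wMinus V ≠ 0 := by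
  intro h
  have := congrArg (pderiv ℂ 0) h
  rw [pderiv_wMinus, hVt, pderiv_X_self, pderiv_X_of_ne (by decide), map_zero, zero_add, zero_sub,
    mul_one, neg_eq_zero] at this
  exact C_I_ne_zero this

theorem holSub_one (hV0 : constantCoeff V = 0) : holSub V 1 = 1 := by
  have := holSub_X_one_pow hV0 0
  rwa [pow_zero, pow_zero] at this

theorem antiSub_one (hV0 : constantCoeff V = 0) : antiSub V 1 = 1 := by
  have := antiSub_X_one_pow hV0 0
  rwa [pow_zero, pow_zero] at this

/-- The coefficient of `t⁰ ζ²` of a series in `t, z, ζ, u`, as a series in `z` and `u`. -/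
def quadraticPart (F : GraphRing) : MvPowerSeries (Fin 2) ℂ :=
  fun d => coeff (expo (d 0) 2 (d 1)) F

theorem coeff_quadraticPart (F : GraphRing) (d : Fin 2 →₀ ℕ) :
    coeff d (quadraticPart F) = coeff (expo (d 0) 2 (d 1)) F := rfl

theorem row_quadraticPart (F : GraphRing) (k : ℕ) : row k (quadraticPart F) = cf k 2 F := by
  ext n
  rw [coeff_row, coeff_quadraticPart, coeff_cf]
  rfl

theorem Conv.quadraticPart {F : GraphRing} (hF : Conv F) : Conv (quadraticPart F) := by
  refine hF.of_coeff (φ := fun d => expo (d 0) 2 (d 1)) (c := 2) ?_ ?_ (coeff_quadraticPart F)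
  · intro d d' hd
    ext i
    fin_cases i
    · exact DFunLike.congr_fun hd 1
    · exact DFunLike.congr_fun hd 3
  · intro d
    rw [Finsupp.degree_eq_sum, Finsupp.degree_eq_sum, Fin.sum_univ_four, Fin.sum_univ_two]
    simp only [expo_zero, expo_one, expo_two, expo_three]
    omega

/-- If the Jacobian determinant of `Ψ` is a power of `w` up to a unit, the pulled back vector field
has at most a pole along `w = 0`; it converges. -/
theorem conv_subst_of_dvd (hΨ0 : ∀ i, constantCoeff (Ψ i) = 0) (hΨ : ∀ i, Conv (Ψ i)) {k : ℕ}
    {e e' : MvPowerSeries (Fin 2) ℂ} (he : e * e' = 1) (hJ : jacDet Ψ = X 1 ^ k * e)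
    {r : FormalRing} (hr : r ≠ 0) {L : FormalVectorField} (hL : r ∣ L.applyReal r)
    {μ : ℕ} {ε : ℝ} {h : ℕ → ℕ → PowerSeries ℂ} {H : ℂ → ℝ → ℝ} (hε : ε = 1 ∨ ε = -1)
    (h0 : ∀ k l, k < 2 ∨ l < 2 → h k l = 0) (hH : IsRestSum h H)
    (o22 : ((μ : ℕ) : ℕ∞) ≤ (h 2 2).order) (o23 : ((2 * μ : ℕ) : ℕ∞) ≤ (h 2 3).order)
    (o33 : ((2 * μ : ℕ) : ℕ∞) ≤ (h 3 3).order) (o24 : ((3 * μ : ℕ) : ℕ∞) ≤ (h 2 4).order)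
    (o34 : ((3 * μ : ℕ) : ℕ∞) ≤ (h 3 4).order)
    (ht : X 0 ∣ subst (coordMap Ψ (X 3 * graphSeries μ ε h)) r) (i : Fin 2) :
    Conv (subst Ψ (L i)) := by
  set S := graphSeries μ ε h with hS
  have hV0 : constantCoeff (X 3 * S) = 0 := by simp
  have hVt : pderiv ℂ 0 (X 3 * S) = 0 := by
    rw [Derivation.leibniz, pderiv_X_of_ne (by decide), hS, pderiv_zero_graphSeries]
    simp
  have hJ1 : holSub (X 3 * S) (jacDet Ψ) ≠ 0 := by
    rw [hJ, holSub_mul hV0, holSub_X_one_pow hV0]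
    refine mul_ne_zero (pow_ne_zero _ (wPlus_ne_zero hVt)) (left_ne_zero_of_mul_eq_one (b :=
      holSub (X 3 * S) e') ?_)
    rw [← holSub_mul hV0, he, holSub_one hV0]
  have hJ2 : antiSub (X 3 * S) (map (starRingEnd ℂ) (jacDet Ψ)) ≠ 0 := by
    rw [hJ, map_mul, map_pow, map_X, antiSub_mul hV0, antiSub_X_one_pow hV0]
    refine mul_ne_zero (pow_ne_zero _ (wMinus_ne_zero hVt)) (left_ne_zero_of_mul_eq_one (b :=
      antiSub (X 3 * S) (map (starRingEnd ℂ) e')) ?_)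
    rw [← antiSub_mul hV0, ← map_mul, he, map_one, antiSub_one hV0]
  -- the components of the pulled back field, by Cramer's rule
  set p := e' * (pderiv ℂ 1 (Ψ 1) * subst Ψ (L 0) - pderiv ℂ 1 (Ψ 0) * subst Ψ (L 1)) with hp
  set q := e' * (pderiv ℂ 0 (Ψ 0) * subst Ψ (L 1) - pderiv ℂ 0 (Ψ 1) * subst Ψ (L 0)) with hq
  have hpq : ∀ i, p * pderiv ℂ 0 (Ψ i) + q * pderiv ℂ 1 (Ψ i) = X 1 ^ k * subst Ψ (L i) := by
    have hJ' : e' * (pderiv ℂ 0 (Ψ 0) * pderiv ℂ 1 (Ψ 1) - pderiv ℂ 1 (Ψ 0) * pderiv ℂ 0 (Ψ 1)) =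
        X 1 ^ k := by
      change e' * jacDet Ψ = _
      rw [hJ]
      linear_combination X 1 ^ k * he
    intro i
    fin_cases i
    · change p * pderiv ℂ 0 (Ψ 0) + q * pderiv ℂ 1 (Ψ 0) = X 1 ^ k * subst Ψ (L 0)
      rw [hp, hq]
      linear_combination subst Ψ (L 0) * hJ'
    · change p * pderiv ℂ 0 (Ψ 1) + q * pderiv ℂ 1 (Ψ 1) = X 1 ^ k * subst Ψ (L 1)
      rw [hp, hq]
      linear_combination subst Ψ (L 1) * hJ'
  have hsymm : ∀ k l, conjU (cf k l S) = cf l k S := fun k l => by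
    rw [← cf_conjSwap, conjSwap_graphSeries hH]
  have htan : IsTangent (k + 1) S q (X 1 * p) :=
    { normal := isNormal_graphSeries h0
      symm := hsymm
      eqn := fun a b hab => cf_tangency (X_one_dvd_graphSeries h0) (X_two_dvd_graphSeries h0)
        (conjSwap_graphSeries hH) (tangency hV0 hVt hΨ0 hJ1 hJ2 hr hL ht hpq) rfl rfl rfl rfl hab }
  have hcf : ∀ k l, ¬ (k = 1 ∧ l = 1) → cf k l S = PowerSeries.X ^ μ * h k l := fun k l hkl => by
    rw [hS, cf_graphSeries, if_neg hkl, mul_zero, zero_add]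
  have hsw : ∀ k l, ¬ (k = 1 ∧ l = 1) → h l k = conjU (h k l) := fun k l hkl => by
    have h1 := hsymm k l
    rw [hcf k l hkl, hcf l k (fun h => hkl h.symm), map_mul, map_pow, PowerSeries.map_X] at h1
    exact (mul_left_cancel₀ (pow_ne_zero _ PowerSeries.X_ne_zero) h1).symm
  have hhc : ∀ k l, Conv (h k l) := fun k l => by
    have := hH.conv.cf k l
    rwa [cf_restSeries] at this
  have hconj : ∀ {a : ℕ} {f t : PowerSeries ℂ}, f = PowerSeries.X ^ a * t →
      conjU f = PowerSeries.X ^ a * conjU t := fun {a f t} hft => by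
    rw [hft, map_mul, map_pow, PowerSeries.map_X]
  obtain ⟨t22, c22, e22⟩ := exists_eq_X_pow_mul (hhc 2 2) o22
  obtain ⟨t23, c23, e23⟩ := exists_eq_X_pow_mul (hhc 2 3) o23
  obtain ⟨t33, c33, e33⟩ := exists_eq_X_pow_mul (hhc 3 3) o33
  obtain ⟨t24, c24, e24⟩ := exists_eq_X_pow_mul (hhc 2 4) o24
  obtain ⟨t34, c34, e34⟩ := exists_eq_X_pow_mul (hhc 3 4) o34
  have e32 := hconj e23
  have e42 := hconj e24
  have e43 := hconj e34
  rw [← hsw _ _ (by omega)] at e32 e42 e43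
  have hεc : (ε : ℂ) = 1 ∨ (ε : ℂ) = -1 := by
    rcases hε with rfl | rfl
    · left; simp
    · right; simp
  have h11 : cf 1 1 S = PowerSeries.C (ε : ℂ) * PowerSeries.X ^ μ := by
    rw [hS, cf_graphSeries, if_pos ⟨rfl, rfl⟩, h0 1 1 (by omega)]
    ring
  have h22 : cf 2 2 S = (PowerSeries.X ^ μ) ^ 2 * t22 := by
    rw [hcf _ _ (by omega), e22]
    ring
  obtain ⟨hg, ha, hb⟩ := htan.conv_rows hεc h11 h22 (t23 := t23) (t32 := conjU t23) (t33 := t33)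
    (t34 := t34) (t43 := conjU t34) (t42 := conjU t24)
    (by rw [hcf _ _ (by omega), e23]; ring) (by rw [hcf _ _ (by omega), e32]; ring)
    (by rw [hcf _ _ (by omega), e33]; ring) (by rw [hcf _ _ (by omega), e34]; ring)
    (by rw [hcf _ _ (by omega), e43]; ring) (by rw [hcf _ _ (by omega), e42]; ring)
    c22 c23 c23.conjU c33 c34 c34.conjU c24.conjU
  have hqc := htan.conv_snd h11 hg ha
  have hpc : Conv (X 1 * p) := by
    refine htan.conv_fst hεc h11 h22 hH.conv.quadraticPart (fun j => ?_) ha hb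
    rw [hcf _ _ (by omega), row_quadraticPart, cf_restSeries]
  refine Conv.of_X_pow_mul (i := 1) (a := k + 1) ?_
  have : X 1 ^ (k + 1) * subst Ψ (L i) =
      X 1 * p * pderiv ℂ 0 (Ψ i) + X 1 * q * pderiv ℂ 1 (Ψ i) := by
    linear_combination (-X 1) * hpq i
  rw [this]
  exact (hpc.mul (Conv.pderiv (hΨ i) 0)).add (((conv_X 1).mul hqc).mul (Conv.pderiv (hΨ i) 1))

end Pullback

section TaylorSeries

variable {M : Set C2} {p : C2} {ρ : C2 → ℝ} {r : FormalRing}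

theorem IsTaylorSeriesAt.eventually_ev (h : IsTaylorSeriesAt r ρ p) :
    ∀ᶠ x in 𝓝 (0 : C2), ev (Sum.elim x fun i => starRingEnd ℂ (x i)) r = (ρ (p + x) : ℂ) := by
  filter_upwards [h] with x hx
  rw [← hx.tsum_eq, ev]
  refine tsum_congr fun n => ?_
  rw [Fintype.prod_sum_type]
  rfl

theorem IsTaylorSeriesAt.conv (h : IsTaylorSeriesAt r ρ p) : Conv r := by
  obtain ⟨δ, hδ, hb⟩ := Metric.eventually_nhds_iff.1 h
  have hδ2 : 0 < δ / 2 := by positivity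
  have h1 := (hb (y := fun _ => ((δ / 2 : ℝ) : ℂ)) (by
    rw [dist_zero_right]
    refine lt_of_le_of_lt ((pi_norm_le_iff_of_nonneg hδ2.le).2 fun i => ?_) (half_lt_self hδ)
    rw [Complex.norm_real, Real.norm_of_nonneg hδ2.le])).summable
  refine conv_of_summable (t := (δ / 2).toNNReal) (by simpa using hδ2) (h1.congr fun n => ?_)
  simp only [Complex.conj_ofReal, Real.coe_toNNReal _ hδ2.le, Fintype.prod_sum_type]

theorem IsTaylorSeriesAt.ne_zero (h : IsTaylorSeriesAt r ρ p) (hρ : fderiv ℝ ρ p ≠ 0) :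
    r ≠ 0 := by
  rintro rfl
  refine hρ ?_
  have h1 : ∀ᶠ x in 𝓝 (0 : C2), ρ (p + x) = 0 := by
    filter_upwards [h.eventually_ev] with x hx
    rw [ev_zero] at hx
    exact_mod_cast hx.symm
  have h2 : Tendsto (fun y => y - p) (𝓝 p) (𝓝 (0 : C2)) := by
    have : Continuous fun y : C2 => y - p := by fun_prop
    simpa using this.tendsto p
  have h3 : ρ =ᶠ[𝓝 p] fun _ => 0 := by
    filter_upwards [h2.eventually h1] with y hy
    rwa [add_sub_cancel] at hy
  rw [h3.fderiv_eq, fderiv_fun_const]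
  rfl

/-- If a holomorphic map sends the hypersurface `v = V` into `M`, the pulled back defining series
of `M` vanishes on it. -/
theorem X_zero_dvd_subst_coordMap (hρ : IsDefiningFunctionAt ρ M p) (h : IsTaylorSeriesAt r ρ p)
    {Ψ : Fin 2 → MvPowerSeries (Fin 2) ℂ} (hΨ0 : ∀ i, constantCoeff (Ψ i) = 0)
    (hΨ : ∀ i, Conv (Ψ i)) {f : C2 → C2} (hf : ∀ᶠ x in 𝓝 (0 : C2), ∀ i, ev x (Ψ i) = f x i - p i)
    {v : ℂ → ℝ → ℝ} (hfM : ∀ᶠ x in 𝓝 (0 : C2), (x 1).im = v (x 0) (x 1).re → f x ∈ M)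
    {V : GraphRing} (hV : Conv V) (hV0 : constantCoeff V = 0)
    (hVv : ∀ᶠ q in 𝓝 (0 : ℂ × ℝ × ℝ), ev (realPoint q) V = (v q.1 q.2.2 : ℂ)) :
    X 0 ∣ subst (coordMap Ψ V) r := by
  set a : Fin 2 → GraphRing := ![X 1, X 3 + C Complex.I * V] with ha
  set a' : Fin 2 → GraphRing := ![X 2, X 3 - C Complex.I * V] with ha'
  have ha0 : ∀ i, constantCoeff (a i) = 0 := by
    intro i; fin_cases i <;> simp [ha, hV0]
  have ha0' : ∀ i, constantCoeff (a' i) = 0 := by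
    intro i; fin_cases i <;> simp [ha', hV0]
  have hIV : Conv (C Complex.I * V) := (conv_C _).mul hV
  have hac : ∀ i, Conv (a i) := by
    intro i
    fin_cases i
    exacts [conv_X _, (conv_X _).add hIV]
  have hac' : ∀ i, Conv (a' i) := by
    intro i
    fin_cases i
    exacts [conv_X _, (conv_X _).sub hIV]
  set b : Fin 2 ⊕ Fin 2 → GraphRing := Sum.elim (fun i => subst a (Ψ i))
    (fun i => subst a' (map (starRingEnd ℂ) (Ψ i))) with hb
  have hΨ0' : ∀ i, constantCoeff (map (starRingEnd ℂ) (Ψ i)) = 0 := fun i => by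
    rw [constantCoeff_map, hΨ0, map_zero]
  have hb0 : ∀ i, constantCoeff (b i) = 0 := by
    rintro (i | i)
    · exact constantCoeff_subst_eq_zero (hasSubst_of_constantCoeff_zero ha0) ha0 (hΨ0 i)
    · exact constantCoeff_subst_eq_zero (hasSubst_of_constantCoeff_zero ha0') ha0' (hΨ0' i)
  have hbc : ∀ i, Conv (b i) := by
    rintro (i | i)
    · exact (hΨ i).comp hac ha0
    · exact (hΨ i).map_conj.comp hac' ha0'
  -- `b` is the coordinate map restricted to `t = 0`
  have hsub : X 0 ∣ subst (coordMap Ψ V) r - subst b r := by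
    refine X_dvd_subst_sub_subst (hasSubst_coordMap hV0 hΨ0) (hasSubst_of_constantCoeff_zero hb0)
      ?_ r
    rintro (i | i)
    · refine X_dvd_subst_sub_subst (hasSubst_holVars hV0) (hasSubst_of_constantCoeff_zero ha0) ?_ _
      intro j
      fin_cases j
      · exact ⟨0, by simp [ha]⟩
      · refine ⟨C Complex.I, ?_⟩
        change wPlus V - (X 3 + C Complex.I * V) = _
        rw [wPlus]
        ring
    · refine X_dvd_subst_sub_subst (hasSubst_antiVars hV0) (hasSubst_of_constantCoeff_zero ha0') ?_ _
      intro j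
      fin_cases j
      · exact ⟨0, by simp [ha']⟩
      · refine ⟨-C Complex.I, ?_⟩
        change wMinus V - (X 3 - C Complex.I * V) = _
        rw [wMinus]
        ring
  suffices hz : subst b r = 0 by rwa [hz, sub_zero] at hsub
  refine Conv.eq_zero_of_conj (h.conv.comp hbc hb0) ?_
  have htail : Tendsto (fun x : Fin 4 → ℂ => fun i => ev x (a i)) (𝓝 0) (𝓝 0) :=
    tendsto_pi_nhds.2 fun i => (hac i).tendsto_ev (ha0 i)
  have hx : Tendsto (fun q => fun i => ev (realPoint q) (a i)) (𝓝 0) (𝓝 (0 : C2)) :=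
    htail.comp tendsto_realPoint
  have hy : Tendsto (fun x : C2 => fun i => ev x (Ψ i)) (𝓝 0) (𝓝 (0 : C2)) :=
    tendsto_pi_nhds.2 fun i => (hΨ i).tendsto_ev (hΨ0 i)
  have hpy : Tendsto (fun y : C2 => p + y) (𝓝 0) (𝓝 p) := by
    have : Continuous fun y : C2 => p + y := by fun_prop
    simpa using this.tendsto 0
  have hev : ∀ᶠ q in 𝓝 (0 : ℂ × ℝ × ℝ), ∀ i, ev (realPoint q) (subst a (Ψ i)) =
      ev (fun j => ev (realPoint q) (a j)) (Ψ i) :=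
    eventually_all.2 fun i => tendsto_realPoint.eventually ((hΨ i).eventually_ev_subst hac ha0)
  have hev' : ∀ᶠ q in 𝓝 (0 : ℂ × ℝ × ℝ), ∀ i,
      ev (realPoint q) (subst a' (map (starRingEnd ℂ) (Ψ i))) =
      ev (fun j => ev (realPoint q) (a' j)) (map (starRingEnd ℂ) (Ψ i)) :=
    eventually_all.2 fun i =>
      tendsto_realPoint.eventually ((hΨ i).map_conj.eventually_ev_subst hac' ha0')
  filter_upwards [hev, hev', tendsto_realPoint.eventually (h.conv.eventually_ev_subst hbc hb0),
    hx.eventually (hy.eventually h.eventually_ev), hx.eventually hf, hx.eventually hfM, hVv,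
    hx.eventually (hy.eventually (hpy.eventually hρ.eventually_mem_iff)),
    tendsto_realPoint.eventually ((conv_X 3).eventually_ev_add hIV),
    tendsto_realPoint.eventually ((conv_X 3).eventually_ev_add hIV.neg)]
    with q h1 h2 h3 h4 h5 h6 h7 h8 h9 h10
  change ev (realPoint q) _ = 0
  have e1 : ev (realPoint q) (a 1) = (q.2.2 : ℂ) + Complex.I * (v q.1 q.2.2 : ℂ) := by
    change ev (realPoint q) (X 3 + C Complex.I * V) = _
    rw [h9, ev_X, ev_C_mul, h7]
    rfl
  have e0 : ev (realPoint q) (a 0) = q.1 := ev_X _ _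
  have hneg : ev (realPoint q) (-(C Complex.I * V)) = -(Complex.I * ev (realPoint q) V) := by
    have := ev_C_mul (-Complex.I) V (realPoint q)
    rwa [map_neg, neg_mul, neg_mul] at this
  have ec : (fun j => ev (realPoint q) (a' j)) =
      fun j => starRingEnd ℂ (ev (realPoint q) (a j)) := by
    funext j
    fin_cases j
    · change ev (realPoint q) (X 2) = starRingEnd ℂ (ev (realPoint q) (a 0))
      rw [e0, ev_X]
      rfl
    · change ev (realPoint q) (X 3 - C Complex.I * V) = starRingEnd ℂ (ev (realPoint q) (a 1))
      rw [e1, sub_eq_add_neg, h10, hneg, h7, ev_X, map_add, map_mul, Complex.conj_ofReal,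
        Complex.conj_ofReal, Complex.conj_I]
      change (q.2.2 : ℂ) + _ = _
      ring
  have hmem : f (fun i => ev (realPoint q) (a i)) ∈ M := by
    refine h6 ?_
    rw [e1, e0]
    simp
  have hfy : f (fun i => ev (realPoint q) (a i)) =
      p + fun i => ev (fun j => ev (realPoint q) (a j)) (Ψ i) := by
    funext i
    rw [Pi.add_apply, h5 i]
    ring
  rw [hfy] at hmem
  have hρ0 := h8.1 hmem
  have hbe : (fun i => ev (realPoint q) (b i)) =
      Sum.elim (fun i => ev (fun j => ev (realPoint q) (a j)) (Ψ i))
        fun i => starRingEnd ℂ (ev (fun j => ev (realPoint q) (a j)) (Ψ i)) := by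
    funext i
    rcases i with i | i
    · exact h1 i
    · refine (h2 i).trans ?_
      rw [ec, ev_conj_map_conj]
      rfl
  rw [h3, hbe, h4, hρ0, Complex.ofReal_zero]

end TaylorSeries

/-! ### Convergence under holomorphic and monomial maps -/

theorem ev_at_zero {σ : Type*} [Fintype σ] (f : MvPowerSeries σ ℂ) :
    ev 0 f = constantCoeff f := by
  classical
  rw [ev, tsum_eq_single 0]
  · simp
  · intro n hn
    obtain ⟨i, hi⟩ := Finsupp.ne_iff.1 hn
    rw [Finset.prod_eq_zero (Finset.mem_univ i) (by rw [Pi.zero_apply, zero_pow (by simpa using hi)]), mul_zero]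

/-- The power series `Ψ i` converge, and they are the components of the Taylor expansion at the
origin of the holomorphic map `f - f 0`. -/
structure IsExpansion (Ψ : Fin 2 → MvPowerSeries (Fin 2) ℂ) (f : C2 → C2) : Prop where
  conv : ∀ i, Conv (Ψ i)
  eventually_ev : ∀ᶠ x in 𝓝 (0 : C2), ∀ i, ev x (Ψ i) = f x i - f 0 i

section Expansion

variable {A B Ψ G : Fin 2 → MvPowerSeries (Fin 2) ℂ} {f g ψ : C2 → C2} {p : C2}

theorem exists_isExpansion (hf : AnalyticAt ℂ f 0) : ∃ Ψ, IsExpansion Ψ f := by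
  have h : ∀ i, ∃ g : MvPowerSeries (Fin 2) ℂ,
      Conv g ∧ ∀ᶠ x in 𝓝 (0 : C2), ev x g = f x i - f 0 i := fun i =>
    exists_conv_of_analyticAt (((ContinuousLinearMap.proj (R := ℂ) (φ := fun _ : Fin 2 => ℂ)
      i).analyticAt _).comp hf |>.sub analyticAt_const)
  choose Ψ h1 h2 using h
  exact ⟨Ψ, h1, eventually_all.2 h2⟩

theorem IsExpansion.constantCoeff_eq_zero (h : IsExpansion Ψ f) (i : Fin 2) :
    constantCoeff (Ψ i) = 0 := by
  rw [← ev_at_zero, h.eventually_ev.self_of_nhds i, sub_self]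

theorem IsExpansion.hasSubst (h : IsExpansion Ψ f) : HasSubst Ψ :=
  hasSubst_of_constantCoeff_zero h.constantCoeff_eq_zero

theorem IsExpansion.tendsto_ev (h : IsExpansion Ψ f) :
    Tendsto (fun x => fun i => ev x (Ψ i)) (𝓝 0) (𝓝 0) :=
  tendsto_pi_nhds.2 fun i => (h.conv i).tendsto_ev (h.constantCoeff_eq_zero i)

theorem IsExpansion.congr (hA : IsExpansion A f) (hB : IsExpansion B g)
    (hfg : ∀ᶠ x in 𝓝 0, f x = g x) : A = B := by
  funext i
  rw [← sub_eq_zero]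
  refine ((hA.conv i).sub (hB.conv i)).eq_zero_of_eventually ?_
  have h := ((hA.conv i).sub (hB.conv i)).eventually_ev_add (hB.conv i)
  filter_upwards [h, hA.eventually_ev, hB.eventually_ev, hfg] with x h h1 h2 h3
  rw [sub_add_cancel, h1, h2, h3, hfg.self_of_nhds] at h
  exact left_eq_add.1 (add_comm (g x i - g 0 i) _ ▸ h)

theorem isExpansion_X : IsExpansion X id :=
  ⟨conv_X, Eventually.of_forall fun x i => by simp [ev_X]⟩

theorem IsExpansion.comp (hB : IsExpansion B g) (hA : IsExpansion A f) (hf : f 0 = 0) :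
    IsExpansion (fun i => subst A (B i)) (g ∘ f) := by
  refine ⟨fun i => (hB.conv i).comp hA.conv hA.constantCoeff_eq_zero, ?_⟩
  have h := eventually_all.2 fun i =>
    (hB.conv i).eventually_ev_subst hA.conv hA.constantCoeff_eq_zero
  filter_upwards [h, hA.eventually_ev, hA.tendsto_ev.eventually hB.eventually_ev] with x h h1 h2 i
  rw [h, h2]
  have : (fun i => ev x (A i)) = f x := funext fun i => by simp [h1, hf]
  rw [this, Function.comp_apply, Function.comp_apply, hf]

theorem subst_subst_eq_self (hA : IsExpansion A f) (hB : IsExpansion B g)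
    (h : (fun i => subst B (A i)) = X) (P : MvPowerSeries (Fin 2) ℂ) : subst B (subst A P) = P := by
  rw [subst_comp_subst_apply hA.hasSubst hB.hasSubst, h, subst_self]
  rfl

/-- The inverse function theorem, for local coordinates. -/
theorem IsLocalCoordinatesAt.exists_inverse (h : IsLocalCoordinatesAt ψ p) :
    ∃ g : C2 → C2, AnalyticAt ℂ g 0 ∧ g 0 = 0 ∧ (∀ᶠ x in 𝓝 0, g (ψ x - p) = x) ∧
      ∀ᶠ y in 𝓝 0, ψ (g y) = y + p := by
  obtain ⟨e, he⟩ := h.isInvertible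
  have hs : HasStrictFDerivAt ψ (e : C2 →L[ℂ] C2) 0 := he ▸ h.analyticAt.hasStrictFDerivAt
  have ht : Tendsto (fun y : C2 => y + p) (𝓝 0) (𝓝 (ψ 0)) := by
    have : Tendsto (fun y : C2 => y + p) (𝓝 0) (𝓝 (0 + p)) :=
      (continuous_id.add continuous_const).tendsto 0
    rwa [zero_add, ← congrArg 𝓝 h.map_zero] at this
  have ha := (hs.toOpenPartialHomeomorph ψ).analyticAt_symm'
    hs.mem_toOpenPartialHomeomorph_source h.analyticAt he.symm
  refine ⟨fun y => hs.localInverse ψ e 0 (y + p), ?_, ?_, ?_, ?_⟩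
  · refine AnalyticAt.fun_comp (g := hs.localInverse ψ e 0) ?_ (analyticAt_id.add analyticAt_const)
    rw [zero_add]
    exact h.map_zero ▸ ha
  · have := hs.localInverse_apply_image
    rwa [h.map_zero, ← zero_add p] at this
  · filter_upwards [hs.eventually_left_inverse] with x hx
    rwa [sub_add_cancel]
  · exact ht.eventually hs.eventually_right_inverse

/-- A formal power series converges if it does so in other local coordinates. -/
theorem IsLocalCoordinatesAt.conv_of_conv_subst (h : IsLocalCoordinatesAt ψ p)
    (hΨ : IsExpansion Ψ ψ) {P : MvPowerSeries (Fin 2) ℂ} (hP : Conv (subst Ψ P)) : Conv P := by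
  obtain ⟨g, hga, hg0, -, hg⟩ := h.exists_inverse
  obtain ⟨G, hG⟩ := exists_isExpansion hga
  have hcomp : (fun i => subst G (Ψ i)) = X := by
    have h1 := hΨ.comp hG hg0
    have h2 : IsExpansion (fun i => subst G (Ψ i)) id := ⟨h1.conv, by
      filter_upwards [h1.eventually_ev, hg] with x hx hx2 i
      rw [hx, Function.comp_apply, Function.comp_apply, hx2, hg0, h.map_zero]
      simp⟩
    exact h2.congr isExpansion_X (Eventually.of_forall fun _ => rfl)
  rw [← subst_subst_eq_self hΨ hG hcomp P]
  exact hP.comp hG.conv hG.constantCoeff_eq_zero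

/-- The chain rule for Jacobian determinants. -/
theorem jacDet_subst (hA : HasSubst A) (hA0 : ∀ i, constantCoeff (A i) = 0) :
    jacDet (fun i => subst A (B i)) = subst A (jacDet B) * jacDet A := by
  have hm : ∀ P Q : MvPowerSeries (Fin 2) ℂ, subst A (P * Q) = subst A P * subst A Q :=
    subst_mul hA
  simp only [jacDet, pderiv_subst hA0, Fin.sum_univ_two, subst_sub hA, hm]
  ring

theorem jacDet_X : jacDet X = 1 := by
  rw [jacDet, pderiv_X_self, pderiv_X_self, pderiv_X_of_ne (by decide)]
  simp

theorem IsLocalCoordinatesAt.isUnit_jacDet (h : IsLocalCoordinatesAt ψ p) (hΨ : IsExpansion Ψ ψ) :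
    IsUnit (jacDet Ψ) := by
  obtain ⟨g, hga, hg0, hg, -⟩ := h.exists_inverse
  obtain ⟨G, hG⟩ := exists_isExpansion hga
  have hΨ' : IsExpansion Ψ (fun x => ψ x - p) := ⟨hΨ.conv, by simpa using hΨ.eventually_ev⟩
  have hcomp : (fun i => subst Ψ (G i)) = X :=
    (hG.comp hΨ' (by rw [h.map_zero, sub_self])).congr isExpansion_X hg
  have := jacDet_subst (B := G) hΨ.hasSubst hΨ.constantCoeff_eq_zero
  rw [hcomp, jacDet_X] at this
  exact IsUnit.of_mul_eq_one_right _ this.symm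

end Expansion

section Monomial

/-- The components of the monomial map `(ξ, η) ↦ (ξ η ^ s, η ^ l)`, as power series. -/
def blowUp (s l : ℕ) : Fin 2 → MvPowerSeries (Fin 2) ℂ := ![X 0 * X 1 ^ s, X 1 ^ l]

/-- The action of the monomial map `blowUp s l` on exponents. -/
def blowUpExpo (s l : ℕ) (d : Fin 2 →₀ ℕ) : Fin 2 →₀ ℕ :=
  Finsupp.single 0 (d 0) + Finsupp.single 1 (s * d 0 + l * d 1)

variable {s l : ℕ}

theorem blowUpExpo_injective (hl : 1 ≤ l) : Function.Injective (blowUpExpo s l) := by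
  intro d d' h
  have h0 := DFunLike.congr_fun h 0
  have h1 := DFunLike.congr_fun h 1
  simp only [blowUpExpo, Finsupp.add_apply, Finsupp.single_apply, if_true, if_false, one_ne_zero,
    zero_ne_one, add_zero, zero_add] at h0 h1
  rw [h0, add_right_inj] at h1
  ext i
  fin_cases i
  · exact h0
  · exact Nat.eq_of_mul_eq_mul_left hl h1

theorem prod_blowUp (d : Fin 2 →₀ ℕ) :
    (d.prod fun i k => blowUp s l i ^ k) = monomial (blowUpExpo s l d) 1 := by
  rw [Finsupp.prod_fintype _ _ (fun i => pow_zero _), Fin.prod_univ_two]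
  change (X 0 * X 1 ^ s) ^ d 0 * (X 1 ^ l) ^ d 1 = _
  rw [mul_pow, ← pow_mul, ← pow_mul, mul_assoc, ← pow_add, X_pow_eq, X_pow_eq,
    monomial_mul_monomial, one_mul, blowUpExpo]

theorem isExpansion_blowUp (hl : 1 ≤ l) :
    IsExpansion (blowUp s l) fun x => ![x 0 * x 1 ^ s, x 1 ^ l] := by
  have h1 : ∀ k, Conv (X 1 ^ k : MvPowerSeries (Fin 2) ℂ) := fun k => (conv_X 1).pow k
  refine ⟨fun i => ?_, ?_⟩
  · fin_cases i
    exacts [(conv_X 0).mul (h1 s), h1 l]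
  · filter_upwards [(conv_X 0).eventually_ev_mul (h1 s)] with x hx i
    fin_cases i
    · simpa [blowUp, ev_X, ev_X_pow] using hx
    · simp [blowUp, ev_X_pow, zero_pow (by omega : l ≠ 0)]

theorem coeff_subst_blowUp (hl : 1 ≤ l) (P : MvPowerSeries (Fin 2) ℂ)
    (d : Fin 2 →₀ ℕ) : coeff (blowUpExpo s l d) (subst (blowUp s l) P) = coeff d P := by
  classical
  rw [coeff_subst (isExpansion_blowUp hl).hasSubst, finsum_eq_single _ d]
  · rw [prod_blowUp, coeff_monomial_same, smul_eq_mul, mul_one]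
  · intro d' hd
    rw [prod_blowUp, coeff_monomial_ne ((blowUpExpo_injective hl).ne hd.symm), smul_zero]

/-- A formal power series converges if its pullback under a monomial map does: the pullback has the
same coefficients, at exponents whose degree has grown by a bounded factor. -/
theorem conv_of_conv_subst_blowUp (hl : 1 ≤ l) {P : MvPowerSeries (Fin 2) ℂ}
    (h : Conv (subst (blowUp s l) P)) : Conv P := by
  obtain ⟨t, ht, h⟩ := h
  set t' := min t 1 with ht'
  have h0 : 0 < t' := lt_min ht one_pos
  have h1 : t' ≤ 1 := min_le_right _ _
  refine ⟨t' ^ (s + l + 1), pow_pos h0 _, ?_⟩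
  have h' : wnorm t' (subst (blowUp s l) P) ≠ ⊤ :=
    ne_top_of_le_ne_top h (wnorm_mono (by exact_mod_cast min_le_left t 1) _)
  refine ne_top_of_le_ne_top h' (le_trans ?_
    (ENNReal.tsum_comp_le_tsum_of_injective (blowUpExpo_injective (s := s) hl) _))
  refine ENNReal.tsum_le_tsum fun d => ?_
  rw [coeff_subst_blowUp hl, ENNReal.coe_pow, ← pow_mul]
  refine mul_le_mul' le_rfl (pow_le_pow_right_of_le_one' (by exact_mod_cast h1) ?_)
  rw [Finsupp.degree_eq_sum, Finsupp.degree_eq_sum, Fin.sum_univ_two, Fin.sum_univ_two]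
  simp only [blowUpExpo, Finsupp.add_apply, Finsupp.single_apply, if_true, if_false, one_ne_zero,
    zero_ne_one, add_zero, zero_add]
  nlinarith [Nat.zero_le (s * d 1), Nat.zero_le (l * d 0)]

theorem jacDet_blowUp (hl : 1 ≤ l) :
    jacDet (blowUp s l) = X 1 ^ (s + l - 1) * C (l : ℂ) := by
  obtain ⟨k, rfl⟩ : ∃ k, l = k + 1 := ⟨l - 1, by omega⟩
  have h0 : pderiv ℂ 0 (X 1 : MvPowerSeries (Fin 2) ℂ) = 0 := pderiv_X_of_ne (by decide)
  have e0 : blowUp s (k + 1) 0 = X 0 * X 1 ^ s := rfl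
  have e1 : blowUp s (k + 1) 1 = X 1 ^ (k + 1) := rfl
  rw [jacDet, e0, e1, Derivation.leibniz, Derivation.leibniz_pow, Derivation.leibniz_pow,
    Derivation.leibniz_pow, h0, pderiv_X_self, pderiv_X_self]
  simp only [smul_zero, mul_zero, sub_zero, zero_add, smul_eq_mul, mul_one, nsmul_eq_mul,
    Nat.add_sub_cancel]
  rw [show s + (k + 1) - 1 = s + k by omega, map_natCast]
  ring

end Monomial

/-! ### Blow-ups -/

section Geometry

variable {M : Set C2} {p : C2} {Ψ : Fin 2 → MvPowerSeries (Fin 2) ℂ} {ψ f : C2 → C2} {m : ℕ}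
  {ε : ℝ} {h : ℕ → ℕ → PowerSeries ℂ} {H : ℂ → ℝ → ℝ}

/-- Along a germ of an analytic function `γ` with `|Im γ| ≤ |Re γ| / 2`, the values of `γ` do not
fill a neighbourhood of the origin, so that `γ` is constant. -/
theorem eventually_eq_zero_of_abs_im_le {γ : ℂ → ℂ} (hγ : AnalyticAt ℂ γ 0) (h0 : γ 0 = 0)
    (h : ∀ᶠ ξ in 𝓝 0, |(γ ξ).im| ≤ |(γ ξ).re| / 2) : ∀ᶠ ξ in 𝓝 0, γ ξ = 0 := by
  rcases hγ.eventually_constant_or_nhds_le_map_nhds with hc | hc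
  · rwa [h0] at hc
  · rw [h0] at hc
    have h1 : ∀ᶠ y in 𝓝 (0 : ℂ), |y.im| ≤ |y.re| / 2 := hc h
    have ht : Tendsto (fun t : ℝ => (t : ℂ) * Complex.I) (𝓝[≠] 0) (𝓝 0) := by
      have : Continuous fun t : ℝ => (t : ℂ) * Complex.I := by fun_prop
      exact (this.tendsto' 0 0 (by simp)).mono_left nhdsWithin_le_nhds
    obtain ⟨t, ht1, ht2⟩ := ((ht.eventually h1).and self_mem_nhdsWithin).exists
    simp at ht1 ht2
    exact absurd ht1 ht2

/-- The right hand side of an admissible equation is small compared to `u`. -/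
theorem IsRestSum.eventually_abs_le (hH : IsRestSum h H) (h0 : ∀ k l, k < 2 ∨ l < 2 → h k l = 0)
    (μ : ℕ) : ∀ᶠ q in 𝓝 (0 : ℂ × ℝ × ℝ),
      |q.2.2 ^ (μ + 1) * (ε * ‖q.1‖ ^ 2 + H q.1 q.2.2)| ≤ |q.2.2| / 2 := by
  have hc : constantCoeff (graphSeries μ ε h) = 0 := by
    obtain ⟨a, ha⟩ := X_one_dvd_graphSeries (μ := μ) (ε := ε) h0
    rw [ha, map_mul, constantCoeff_X, zero_mul]
  have hcv := hH.conv_graphSeries (μ := μ) (ε := ε)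
  have ht := (hcv.tendsto_ev hc).comp tendsto_realPoint
  filter_upwards [hH.eventually_ev_graphSeries (μ := μ) (ε := ε),
    ht.eventually (Metric.ball_mem_nhds 0 (half_pos one_pos)),
    tendsto_realPoint.eventually ((conv_X 3).eventually_ev_mul hcv)] with q h1 h2 h3
  rw [h3, ev_X] at h1
  have h4 := congrArg norm h1
  rw [Complex.norm_real, norm_mul, Real.norm_eq_abs] at h4
  rw [← h4]
  have h5 : ‖realPoint q 3‖ = |q.2.2| := Complex.norm_real _
  have h6 : ‖ev (realPoint q) (graphSeries μ ε h)‖ < 1 / 2 := mem_ball_zero_iff.1 h2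
  rw [h5, div_eq_mul_one_div]
  gcongr

/-- If `M` contains the line `{η = 0}`, this line is `{w = 0}` in any coordinates in which `M` is
given by an admissible equation. Hence `η` is a unit multiple of `w`. -/
theorem exists_snd_eq_X_one_mul (hψ : IsLocalCoordinatesAt ψ 0) (hΨ : IsExpansion Ψ ψ)
    (hline : ∀ᶠ x in 𝓝 (0 : C2), x 1 = 0 → x ∈ M) (hm : 1 ≤ m)
    (hM : IsAdmissibleEquation M ψ m ε h) :
    ∃ u, IsUnit u ∧ Ψ 1 = X 1 * u := by
  obtain ⟨h0, H, hH, heq⟩ := hM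
  obtain ⟨μ, rfl⟩ : ∃ μ, m = μ + 1 := ⟨m - 1, by omega⟩
  obtain ⟨g, hga, hg0, hgl, hgr⟩ := hψ.exists_inverse
  obtain ⟨G, hG⟩ := exists_isExpansion hga
  have hι : AnalyticAt ℂ (fun ξ : ℂ => (![ξ, 0] : C2)) 0 := by
    refine AnalyticAt.pi fun i => ?_
    fin_cases i
    exacts [analyticAt_id, analyticAt_const]
  have hι0 : (![(0 : ℂ), 0] : C2) = 0 := by simp
  have hιt : Tendsto (fun ξ : ℂ => (![ξ, 0] : C2)) (𝓝 0) (𝓝 0) := by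
    have := hι.continuousAt.tendsto
    rwa [hι0] at this
  have hgt : Tendsto g (𝓝 0) (𝓝 0) := by
    have := hga.continuousAt.tendsto
    rwa [hg0] at this
  have hgι : AnalyticAt ℂ (fun ξ : ℂ => g ![ξ, 0]) 0 :=
    AnalyticAt.fun_comp (g := g) (by rwa [hι0]) hι
  have hγ : AnalyticAt ℂ (fun ξ : ℂ => g ![ξ, 0] 1) 0 :=
    ((ContinuousLinearMap.proj (R := ℂ) (φ := fun _ : Fin 2 => ℂ) 1).analyticAt _).comp hgι
  have hqt : Tendsto (fun x : C2 => ((x 0, 0, (x 1).re) : ℂ × ℝ × ℝ)) (𝓝 0) (𝓝 0) := by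
    have : Continuous fun x : C2 => ((x 0, 0, (x 1).re) : ℂ × ℝ × ℝ) := by fun_prop
    exact this.tendsto' _ _ (by simp)
  -- `γ ξ = w(ξ, 0)` satisfies `|Im γ| ≤ |Re γ| / 2` by the equation of `M`
  have hz := eventually_eq_zero_of_abs_im_le hγ (by simp [hι0, hg0]) (by
    filter_upwards [hιt.eventually hline, hιt.eventually hgr, (hgt.comp hιt).eventually heq,
      ((hqt.comp hgt).comp hιt).eventually (IsRestSum.eventually_abs_le (ε := ε) hH h0 μ)]
      with ξ h1 h2 h3 h4
    rw [Function.comp_apply, h2, add_zero] at h3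
    rw [h3.1 (h1 rfl)]
    exact h4)
  -- the second component `G 1` of the inverse map vanishes on the line
  set a : Fin 2 → MvPowerSeries (Fin 2) ℂ := ![X 0, 0] with ha
  have ha0 : ∀ i, constantCoeff (a i) = 0 := by
    intro i
    fin_cases i <;> simp [ha]
  have hac : ∀ i, Conv (a i) := by
    intro i
    fin_cases i
    exacts [conv_X 0, show Conv 0 from map_zero (C (σ := Fin 2) (R := ℂ)) ▸ conv_C 0]
  have hsub0 : subst a (G 1) = 0 := by
    refine ((hG.conv 1).comp hac ha0).eq_zero_of_eventually ?_
    have hx0 : Tendsto (fun x : C2 => x 0) (𝓝 0) (𝓝 0) := (continuous_apply 0).tendsto 0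
    filter_upwards [(hG.conv 1).eventually_ev_subst hac ha0, hx0.eventually hz,
      (hιt.comp hx0).eventually hG.eventually_ev] with x h1 h2 h3
    have h4 : (fun i => ev x (a i)) = ![x 0, 0] := by
      funext i
      fin_cases i
      · exact ev_X 0 x
      · exact ev_zero x
    rw [h1, h4]
    have h5 := h3 1
    rw [Function.comp_apply, h2, hg0] at h5
    simpa using h5
  have hdvd : X 1 ∣ G 1 := by
    have := X_dvd_subst_sub_subst (a := X) (b := a) (s := (1 : Fin 2)) HasSubst.X
      (hasSubst_of_constantCoeff_zero ha0) (fun i => by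
        fin_cases i
        · simp [ha]
        · simp [ha]) (G 1)
    rwa [hsub0, sub_zero, subst_self] at this
  obtain ⟨q, hq⟩ := hdvd
  have hcomp : (fun i => subst Ψ (G i)) = X := by
    have hΨ' : IsExpansion Ψ (fun x => ψ x - 0) := by simpa using hΨ
    exact (hG.comp hΨ' (by rw [hψ.map_zero, sub_self])).congr isExpansion_X hgl
  have h1 : X 1 = Ψ 1 * subst Ψ q := by
    have h2 : subst Ψ (G 1) = X 1 := congrFun hcomp 1
    rw [← h2, hq, subst_mul hΨ.hasSubst, subst_X hΨ.hasSubst]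
  -- the derivative of `w = Ψ 1 * (q ∘ Ψ)` with respect to `w` is `1` at the origin
  have hu : IsUnit (subst Ψ q) := by
    rw [MvPowerSeries.isUnit_iff_constantCoeff, isUnit_iff_ne_zero]
    intro hc
    have h2 := congrArg (fun f => constantCoeff (pderiv ℂ 1 f)) h1
    simp only [pderiv_X_self, Derivation.leibniz, map_one, map_add, smul_eq_mul, map_mul, hc,
      hΨ.constantCoeff_eq_zero, zero_mul, add_zero] at h2
    exact one_ne_zero h2
  obtain ⟨v, hv⟩ := hu.exists_right_inv
  exact ⟨v, IsUnit.of_mul_eq_one_right _ hv, by rw [h1, mul_assoc, hv, mul_one]⟩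

/-- A formal infinitesimal automorphism converges after pulling it back by a holomorphic map into
`M` from a Fuchsian hypersurface in admissible coordinates, provided that the map ramifies only
along the complex locus `w = 0`. -/
theorem conv_subst_of_eventually_mem (hf0 : f 0 = p) (hΨ : IsExpansion Ψ f) {k : ℕ}
    {e : MvPowerSeries (Fin 2) ℂ} (he : IsUnit e) (hJ : jacDet Ψ = X 1 ^ k * e) (hm : 1 ≤ m)
    (hε : ε = 1 ∨ ε = -1) {M' : Set C2} {ψ' : C2 → C2} (hM' : IsAdmissibleEquation M' ψ' m ε h)
    (o22 : ((m - 1 : ℕ) : ℕ∞) ≤ (h 2 2).order) (o23 : ((2 * (m - 1) : ℕ) : ℕ∞) ≤ (h 2 3).order)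
    (o33 : ((2 * (m - 1) : ℕ) : ℕ∞) ≤ (h 3 3).order)
    (o24 : ((3 * (m - 1) : ℕ) : ℕ∞) ≤ (h 2 4).order)
    (o34 : ((3 * (m - 1) : ℕ) : ℕ∞) ≤ (h 3 4).order)
    (hfM : ∀ᶠ x in 𝓝 (0 : C2), ψ' x ∈ M' → f x ∈ M) {L : FormalVectorField}
    (hL : IsFormalInfinitesimalAutomorphismAt M p L) (i : Fin 2) : Conv (subst Ψ (L i)) := by
  obtain ⟨ρ, r, hρ, hr, hdvd⟩ := hL
  obtain ⟨h0, H, hH, heq⟩ := hM'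
  replace hH : IsRestSum h H := hH
  obtain ⟨μ, rfl⟩ : ∃ μ, m = μ + 1 := ⟨m - 1, by omega⟩
  rw [Nat.add_sub_cancel] at o22 o23 o33 o24 o34
  obtain ⟨e', he'⟩ := he.exists_right_inv
  refine conv_subst_of_dvd hΨ.constantCoeff_eq_zero hΨ.conv he' hJ (hr.ne_zero hρ.fderiv_ne_zero)
    hdvd hε h0 hH o22 o23 o33 o24 o34 ?_ i
  refine X_zero_dvd_subst_coordMap hρ hr hΨ.constantCoeff_eq_zero hΨ.conv (f := f)
    (hf0 ▸ hΨ.eventually_ev) (v := fun z u => u ^ (μ + 1) * (ε * ‖z‖ ^ 2 + H z u)) ?_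
    ((conv_X 3).mul hH.conv_graphSeries) (by simp) hH.eventually_ev_graphSeries
  filter_upwards [heq, hfM] with x h1 h2 h3 using h2 (h1.2 h3)

end Geometry

/-! ### The theorem -/

section Main

variable {M : Set C2} {p : C2} {L : FormalVectorField}

theorem conv_of_isFuchsianInAdmissibleCoordinatesAt
    (hM : IsFuchsianInAdmissibleCoordinatesAt M p)
    (hL : IsFormalInfinitesimalAutomorphismAt M p L) (i : Fin 2) : Conv (L i) := by
  obtain ⟨ψ, m, ε, h, hψ, hm, hε, heq, o22, o23, o33, o24, o34⟩ := hM
  obtain ⟨Ψ, hΨ⟩ := exists_isExpansion hψ.analyticAt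
  refine hψ.conv_of_conv_subst hΨ ?_
  exact conv_subst_of_eventually_mem hψ.map_zero hΨ (k := 0) (hψ.isUnit_jacDet hΨ)
    (by rw [pow_zero, one_mul]) hm hε heq o22 o23 o33 o24 o34 (Eventually.of_forall fun _ h => h)
    hL i

/-- The composition of admissible coordinates of the blow-up, of the monomial map and of the
coordinates of `M` ramifies only along the complex locus of the blow-up, and the pullbacks of power
series under its three factors reflect convergence. -/
theorem conv_of_isMonomialBlowUpAt {M' : Set C2} (hb : IsMonomialBlowUpAt M' M p)
    (hM : IsFuchsianInAdmissibleCoordinatesAt M' 0)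
    (hL : IsFormalInfinitesimalAutomorphismAt M p L) (i : Fin 2) : Conv (L i) := by
  obtain ⟨-, hline, φ, s, l, hφ, -, hl, hmap⟩ := hb
  obtain ⟨ψ, m, ε, h, hψ, hm, hε, heq, o22, o23, o33, o24, o34⟩ := hM
  obtain ⟨Φ, hΦ⟩ := exists_isExpansion hφ.analyticAt
  obtain ⟨Ψ, hΨ⟩ := exists_isExpansion hψ.analyticAt
  obtain ⟨u, hu, hΨu⟩ := exists_snd_eq_X_one_mul hψ hΨ hline hm heq
  have hB := isExpansion_blowUp (s := s) hl
  have hB0 : (![(0 : C2) 0 * (0 : C2) 1 ^ s, (0 : C2) 1 ^ l] : C2) = 0 := by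
    simp [zero_pow (by omega : l ≠ 0)]
  have hψt : Tendsto ψ (𝓝 0) (𝓝 0) := by
    have := hψ.analyticAt.continuousAt.tendsto
    rwa [hψ.map_zero] at this
  have hΦB := hΦ.comp hB hB0
  have hΦBΨ := hΦB.comp hΨ hψ.map_zero
  have hun : ∀ {A : Fin 2 → MvPowerSeries (Fin 2) ℂ}, HasSubst A → ∀ {P}, IsUnit P →
      IsUnit (subst A P : MvPowerSeries (Fin 2) ℂ) := fun hA _ hP => by
    rw [← substAlgHom_apply (R := ℂ) hA]
    exact hP.map _
  have hlu : IsUnit (C (l : ℂ) : MvPowerSeries (Fin 2) ℂ) :=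
    (isUnit_iff_ne_zero.2 (by exact_mod_cast (by omega : l ≠ 0))).map C
  have hJ : jacDet (fun i => subst Ψ (subst (blowUp s l) (Φ i))) = X 1 ^ (s + l - 1) *
      (u ^ (s + l - 1) * subst Ψ (subst (blowUp s l) (jacDet Φ) * C (l : ℂ)) * jacDet Ψ) := by
    rw [jacDet_subst (B := fun i => subst (blowUp s l) (Φ i)) hΨ.hasSubst hΨ.constantCoeff_eq_zero,
      jacDet_subst hB.hasSubst hB.constantCoeff_eq_zero, jacDet_blowUp hl, mul_left_comm,
      subst_mul hΨ.hasSubst, subst_pow hΨ.hasSubst, subst_X hΨ.hasSubst, hΨu]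
    ring
  have hconv := conv_subst_of_eventually_mem (M := M) (p := p) (M' := M') (ψ' := ψ) (L := L)
    (by simp only [Function.comp_apply, hψ.map_zero, hB0, hφ.map_zero]) hΦBΨ
    (((hu.pow _).mul (hun hΨ.hasSubst ((hun hB.hasSubst (hφ.isUnit_jacDet hΦ)).mul hlu))).mul
      (hψ.isUnit_jacDet hΨ)) hJ hm hε heq o22 o23 o33 o24 o34
    (hψt.eventually hmap) hL i
  rw [← subst_comp_subst_apply hΦB.hasSubst hΨ.hasSubst,
    ← subst_comp_subst_apply hΦ.hasSubst hB.hasSubst] at hconv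
  exact hφ.conv_of_conv_subst hΦ (conv_of_conv_subst_blowUp hl (hψ.conv_of_conv_subst hΨ hconv))

end Main

end FuchsianCR

end

theorem mainTheorem3 (M : Set FuchsianCR.C2) (p : FuchsianCR.C2)
    (hM : FuchsianCR.IsRealAnalyticHypersurfaceAt M p)
    (hflat : ¬ FuchsianCR.IsLeviFlatAt M p)
    (hmin : FuchsianCR.IsNonminimalAt M p)
    (hfuchs : FuchsianCR.IsFuchsianTypeAt M p)
    (L : FuchsianCR.FormalVectorField)
    (hL : FuchsianCR.IsFormalInfinitesimalAutomorphismAt M p L) :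
    L.IsConvergent := by
  intro i
  refine (FuchsianCR.conv_iff_isConvergent _).1 ?_
  rcases hfuchs with ⟨-, hF⟩ | ⟨-, M', hb, -, hF⟩
  · exact FuchsianCR.conv_of_isFuchsianInAdmissibleCoordinatesAt hF hL i
  · exact FuchsianCR.conv_of_isMonomialBlowUpAt hb hF hL i
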